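/- There are a constant $c\ge 2$ and a constant $k$ such that for every $a\in\mathbb N$ there are a constant $C$ and a randomized algorithm in the incidence-list query model with the following guarantee. Let $G$ be a simple graph with $n\ge 1$ vertices, numbered $1,\dots,n$, given by an arbitrarily ordered list of neighbors for each vertex, and let $\lambda$ be the arboricity of $G$, that is, the minimum number of forests into which the edges of $G$ can be partitioned. The algorithm is a single program, the same for all graphs and all $n$. It is given $n$, and it can access $G$ only through degree queries (which return the degree of a vertex $v$) and neighbor queries (which return the $i$-th neighbor of $v$, or $\bot$ if $v$ has fewer than $i$ neighbors). It runs on a randomized word RAM with words of $\Theta(\log n)$ bits, where every elementary operation (arithmetic or comparison of words, memory access, drawing a uniformly random integer below a given word, control flow, query) takes one unit of time. Put $$B=C\cdot\frac{n}{\max(1,\lambda)}\cdot(\log (n+1))^{k},$$ which is $\tilde O(n/\lambda)$ if $G$ has an edge. Then, with probability at least $1-1/n^{a}$, the algorithm halts after at most $B$ units of time, having made at most $B$ queries, and outputs a value $\hat\lambda$ with $$\frac{\lambda}{c}\le\hat\lambda\le\lambda .$$ Moreover, its expected running time (and hence its expected number of queries) is at most $B$. -/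

import Mathlib

/-- The arboricity of a graph: the minimum number of forests into which its edges can be
partitioned. -/
noncomputable def arboricity {V : Type*} (G : SimpleGraph V) : ℕ :=
  sInf {k : ℕ | ∃ F : Fin k → SimpleGraph V,
    (∀ i, (F i).IsAcyclic) ∧ (∀ i j, i ≠ j → Disjoint (F i) (F j)) ∧ (⨆ i, F i) = G}

/-- An incidence-list representation of a graph: for every vertex, the list of its neighbours, each
occurring once, in an arbitrary order. -/
structure IncidenceList {n : ℕ} (G : SimpleGraph (Fin n)) where
  nbrs : Fin n → List (Fin n)
  nodup : ∀ v, (nbrs v).Nodup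
  mem_nbrs : ∀ v u, u ∈ nbrs v ↔ G.Adj v u

namespace IncidenceList

variable {n : ℕ} {G : SimpleGraph (Fin n)}

/-- The degree query. The vertices are numbered `1, …, n`: number `v` is the vertex `v - 1` of
`Fin n`. The answer is `0` if `v` is not the number of a vertex. -/
def degreeQuery (L : IncidenceList G) (v : ℕ) : ℕ :=
  if h : 1 ≤ v ∧ v ≤ n then (L.nbrs ⟨v - 1, by omega⟩).length else 0

/-- The neighbour query: the number of the `i`-th neighbour (`i = 1, 2, …`) of the vertex with
number `v` if it has at least `i` neighbours, and `0` (which stands for `⊥`) otherwise. -/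
def neighborQuery (L : IncidenceList G) (v i : ℕ) : ℕ :=
  if h : (1 ≤ v ∧ v ≤ n) ∧ 1 ≤ i then
    match (L.nbrs ⟨v - 1, by omega⟩)[i - 1]? with
    | some u => (u : ℕ) + 1
    | none => 0
  else 0

end IncidenceList

namespace WordRAM

/-- The arithmetic and comparison operations of the machine. -/
inductive BinOp
  | add
  | sub
  | mul
  | div
  | mod
  | lt
  | eq

/-- Evaluation of an operation on `w`-bit words: results are reduced modulo `2 ^ w`
(a difference that would be negative is `0`, and so is a quotient by `0`; comparisons return
`1` or `0`). -/
def BinOp.eval (w : ℕ) : BinOp → ℕ → ℕ → ℕ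
  | add, x, y => (x + y) % 2 ^ w
  | sub, x, y => x - y
  | mul, x, y => (x * y) % 2 ^ w
  | div, x, y => x / y
  | mod, x, y => x % y
  | lt, x, y => if x < y then 1 % 2 ^ w else 0
  | eq, x, y => if x = y then 1 % 2 ^ w else 0

/-- Programs of a randomized word RAM with access to the incidence lists of a graph.
The arguments `r`, `a`, `b`, `v`, `i` are indices of registers. -/
inductive Cmd
  /-- write the constant `x` to register `r` -/
  | const (r x : ℕ)
  /-- apply an operation to registers `a` and `b`, and write the result to `r` -/
  | bin (o : BinOp) (r a b : ℕ)
  /-- load to `r` the memory cell whose address is in `a` -/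
  | load (r a : ℕ)
  /-- store `r` to the memory cell whose address is in `a` -/
  | store (a r : ℕ)
  /-- write to `r` a fresh uniformly random element of `{0, …, x - 1}`, `x` the content of `a` -/
  | rand (r a : ℕ)
  /-- write to `r` the answer to the degree query for the vertex whose number is in `v` -/
  | degree (r v : ℕ)
  /-- write to `r` the answer to the neighbour query for the contents of `v` and `i` -/
  | neighbor (r v i : ℕ)
  /-- sequential composition -/
  | seq (p q : Cmd)
  /-- run `p` if register `r` is nonzero, and `q` otherwise -/
  | ite (r : ℕ) (p q : Cmd)
  /-- run `p` repeatedly as long as register `r` is nonzero -/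
  | loop (r : ℕ) (p : Cmd)

/-- The registers and the memory of the machine, and the number of queries made so far. -/
structure Store where
  reg : ℕ → ℕ
  mem : ℕ → ℕ
  queries : ℕ

/-- Write `x` to register `r`. -/
def Store.setReg (s : Store) (r x : ℕ) : Store :=
  { s with reg := Function.update s.reg r x }

/-- Write `x` to the memory cell with address `p`. -/
def Store.setMem (s : Store) (p x : ℕ) : Store :=
  { s with mem := Function.update s.mem p x }

/-- Write the answer `x` of a query to register `r`, and count the query. -/
def Store.answer (s : Store) (r x : ℕ) : Store :=
  { s.setReg r x with queries := s.queries + 1 }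

/-- A configuration: the stack of the commands that are still to be run, and the store. -/
structure Config where
  todo : List Cmd
  store : Store

/-- The machine has halted when no command is left. -/
def Config.Halted (x : Config) : Prop := x.todo = []

/-- The output is the content of register `0`. -/
def Config.output (x : Config) : ℕ := x.store.reg 0

/-- A uniformly random element of `{0, …, m - 1}` (and `0` if `m = 0`). -/
noncomputable def uniformBelow : ℕ → PMF ℕ
  | 0 => PMF.pure 0
  | m + 1 => (PMF.uniformOfFintype (Fin (m + 1))).map (fun i => (i : ℕ))

variable {n : ℕ} {G : SimpleGraph (Fin n)}

/-- One step of the machine with `w`-bit words. A halted machine does not change any more. -/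
noncomputable def step (w : ℕ) (L : IncidenceList G) : Config → PMF Config
  | ⟨[], s⟩ => PMF.pure ⟨[], s⟩
  | ⟨.const r x :: K, s⟩ => PMF.pure ⟨K, s.setReg r (x % 2 ^ w)⟩
  | ⟨.bin o r a b :: K, s⟩ => PMF.pure ⟨K, s.setReg r (o.eval w (s.reg a) (s.reg b))⟩
  | ⟨.load r a :: K, s⟩ => PMF.pure ⟨K, s.setReg r (s.mem (s.reg a))⟩
  | ⟨.store a r :: K, s⟩ => PMF.pure ⟨K, s.setMem (s.reg a) (s.reg r)⟩
  | ⟨.rand r a :: K, s⟩ => (uniformBelow (s.reg a)).map fun x => ⟨K, s.setReg r x⟩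
  | ⟨.degree r v :: K, s⟩ => PMF.pure ⟨K, s.answer r (L.degreeQuery (s.reg v))⟩
  | ⟨.neighbor r v i :: K, s⟩ =>
      PMF.pure ⟨K, s.answer r (L.neighborQuery (s.reg v) (s.reg i))⟩
  | ⟨.seq p q :: K, s⟩ => PMF.pure ⟨p :: q :: K, s⟩
  | ⟨.ite r p q :: K, s⟩ => PMF.pure ⟨(if s.reg r ≠ 0 then p else q) :: K, s⟩
  | ⟨.loop r p :: K, s⟩ => PMF.pure ⟨if s.reg r ≠ 0 then p :: .loop r p :: K else K, s⟩

/-- The distribution of the configuration `t` steps after a given one. -/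
noncomputable def steps (w : ℕ) (L : IncidenceList G) : ℕ → Config → PMF Config
  | 0, x => PMF.pure x
  | t + 1, x => (step w L x).bind (steps w L t)

/-- A randomized algorithm: one fixed program for all inputs, and the constant factor in the word
length `Θ(log n)`. -/
structure Algorithm where
  prog : Cmd
  wordFactor : ℕ
  wordFactor_pos : 0 < wordFactor

/-- The word length on graphs with `n` vertices. -/
def Algorithm.wordLength (A : Algorithm) (n : ℕ) : ℕ := A.wordFactor * (Nat.log 2 n + 1)

/-- The initial configuration: register `0` holds the number of vertices, and all other registers
and memory cells hold `0`. -/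
def Algorithm.init (A : Algorithm) (n : ℕ) : Config :=
  ⟨[A.prog], ⟨Function.update (fun _ => 0) 0 n, fun _ => 0, 0⟩⟩

/-- The distribution of the configuration after `t` steps on a given graph. -/
noncomputable def Algorithm.run (A : Algorithm) (L : IncidenceList G) (t : ℕ) : PMF Config :=
  steps (A.wordLength n) L t (A.init n)

/-- The expected number `∑ₜ ℙ(not halted after t steps)` of steps until the machine halts. -/
noncomputable def Algorithm.expectedTime (A : Algorithm) (L : IncidenceList G) : ENNReal :=
  ∑' t : ℕ, (A.run L t).toOuterMeasure {x | ¬ x.Halted}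

end WordRAM

/-- The bound `C · (n / λ) · (log (n + 1)) ^ k`, where `λ` is the arboricity of the `n`-vertex
graph `G`, or `1` if `G` has no edges. -/
noncomputable def softBound (C : ℝ) (k : ℕ) {n : ℕ} (G : SimpleGraph (Fin n)) : ℝ :=
  C * ((n : ℝ) / max 1 (arboricity G : ℝ)) * Real.log ((n : ℝ) + 1) ^ k

/-!
The algorithm estimates the arboricity `α` by testing thresholds `T = n, n / 2, n / 4, …`, until a
test reports that the graph has a dense core. A test for the threshold `T` takes time `Õ(n / T)`, and
is likely to give the right answer if `32 * α ≤ T` (no) or `480 * T ≤ α` (yes). It is based on the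
peeling of vertices: if vertices with fewer than about `T` remaining neighbours are removed again and
again, then everything is peeled off if `T` is large compared to `α`, while a subgraph of minimum
degree at least `480 * T` stays. Such a subgraph exists if `480 * T ≤ α`, because a graph in which
every subgraph has a vertex of degree less than `k` is a union of `k - 1` forests
(`IncidenceList.exists_core`).

Whether a vertex `v` is peeled off is explored by a randomized recursive process (`Peeling.Peeler`).
It draws random neighbours of `v`, about `deg v / T` for each survivor that it asks for, and starts
their processes; if too few of these survive, it dies. Concurrently it starts the same process with
twice the effort, which reduces the probability of a wrong death, and it shares its time fairly among
all of its children. Two facts about these processes carry the test.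

* If `480 * T ≤ α`, the process of a vertex in the core survives forever with probability at least
  `1 / 2` (`Peeling.death_mkVertex_le`, by a Chernoff bound). There are at least `480 * T` such
  vertices.
* If `32 * α ≤ T`, the expected lifetime of the processes is constant on average over all vertices
  (`Peeling.sum_startLife_le`). A partition of the edges into `α` forests orients the graph such that
  every vertex has at most `α` outgoing edges (`IncidenceList.exists_orientation`). In a batch of
  draws, it is unlikely that many of them are along outgoing edges. Otherwise, at least half of the
  time of the batch goes to children along incoming edges, because time is shared fairly, so that
  the total lifetime is bounded by the sum over the vertices of the lifetimes of their
  in-neighbours, with a factor of order `1 / T`. In this double sum each vertex is counted at most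
  `α` times.

The test runs the processes of `O(log n) * (n / T)` random vertices, for at most `n / T` units of time
each, and reports a dense core if they use up a budget of `O(log n) * (n / T)` units. Both errors have
exponentially small probability (`Peeling.tester_true_le_of_sparse`,
`Peeling.tester_false_le_of_core`). Hence the search stops at a threshold that is proportional to `α`,
or reaches `0` if `α` is bounded, and the time is dominated by the smallest threshold that is tested
(`Peeling.search_not_good_le`, `Peeling.search_refines`).

On the word RAM, the tree of processes is kept in memory, with the children of a process in a linked
queue. As every process that passes on time has at least two children, a unit of time reaches
logarithmic depth only (`Peeling.Balanced`), and takes `O(log n)` steps (`Peeling.give_refines`). That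
the machine simulates the abstract experiments is expressed by `WordRAM.Refines`. The expected
running time follows since even the bad runs take polynomial time, and their probability is smaller
than the inverse of this polynomial.
-/


open scoped ENNReal

/-! ### Expectations of probability mass functions -/

namespace PMF

variable {α β : Type}

/-- The expectation of an extended nonnegative function. -/
noncomputable def expect (μ : PMF α) (f : α → ℝ≥0∞) : ℝ≥0∞ := ∑' a, μ a * f a

theorem expect_pure (a : α) (f : α → ℝ≥0∞) : (PMF.pure a).expect f = f a := by
  unfold expect
  rw [tsum_eq_single a]
  · simp
  · intro b hb
    simp [PMF.pure_apply, hb]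

theorem expect_bind (μ : PMF α) (ν : α → PMF β) (f : β → ℝ≥0∞) :
    (μ.bind ν).expect f = μ.expect fun a => (ν a).expect f := by
  unfold expect
  simp only [PMF.bind_apply, ← ENNReal.tsum_mul_right, ← ENNReal.tsum_mul_left]
  rw [ENNReal.tsum_comm]
  simp only [mul_assoc]

theorem expect_map (μ : PMF α) (h : α → β) (f : β → ℝ≥0∞) :
    (μ.map h).expect f = μ.expect fun a => f (h a) := by
  unfold PMF.map
  rw [expect_bind]
  simp [expect_pure]

theorem expect_mono_of_support {μ : PMF α} {f g : α → ℝ≥0∞} (h : ∀ a, μ a ≠ 0 → f a ≤ g a) :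
    μ.expect f ≤ μ.expect g := by
  unfold expect
  refine ENNReal.tsum_le_tsum fun a => ?_
  by_cases ha : μ a = 0
  · simp [ha]
  · exact mul_le_mul_right (h a ha) _

theorem expect_mono {μ : PMF α} {f g : α → ℝ≥0∞} (h : ∀ a, f a ≤ g a) :
    μ.expect f ≤ μ.expect g :=
  expect_mono_of_support fun a _ => h a

theorem expect_const (μ : PMF α) (c : ℝ≥0∞) : (μ.expect fun _ => c) = c := by
  unfold expect
  rw [ENNReal.tsum_mul_right, μ.tsum_coe, one_mul]

theorem expect_add (μ : PMF α) (f g : α → ℝ≥0∞) :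
    (μ.expect fun a => f a + g a) = μ.expect f + μ.expect g := by
  unfold expect
  simp only [mul_add]
  exact ENNReal.tsum_add

theorem expect_const_mul (μ : PMF α) (c : ℝ≥0∞) (f : α → ℝ≥0∞) :
    (μ.expect fun a => c * f a) = c * μ.expect f := by
  unfold expect
  rw [← ENNReal.tsum_mul_left]
  exact tsum_congr fun a => by ring

theorem expect_mul_const (μ : PMF α) (c : ℝ≥0∞) (f : α → ℝ≥0∞) :
    (μ.expect fun a => f a * c) = μ.expect f * c := by
  simp only [mul_comm _ c, expect_const_mul]

theorem expect_le_const {μ : PMF α} {f : α → ℝ≥0∞} {c : ℝ≥0∞} (h : ∀ a, μ a ≠ 0 → f a ≤ c) :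
    μ.expect f ≤ c :=
  (expect_mono_of_support h).trans_eq (expect_const μ c)

theorem expect_uniformOfFintype_fin (m : ℕ) (f : Fin (m + 1) → ℝ≥0∞) :
    (PMF.uniformOfFintype (Fin (m + 1))).expect f = (∑ i, f i) / ((m + 1 : ℕ) : ℝ≥0∞) := by
  unfold expect
  rw [tsum_fintype]
  simp only [PMF.uniformOfFintype_apply, Fintype.card_fin]
  rw [← Finset.mul_sum, mul_comm, div_eq_mul_inv]

theorem toOuterMeasure_eq_expect (μ : PMF α) (s : Set α) :
    μ.toOuterMeasure s = μ.expect (s.indicator 1) := by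
  rw [PMF.toOuterMeasure_apply]
  unfold expect
  refine tsum_congr fun a => ?_
  by_cases h : a ∈ s <;> simp [h]

theorem bind_apply_ne_zero {μ : PMF α} {ν : α → PMF β} {b : β} :
    μ.bind ν b ≠ 0 ↔ ∃ a, μ a ≠ 0 ∧ ν a b ≠ 0 := by
  rw [← PMF.mem_support_iff, PMF.mem_support_bind_iff]
  simp [PMF.mem_support_iff]

theorem map_apply_ne_zero {μ : PMF α} {f : α → β} {b : β} :
    μ.map f b ≠ 0 ↔ ∃ a, μ a ≠ 0 ∧ f a = b := by
  rw [← PMF.mem_support_iff, PMF.mem_support_map_iff]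
  simp [PMF.mem_support_iff]

theorem pure_apply_ne_zero {a b : α} : (PMF.pure a) b ≠ 0 ↔ b = a := by
  rw [← PMF.mem_support_iff, PMF.mem_support_pure_iff]

theorem exists_of_expect_ne_zero {μ : PMF α} {f : α → ℝ≥0∞} (h : μ.expect f ≠ 0) :
    ∃ a, μ a ≠ 0 ∧ f a ≠ 0 := by
  by_contra! hcon
  refine h (le_antisymm (expect_le_const fun a ha => (hcon a ha).le) (by simp))

end PMF

/-! ### Simulation of random experiments by the machine -/

namespace WordRAM

variable {n : ℕ} {G : SimpleGraph (Fin n)} (w : ℕ) (L : IncidenceList G)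

/-- The expected value of `g` at the configuration reached after `B` steps from `x`. -/
noncomputable def val (g : Config → ℝ≥0∞) (B : ℕ) (x : Config) : ℝ≥0∞ :=
  (steps w L B x).expect g

/-- A value function that does not decrease along a step, such as the indicator of an event that
implies halting. -/
def Monotonic (g : Config → ℝ≥0∞) : Prop := ∀ x, g x ≤ (step w L x).expect g

variable {w L}
variable {g : Config → ℝ≥0∞}

theorem val_zero (x : Config) : val w L g 0 x = g x := PMF.expect_pure _ _

theorem val_succ (B : ℕ) (x : Config) :
    val w L g (B + 1) x = (step w L x).expect (val w L g B) := PMF.expect_bind _ _ _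

theorem Monotonic.val_le_succ (hg : Monotonic w L g) (B : ℕ) (x : Config) :
    val w L g B x ≤ val w L g (B + 1) x := by
  induction B generalizing x with
  | zero =>
    rw [val_zero, val_succ]
    refine (hg x).trans (PMF.expect_mono fun y => ?_)
    rw [val_zero]
  | succ B ih =>
    rw [val_succ, val_succ (B + 1)]
    exact PMF.expect_mono ih

theorem Monotonic.val_mono (hg : Monotonic w L g) {B B' : ℕ} (h : B ≤ B') (x : Config) :
    val w L g B x ≤ val w L g B' x := by
  induction h with
  | refl => rfl
  | step _ ih => exact ih.trans (hg.val_le_succ _ x)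

theorem monotonic_of_halted {E : Set Config} (hE : ∀ x ∈ E, x.Halted) :
    Monotonic w L (E.indicator 1) := by
  intro x
  by_cases hx : x ∈ E
  · obtain ⟨K, s⟩ := x
    have : K = [] := hE _ hx
    subst this
    rw [step, PMF.expect_pure]
  · simp [hx]

variable (w L)

/-- The largest number of steps that a command without loops takes. -/
def Cmd.size : Cmd → ℕ
  | .seq p q => 1 + p.size + q.size
  | .ite _ p q => 1 + max p.size q.size
  | _ => 1

/-- Commands without loops and random choices. -/
def Cmd.Plain : Cmd → Prop
  | .rand _ _ => False
  | .loop _ _ => False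
  | .seq p q => p.Plain ∧ q.Plain
  | .ite _ p q => p.Plain ∧ q.Plain
  | _ => True

/-- The effect of a command without loops and random choices. -/
def Cmd.eval : Cmd → Store → Store
  | .const r x, s => s.setReg r (x % 2 ^ w)
  | .bin o r a b, s => s.setReg r (o.eval w (s.reg a) (s.reg b))
  | .load r a, s => s.setReg r (s.mem (s.reg a))
  | .store a r, s => s.setMem (s.reg a) (s.reg r)
  | .degree r v, s => s.answer r (L.degreeQuery (s.reg v))
  | .neighbor r v i, s => s.answer r (L.neighborQuery (s.reg v) (s.reg i))
  | .seq p q, s => q.eval (p.eval s)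
  | .ite r p q, s => if s.reg r ≠ 0 then p.eval s else q.eval s
  | _, s => s

variable {w L}

theorem Monotonic.val_plain (hg : Monotonic w L g) :
    ∀ (c : Cmd), c.Plain → ∀ (K : List Cmd) (s : Store) (B : ℕ),
      val w L g B ⟨K, c.eval w L s⟩ ≤ val w L g (B + c.size) ⟨c :: K, s⟩
  | .const r x, _, K, s, B => by
    simp only [Cmd.size, val_succ, step, PMF.expect_pure, Cmd.eval]; rfl
  | .bin o r a b, _, K, s, B => by
    simp only [Cmd.size, val_succ, step, PMF.expect_pure, Cmd.eval]; rfl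
  | .load r a, _, K, s, B => by
    simp only [Cmd.size, val_succ, step, PMF.expect_pure, Cmd.eval]; rfl
  | .store a r, _, K, s, B => by
    simp only [Cmd.size, val_succ, step, PMF.expect_pure, Cmd.eval]; rfl
  | .degree r v, _, K, s, B => by
    simp only [Cmd.size, val_succ, step, PMF.expect_pure, Cmd.eval]; rfl
  | .neighbor r v i, _, K, s, B => by
    simp only [Cmd.size, val_succ, step, PMF.expect_pure, Cmd.eval]; rfl
  | .seq p q, hc, K, s, B => by
    have e : B + (Cmd.seq p q).size = B + q.size + p.size + 1 := by
      simp only [Cmd.size]; omega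
    rw [e, val_succ, step, PMF.expect_pure]
    exact (Monotonic.val_plain hg q hc.2 K _ B).trans
      (Monotonic.val_plain hg p hc.1 (q :: K) s (B + q.size))
  | .ite r p q, hc, K, s, B => by
    have e : B + (Cmd.ite r p q).size = B + max p.size q.size + 1 := by
      simp only [Cmd.size]; omega
    rw [e, val_succ, step, PMF.expect_pure, Cmd.eval]
    split_ifs with h
    · exact (Monotonic.val_plain hg p hc.1 K s B).trans (hg.val_mono (by omega) _)
    · exact (Monotonic.val_plain hg q hc.2 K s B).trans (hg.val_mono (by omega) _)
  | .rand _ _, hc, _, _, _ => hc.elim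
  | .loop _ _, hc, _, _, _ => hc.elim

variable (w L)
variable {α β : Type}

/-- A probabilistic refinement triple. From the store `s`, the machine with the stack `K` simulates
the abstract random outcome `μ`: on the outcome `a` it arrives, within `t a` steps, at the stack
`K'` and at a store that is related to `a` by `R`. It is phrased by lower bounds on the expectation
of a monotonic value function, so that running times may be overestimated, and outcomes that
contribute nothing need not be reached in time. -/
def Refines (K : List Cmd) (s : Store) (K' : List Cmd) (μ : PMF α) (t : α → ℕ)
    (R : α → Store → Prop) : Prop :=
  ∀ g, Monotonic w L g → ∀ (B : ℕ) (φ : α → ℝ≥0∞),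
    (∀ a, μ a ≠ 0 → φ a ≠ 0 →
      t a ≤ B ∧ ∀ s', R a s' → φ a ≤ val w L g (B - t a) ⟨K', s'⟩) →
      μ.expect φ ≤ val w L g B ⟨K, s⟩

variable {w L}
variable {K K' K'' : List Cmd} {s : Store}

theorem Refines.of_eq {a : α} {R : α → Store → Prop} {t : α → ℕ} (h : R a s) :
    Refines w L K s K (PMF.pure a) t R := by
  intro g hg B φ hφ
  rw [PMF.expect_pure]
  by_cases h0 : φ a = 0
  · simp [h0]
  obtain ⟨h1, h2⟩ := hφ a (by simp) h0
  exact (h2 s h).trans (hg.val_mono (by omega) _)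

theorem Refines.plain {c : Cmd} (hc : c.Plain) {a : α} {R : α → Store → Prop} {t : α → ℕ}
    (ht : c.size ≤ t a) (h : R a (c.eval w L s)) :
    Refines w L (c :: K) s K (PMF.pure a) t R := by
  intro g hg B φ hφ
  rw [PMF.expect_pure]
  by_cases h0 : φ a = 0
  · simp [h0]
  obtain ⟨h1, h2⟩ := hφ a (by simp) h0
  refine (h2 _ h).trans ((hg.val_plain c hc K s _).trans (hg.val_mono (by omega) _))

/-- Composition: the second experiment may depend on the outcome of the first one. -/
theorem Refines.trans {μ : PMF α} {ν : α → PMF β} {t₁ : α → ℕ} {t₂ : α → β → ℕ} {t : β → ℕ}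
    {R₁ : α → Store → Prop} {R₂ : β → Store → Prop}
    (h₁ : Refines w L K s K' μ t₁ R₁)
    (h₂ : ∀ a, μ a ≠ 0 → ∀ s', R₁ a s' → Refines w L K' s' K'' (ν a) (t₂ a) R₂)
    (ht : ∀ a b, μ a ≠ 0 → ν a b ≠ 0 → t₁ a + t₂ a b ≤ t b) :
    Refines w L K s K'' (μ.bind ν) t R₂ := by
  intro g hg B φ hφ
  rw [PMF.expect_bind]
  refine h₁ g hg B _ fun a ha ha' => ?_
  have key : ∀ b, ν a b ≠ 0 → φ b ≠ 0 → t b ≤ B := fun b hb hb' =>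
    (hφ b (PMF.bind_apply_ne_zero.2 ⟨a, ha, hb⟩) hb').1
  obtain ⟨b₀, hb₀, hb₀'⟩ := PMF.exists_of_expect_ne_zero ha'
  refine ⟨by have := key b₀ hb₀ hb₀'; have := ht a b₀ ha hb₀; omega, fun s' hs' => ?_⟩
  refine h₂ a ha s' hs' g hg _ φ fun b hb hb' => ?_
  have h3 := key b hb hb'
  have h4 := ht a b ha hb
  refine ⟨by omega, fun s'' hs'' => ?_⟩
  refine ((hφ b (PMF.bind_apply_ne_zero.2 ⟨a, ha, hb⟩) hb').2 s'' hs'').trans (hg.val_mono ?_ _)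
  omega

/-- Prefixing a deterministic command. -/
theorem Refines.plain_cons {c : Cmd} (hc : c.Plain) {μ : PMF α} {R : α → Store → Prop}
    {t t' : α → ℕ} (h : Refines w L K (c.eval w L s) K' μ t R)
    (ht : ∀ a, μ a ≠ 0 → c.size + t a ≤ t' a) :
    Refines w L (c :: K) s K' μ t' R := by
  have h1 : Refines w L (c :: K) s K (PMF.pure ()) (fun _ => c.size)
      (fun _ s' => s' = c.eval w L s) := Refines.plain hc le_rfl rfl
  have := Refines.trans (ν := fun _ => μ) (t := t') h1 (t₂ := fun _ => t) (R₂ := R) (K'' := K')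
    (fun _ _ s' hs' => by subst hs'; exact h) (fun a b _ hb => ht b hb)
  simpa using this

theorem Refines.mono {μ : PMF α} {t t' : α → ℕ} {R R' : α → Store → Prop}
    (h : Refines w L K s K' μ t R) (ht : ∀ a, μ a ≠ 0 → t a ≤ t' a)
    (hR : ∀ a, μ a ≠ 0 → ∀ s', R a s' → R' a s') :
    Refines w L K s K' μ t' R' := by
  intro g hg B φ hφ
  refine h g hg B φ fun a ha ha' => ⟨(ht a ha).trans (hφ a ha ha').1, fun s' hs' => ?_⟩
  exact ((hφ a ha ha').2 s' (hR a ha s' hs')).trans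
    (hg.val_mono (by have := ht a ha; have := (hφ a ha ha').1; omega) _)

theorem Refines.map {μ : PMF α} {f : α → β} {t : α → ℕ} {t' : β → ℕ} {R : α → Store → Prop}
    {R' : β → Store → Prop}
    (h : Refines w L K s K' μ t R) (ht : ∀ a, μ a ≠ 0 → t a ≤ t' (f a))
    (hR : ∀ a, μ a ≠ 0 → ∀ s', R a s' → R' (f a) s') :
    Refines w L K s K' (μ.map f) t' R' := by
  intro g hg B φ hφ
  rw [PMF.expect_map]
  refine h.mono ht hR g hg B _ fun a ha ha' => hφ (f a) ?_ ha'
  exact PMF.map_apply_ne_zero.2 ⟨a, ha, rfl⟩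

/-- Prefixing one step of the machine. -/
theorem Refines.of_step {c : Cmd} {μ : PMF α} {t t' : α → ℕ} {R : α → Store → Prop}
    {K₁ : List Cmd}
    (hstep : step w L ⟨c :: K, s⟩ = PMF.pure ⟨K₁, s⟩)
    (h : Refines w L K₁ s K' μ t R) (ht : ∀ a, μ a ≠ 0 → t a + 1 ≤ t' a) :
    Refines w L (c :: K) s K' μ t' R := by
  intro g hg B φ hφ
  by_cases h0 : μ.expect φ = 0
  · simp [h0]
  obtain ⟨a₀, ha₀, ha₀'⟩ := PMF.exists_of_expect_ne_zero h0
  have hB : 1 ≤ B := by have := ht a₀ ha₀; have := (hφ a₀ ha₀ ha₀').1; omega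
  obtain ⟨B, rfl⟩ := Nat.exists_eq_add_of_le' hB
  rw [val_succ, hstep, PMF.expect_pure]
  refine h g hg B φ fun a ha ha' => ?_
  have h1 := ht a ha
  have h2 := (hφ a ha ha').1
  exact ⟨by omega, fun s' hs' => ((hφ a ha ha').2 s' hs').trans (hg.val_mono (by omega) _)⟩

theorem Refines.rand {r a : ℕ} {t : ℕ → ℕ} {R : ℕ → Store → Prop}
    (ht : ∀ x, uniformBelow (s.reg a) x ≠ 0 → 1 ≤ t x)
    (h : ∀ x, uniformBelow (s.reg a) x ≠ 0 → R x (s.setReg r x)) :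
    Refines w L (.rand r a :: K) s K (uniformBelow (s.reg a)) t R := by
  intro g hg B φ hφ
  by_cases h0 : (uniformBelow (s.reg a)).expect φ = 0
  · simp [h0]
  obtain ⟨x₀, hx₀, hx₀'⟩ := PMF.exists_of_expect_ne_zero h0
  have hB : 1 ≤ B := (ht x₀ hx₀).trans (hφ x₀ hx₀ hx₀').1
  obtain ⟨B, rfl⟩ := Nat.exists_eq_add_of_le' hB
  rw [val_succ, step, PMF.expect_map]
  refine PMF.expect_mono_of_support fun x hx => ?_
  by_cases hx' : φ x = 0
  · simp [hx']
  refine ((hφ x hx hx').2 _ (h x hx)).trans (hg.val_mono (by have := ht x hx; omega) _)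

theorem Refines.seq {p q : Cmd} {μ : PMF α} {t t' : α → ℕ} {R : α → Store → Prop}
    (h : Refines w L (p :: q :: K) s K' μ t R) (ht : ∀ a, μ a ≠ 0 → t a + 1 ≤ t' a) :
    Refines w L (.seq p q :: K) s K' μ t' R :=
  .of_step rfl h ht

theorem Refines.ite {r : ℕ} {p q : Cmd} {μ : PMF α} {t t' : α → ℕ} {R : α → Store → Prop}
    (h : Refines w L ((if s.reg r ≠ 0 then p else q) :: K) s K' μ t R)
    (ht : ∀ a, μ a ≠ 0 → t a + 1 ≤ t' a) :
    Refines w L (.ite r p q :: K) s K' μ t' R :=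
  .of_step rfl h ht

theorem Refines.loop_true {r : ℕ} {p : Cmd} {μ : PMF α} {t t' : α → ℕ} {R : α → Store → Prop}
    (hr : s.reg r ≠ 0) (h : Refines w L (p :: .loop r p :: K) s K' μ t R)
    (ht : ∀ a, μ a ≠ 0 → t a + 1 ≤ t' a) :
    Refines w L (.loop r p :: K) s K' μ t' R :=
  .of_step (by rw [step, if_pos hr]) h ht

theorem Refines.loop_false {r : ℕ} {p : Cmd} {μ : PMF α} {t t' : α → ℕ} {R : α → Store → Prop}
    (hr : s.reg r = 0) (h : Refines w L K s K' μ t R)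
    (ht : ∀ a, μ a ≠ 0 → t a + 1 ≤ t' a) :
    Refines w L (.loop r p :: K) s K' μ t' R :=
  .of_step (by rw [step, if_neg (by simp [hr])]) h ht

theorem step_queries_le {x y : Config} (h : step w L x y ≠ 0) :
    y.store.queries ≤ x.store.queries + 1 := by
  obtain ⟨K, s⟩ := x
  rcases K with _ | ⟨c, K⟩
  · rw [step, PMF.pure_apply_ne_zero] at h
    subst h; simp
  cases c <;> simp only [step, PMF.pure_apply_ne_zero, PMF.map_apply_ne_zero] at h
  case rand => obtain ⟨x, -, rfl⟩ := h; simp [Store.setReg]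
  all_goals subst h; simp [Store.setReg, Store.setMem, Store.answer]

/-- A run makes at most one query per step. -/
theorem steps_queries_le {t : ℕ} {x y : Config} (h : steps w L t x y ≠ 0) :
    y.store.queries ≤ x.store.queries + t := by
  induction t generalizing x with
  | zero =>
    rw [steps, PMF.pure_apply_ne_zero] at h
    subst h; simp
  | succ t ih =>
    rw [steps, PMF.bind_apply_ne_zero] at h
    obtain ⟨z, h1, h2⟩ := h
    have := ih h2
    have := step_queries_le h1
    omega

end WordRAM

/-! ### Peeling processes -/

namespace Peeling

/-- The state of a peeling process: a tree of processes that are run concurrently. A process is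
meant to find out whether its vertex `v` is peeled off a graph with adjacency lists `N` when
vertices with few remaining neighbours, compared to a threshold `T`, are removed again and again; it
dies if it finds this out. There are two kinds of processes, with a parameter `th` that controls the
effort:

* a batch (`isBatch = true`) draws `th * (deg v / T)` random neighbours of `v`, runs the processes
  of those with degree at least `T`, and dies as soon as fewer than `th` of the draws survive;
* the process of a vertex (`isBatch = false`) runs a batch with parameter `th`, and the process of
  the same vertex with parameter `2 * th`. It dies as soon as one of them dies.

`rem` is the number of children that still have to be created, and `sl` is the number of children
that may still die without killing the process. The living children are served in rounds: `td` are
those that still have to be served in the current round, and `dn` are the others. The neighbours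
`dr` that a batch has drawn do not affect the process, but are used in its analysis. -/
inductive Peeler (n : ℕ)
  | node (v : Fin n) (isBatch : Bool) (th rem sl : ℕ) (dr : List (Fin n))
      (dn td : List (Peeler n))

variable {n : ℕ}

namespace Peeler

/-- The vertex that a process is about. -/
def vertex : Peeler n → Fin n
  | node v _ _ _ _ _ _ _ => v

/-- The process of the vertex `v` with parameter `th`, before it has received any time. -/
def mkVertex (v : Fin n) (th : ℕ) : Peeler n := node v false th 2 0 [] [] []

end Peeler

open Peeler

variable (N : Fin n → List (Fin n)) (T : ℕ)

/-- A batch of the vertex `v` with parameter `th`, before it has received any time. -/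
def mkBatch (v : Fin n) (th : ℕ) : Peeler n :=
  node v true th (th * ((N v).length / T)) (th * ((N v).length / T) - th) [] [] []

/-- A uniformly random neighbour of `v` (and `v` itself if it has none). -/
noncomputable def pick (v : Fin n) : PMF (Fin n) :=
  (WordRAM.uniformBelow (N v).length).map fun x => (N v)[x]?.getD v

/-- The process that is started for a vertex. It is dead at once if the degree is less than `T`. -/
def start (v : Fin n) : Option (Peeler n) :=
  if T ≤ (N v).length then some (mkVertex v 2) else none

/-- The state of a process after one of its children has received a unit of time, where `td` are
the other children that still have to be served in this round, and `dn` those that were served. -/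
def absorb (v : Fin n) (b : Bool) (th rem sl : ℕ) (dr : List (Fin n)) (dn td : List (Peeler n)) :
    Option (Peeler n) → Option (Peeler n)
  | some y => some (node v b th rem sl dr (dn ++ [y]) td)
  | none => if sl = 0 then none else some (node v b th rem (sl - 1) dr dn td)

/-- Give a unit of time to a process: it creates its next child, or passes the time on to the child
whose turn it is. The outcome `none` means that the process has died. -/
noncomputable def give : Peeler n → PMF (Option (Peeler n))
  | node v b th rem sl dr dn td =>
    if rem = 0 then
      match td, dn with
      | h :: t, dn => (give h).map (absorb v b th 0 sl dr dn t)
      | [], h :: t => (give h).map (absorb v b th 0 sl dr [] t)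
      | [], [] => PMF.pure none
    else
      match b with
      | true => (pick N v).map fun u => absorb v true th (rem - 1) sl (u :: dr) dn td (start N T u)
      | false => PMF.pure (absorb v false th (rem - 1) sl dr dn td
          (some (if rem = 2 then mkBatch N T v th else mkVertex v (2 * th))))

theorem give_cons (v : Fin n) (b : Bool) (th sl : ℕ) (dr : List (Fin n)) (dn t : List (Peeler n))
    (h : Peeler n) :
    give N T (node v b th 0 sl dr dn (h :: t)) = (give N T h).map (absorb v b th 0 sl dr dn t) := by
  rw [give.eq_def]; simp

theorem give_wrap (v : Fin n) (b : Bool) (th sl : ℕ) (dr : List (Fin n)) (dn : List (Peeler n)) :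
    give N T (node v b th 0 sl dr dn []) = give N T (node v b th 0 sl dr [] dn) := by
  cases dn with
  | nil => rfl
  | cons h t => rw [give_cons, give.eq_def]; simp

theorem give_batch (v : Fin n) (th rem sl : ℕ) (hr : rem ≠ 0) (dr : List (Fin n))
    (dn td : List (Peeler n)) :
    give N T (node v true th rem sl dr dn td) =
      (pick N v).map fun u => absorb v true th (rem - 1) sl (u :: dr) dn td (start N T u) := by
  rw [give.eq_def]; simp [hr]

theorem give_vertex (v : Fin n) (th rem sl : ℕ) (hr : rem ≠ 0) (dr : List (Fin n))
    (dn td : List (Peeler n)) :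
    give N T (node v false th rem sl dr dn td) =
      PMF.pure (absorb v false th (rem - 1) sl dr dn td
          (some (if rem = 2 then mkBatch N T v th else mkVertex v (2 * th)))) := by
  rw [give.eq_def]; simp [hr]

theorem give_nil (v : Fin n) (b : Bool) (th sl : ℕ) (dr : List (Fin n)) :
    give N T (node v b th 0 sl dr [] []) = PMF.pure none := by
  rw [give.eq_def]; simp

/-- The expectation of the lifetime, capped at `t`. -/
noncomputable def life : ℕ → Peeler n → ℝ≥0∞
  | 0, _ => 0
  | t + 1, x => 1 + (give N T x).expect fun o => o.elim 0 (life t)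

/-- The probability to die within `t` units of time. -/
noncomputable def death : ℕ → Peeler n → ℝ≥0∞
  | 0, _ => 0
  | t + 1, x => (give N T x).expect fun o => o.elim 1 (death t)

variable {N T}

theorem absorb_vertex {v : Fin n} {b : Bool} {th rem sl : ℕ} {dr : List (Fin n)}
    {dn td : List (Peeler n)} {o : Option (Peeler n)} {x : Peeler n}
    (h : absorb v b th rem sl dr dn td o = some x) : x.vertex = v := by
  cases o with
  | none =>
    simp only [absorb] at h
    split_ifs at h
    cases h; rfl
  | some y => cases h; rfl

theorem vertex_of_give {x y : Peeler n} (h : give N T x (some y) ≠ 0) : y.vertex = x.vertex := by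
  obtain ⟨v, b, th, rem, sl, dr, dn, td⟩ := x
  have key : ∀ (dn : List (Peeler n)) h t,
      give N T (node v b th 0 sl dr dn (h :: t)) (some y) ≠ 0 → y.vertex = v := by
    intro dn h t hh
    rw [give_cons, PMF.map_apply_ne_zero] at hh
    obtain ⟨o, -, ho⟩ := hh
    exact absorb_vertex ho
  by_cases hr : rem = 0
  · subst hr
    rcases td with _ | ⟨h', t⟩
    · rcases dn with _ | ⟨h', t⟩
      · rw [give_nil, PMF.pure_apply_ne_zero] at h; cases h
      · rw [give_wrap] at h; exact key _ _ _ h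
    · exact key _ _ _ h
  · cases b
    · rw [give_vertex _ _ _ _ _ _ hr, PMF.pure_apply_ne_zero] at h
      exact absorb_vertex h.symm
    · rw [give_batch _ _ _ _ _ _ hr, PMF.map_apply_ne_zero] at h
      obtain ⟨u, -, hu⟩ := h
      exact absorb_vertex hu

theorem life_le_succ (t : ℕ) (x : Peeler n) : life N T t x ≤ life N T (t + 1) x := by
  induction t generalizing x with
  | zero => simp [life]
  | succ t ih =>
    rw [life, life]
    gcongr 1 + ?_
    refine PMF.expect_mono fun o => ?_
    cases o with
    | none => simp
    | some y => exact ih y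

theorem life_le (t : ℕ) (x : Peeler n) : life N T t x ≤ t := by
  induction t generalizing x with
  | zero => simp [life]
  | succ t ih =>
    rw [life, Nat.cast_add, Nat.cast_one, add_comm (t : ℝ≥0∞)]
    gcongr 1 + ?_
    refine PMF.expect_le_const fun o _ => ?_
    cases o with
    | none => simp
    | some y => exact ih y

theorem death_le_one (t : ℕ) (x : Peeler n) : death N T t x ≤ 1 := by
  induction t generalizing x with
  | zero => simp [death]
  | succ t ih =>
    rw [death]
    refine PMF.expect_le_const fun o _ => ?_
    cases o with
    | none => simp
    | some y => exact ih y

theorem death_le_succ (t : ℕ) (x : Peeler n) : death N T t x ≤ death N T (t + 1) x := by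
  induction t generalizing x with
  | zero => simp [death]
  | succ t ih =>
    rw [death, death]
    refine PMF.expect_mono fun o => ?_
    cases o with
    | none => simp
    | some y => exact ih y

theorem uniformBelow_succ (m : ℕ) : WordRAM.uniformBelow (m + 1) =
    (PMF.uniformOfFintype (Fin (m + 1))).map Fin.val := by
  unfold WordRAM.uniformBelow
  exact PMF.map_id _

theorem expect_pick (v : Fin n) (hv : (N v).length ≠ 0) (f : Fin n → ℝ≥0∞) :
    (pick N v).expect f = ((N v).map f).sum / ((N v).length : ℝ≥0∞) := by
  unfold pick
  rw [PMF.expect_map]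
  obtain ⟨m, hm⟩ := Nat.exists_eq_succ_of_ne_zero hv
  have e : ((N v).map f).sum = ∑ i : Fin (m + 1), f ((N v)[(i : ℕ)]?.getD v) := by
    have h1 : (N v).map f = List.ofFn fun i : Fin (N v).length => f (N v)[(i : ℕ)] := by
      conv_lhs => rw [← List.ofFn_getElem (xs := N v)]
      rw [List.map_ofFn]; rfl
    rw [h1, List.sum_ofFn]
    refine Fintype.sum_equiv (finCongr hm) _ _ fun i => ?_
    simp
  rw [hm, Nat.succ_eq_add_one, uniformBelow_succ, e, ← PMF.expect_uniformOfFintype_fin]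
  exact PMF.expect_map _ _ _

/-! ### Graphs of small arboricity

`o` is an orientation of the graph: `o v u` means that the edge from `v` to `u` is directed to `u`.
If every vertex has few outgoing edges, few of the draws of a batch are along outgoing edges. Hence
at least half of the surviving children belong to incoming edges, and the lifetime of the batch is
at most about twice the total lifetime of those children. In the sum over all vertices, the lifetime
of each process is then charged along its few outgoing edges only. -/

section Sparse

variable (N T) (o : Fin n → Fin n → Bool)

/-- The expected capped lifetime of the process of a vertex. -/
noncomputable def startLife (t : ℕ) (u : Fin n) : ℝ≥0∞ := (start N T u).elim 0 (life N T t)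

/-- The expected capped lifetime of the process of a random neighbour, counted only if the edge to
this neighbour is incoming. -/
noncomputable def inLife (t : ℕ) (v : Fin n) : ℝ≥0∞ :=
  (pick N v).expect fun u => if o v u then 0 else startLife N T t u

/-- The probability that a random edge at `v` is outgoing. -/
noncomputable def outProb (v : Fin n) : ℝ≥0∞ :=
  (pick N v).expect fun u => if o v u then 1 else 0

/-- The sum of the expected capped lifetimes of the processes in `l` that belong to incoming edges.
-/
noncomputable def sumIn (t : ℕ) (v : Fin n) (l : List (Peeler n)) : ℝ≥0∞ :=
  (l.map fun x => if o v x.vertex then 0 else life N T t x).sum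

/-- The number of processes in `l` that belong to outgoing edges of `v`. -/
def outs (v : Fin n) (l : List (Peeler n)) : ℕ := l.countP fun x => o v x.vertex

/-- The number of processes in `l` that belong to incoming edges of `v`. -/
def ins (v : Fin n) (l : List (Peeler n)) : ℕ := l.countP fun x => !o v x.vertex

/-- A bound for the expected lifetime of a batch, as long as fewer than half of its `th` required
survivors can belong to outgoing edges. Time spent on an incoming child is paid twice by the
lifetime of this child; the surplus is handed to the child's place in `dn`, and pays for serving an
outgoing child in the next round. -/
noncomputable def pot (t : ℕ) (v : Fin n) (rem : ℕ) (dn td : List (Peeler n)) : ℝ≥0∞ :=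
  2 * (sumIn N T o t v dn + sumIn N T o t v td) + (outs o v td + ins o v dn : ℕ)
    + rem * (2 + 2 * inLife N T o t v)

/-- The bound `pot` for a batch that has drawn fewer than `th / 2` outgoing edges. It is `0` for the
other batches, which are left to `luck`. -/
noncomputable def quietPot (t : ℕ) : Peeler n → ℝ≥0∞
  | node v _ th rem _ dr dn td => if th ≤ 2 * dr.countP (o v) then 0 else pot N T o t v rem dn td

/-- A bound, from Markov's inequality, for the conditional probability that a batch draws `th / 2`
outgoing edges or more. -/
noncomputable def luck : Peeler n → ℝ≥0∞
  | node v _ th rem _ dr _ _ =>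
    2 / (th : ℝ≥0∞) * ((dr.countP (o v) : ℕ) + rem * outProb N o v)

/-- The invariants of a batch. -/
def BatchInv : Peeler n → Prop
  | node v b th rem sl dr dn td => b = true ∧ 1 ≤ th ∧ dn.length + td.length + rem = sl + th ∧
      outs o v dn + outs o v td ≤ dr.countP (o v) ∧ (rem ≠ 0 → td = [])

variable {N T o}

theorem sumIn_append (t : ℕ) (v : Fin n) (l l' : List (Peeler n)) :
    sumIn N T o t v (l ++ l') = sumIn N T o t v l + sumIn N T o t v l' := by
  simp [sumIn]

theorem sumIn_le_succ (t : ℕ) (v : Fin n) (l : List (Peeler n)) :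
    sumIn N T o t v l ≤ sumIn N T o (t + 1) v l := by
  unfold sumIn
  refine List.sum_le_sum fun x _ => ?_
  split_ifs
  · rfl
  · exact life_le_succ _ _

theorem startLife_le_succ (t : ℕ) (u : Fin n) : startLife N T t u ≤ startLife N T (t + 1) u := by
  unfold startLife
  cases start N T u with
  | none => simp
  | some y => exact life_le_succ _ _

theorem inLife_le_succ (t : ℕ) (v : Fin n) : inLife N T o t v ≤ inLife N T o (t + 1) v := by
  unfold inLife
  refine PMF.expect_mono fun u => ?_
  split_ifs
  · rfl
  · exact startLife_le_succ _ _

theorem outs_add_ins (v : Fin n) (l : List (Peeler n)) : outs o v l + ins o v l = l.length := by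
  unfold outs ins
  rw [List.length_eq_countP_add_countP (fun x : Peeler n => o v x.vertex)]
  congr 2
  funext x; simp

theorem BatchInv.absorb {v : Fin n} {th rem sl : ℕ} {dr : List (Fin n)}
    {dn td : List (Peeler n)} {oc : Option (Peeler n)} {b' : Peeler n} {u : Fin n}
    (hu : ∀ y, oc = some y → y.vertex = u) (hth : 1 ≤ th)
    (hl : dn.length + td.length + rem + 1 = sl + th)
    (ho : outs o v dn + outs o v td + (if o v u then 1 else 0) ≤ dr.countP (o v))
    (hr : rem ≠ 0 → td = [])
    (h : Peeling.absorb v true th rem sl dr dn td oc = some b') : BatchInv o b' := by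
  cases oc with
  | none =>
    simp only [Peeling.absorb] at h
    split_ifs at h with h0
    cases h
    exact ⟨rfl, hth, by omega, by split_ifs at ho <;> omega, hr⟩
  | some y =>
    cases h
    refine ⟨rfl, hth, by simp; omega, ?_, hr⟩
    have := hu y rfl
    simp only [outs, List.countP_append, List.countP_cons, List.countP_nil, this] at ho ⊢
    omega

theorem BatchInv.give {b b' : Peeler n} (hb : BatchInv o b)
    (h : Peeling.give N T b (some b') ≠ 0) : BatchInv o b' := by
  obtain ⟨v, k, th, rem, sl, dr, dn, td⟩ := b
  obtain ⟨rfl, hth, hl, ho, htd⟩ := hb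
  have key : ∀ (dn : List (Peeler n)) h t, dn.length + t.length + 1 = sl + th →
      outs o v dn + outs o v (h :: t) ≤ dr.countP (o v) →
      Peeling.give N T (node v true th 0 sl dr dn (h :: t)) (some b') ≠ 0 → BatchInv o b' := by
    intro dn h t h1 h2 hh
    rw [give_cons, PMF.map_apply_ne_zero] at hh
    obtain ⟨oc, hoc, ho'⟩ := hh
    refine BatchInv.absorb (u := h.vertex) ?_ hth (by omega) ?_ (by simp) ho'
    · rintro y rfl
      exact vertex_of_give hoc
    · simp only [outs, List.countP_cons] at h2 ⊢
      omega
  by_cases hr : rem = 0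
  · subst hr
    rcases td with _ | ⟨h', t⟩
    · rcases dn with _ | ⟨h', t⟩
      · rw [give_nil, PMF.pure_apply_ne_zero] at h; cases h
      · rw [give_wrap] at h
        refine key _ _ _ (by simpa using hl) ?_ h
        simp only [outs, List.countP_nil] at ho ⊢; omega
    · exact key _ _ _ (by simp at hl; omega) ho h
  · rw [give_batch _ _ _ _ _ _ hr, PMF.map_apply_ne_zero] at h
    obtain ⟨u, -, hu⟩ := h
    refine BatchInv.absorb (u := u) ?_ hth (by omega) ?_ (fun _ => htd hr) hu
    · intro y hy
      unfold start at hy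
      split_ifs at hy
      cases hy; rfl
    · simp only [List.countP_cons]
      omega

/-- When a new round starts, the incoming children hand their credit to the outgoing ones; at that
time at least half of the children are incoming. -/
theorem pot_wrap (t : ℕ) (v : Fin n) (dn : List (Peeler n)) (h : outs o v dn ≤ ins o v dn) :
    pot N T o t v 0 [] dn ≤ pot N T o t v 0 dn [] := by
  unfold pot
  simp only [sumIn, outs, ins, List.map_nil, List.sum_nil, List.countP_nil, zero_add, add_zero]
  gcongr
  exact h

theorem pot_give_cons (t : ℕ) (v : Fin n) (th sl : ℕ) (dr : List (Fin n)) (dn td : List (Peeler n))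
    (h : Peeler n) :
    ((give N T (node v true th 0 sl dr dn (h :: td))).expect
      fun x => x.elim 0 (quietPot N T o t)) + 1 ≤ pot N T o (t + 1) v 0 dn (h :: td) := by
  rw [give_cons, PMF.expect_map]
  by_cases hv : o v h.vertex
  · -- a child along an outgoing edge pays with its own place in the round
    have : ((give N T h).expect fun a => (absorb v true th 0 sl dr dn td a).elim 0
        (quietPot N T o t)) ≤ 2 * (sumIn N T o t v dn + sumIn N T o t v td)
          + (outs o v td + ins o v dn : ℕ) := by
      refine PMF.expect_le_const fun a ha => ?_
      cases a with
      | none =>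
        simp only [absorb]
        split_ifs
        · simp
        · simp only [Option.elim_some, quietPot]
          split_ifs
          · simp
          · simp [pot]
      | some y =>
        have hy := vertex_of_give ha
        simp only [absorb, Option.elim_some, quietPot]
        split_ifs
        · simp
        · simp [pot, sumIn, ins, hy, hv]
    refine (add_le_add_left this 1).trans ?_
    unfold pot
    have e : outs o v (h :: td) = outs o v td + 1 := by simp [outs, hv]
    have e2 : sumIn N T o (t + 1) v (h :: td) = sumIn N T o (t + 1) v td := by simp [sumIn, hv]
    rw [e, e2]
    have := sumIn_le_succ (N := N) (T := T) (o := o) t v dn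
    have := sumIn_le_succ (N := N) (T := T) (o := o) t v td
    simp only [Nat.cast_zero, zero_mul, add_zero]
    rw [add_assoc]
    gcongr
    push_cast
    apply le_of_eq; ring
  · have : ((give N T h).expect fun a => (absorb v true th 0 sl dr dn td a).elim 0
        (quietPot N T o t)) ≤ (give N T h).expect fun a =>
          2 * (a.elim 0 (life N T t)) + (2 * (sumIn N T o t v dn + sumIn N T o t v td)
          + (outs o v td + ins o v dn + 1 : ℕ)) := by
      refine PMF.expect_mono_of_support fun a ha => ?_
      cases a with
      | none =>
        simp only [absorb]
        split_ifs
        · simp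
        · simp only [Option.elim_some, quietPot]
          split_ifs
          · simp
          · simp only [pot, Nat.cast_zero, zero_mul, add_zero, Option.elim_none, mul_zero, zero_add]
            exact add_le_add_right (Nat.cast_le.2 (by omega)) _
      | some y =>
        have hy := vertex_of_give ha
        simp only [absorb, Option.elim_some, quietPot]
        split_ifs
        · simp
        · have e : ins o v (dn ++ [y]) = ins o v dn + 1 := by simp [ins, hy, hv]
          have e2 : sumIn N T o t v [y] = life N T t y := by simp [sumIn, hy, hv]
          simp only [pot, Nat.cast_zero, zero_mul, add_zero, e, sumIn_append, e2]
          apply le_of_eq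
          push_cast
          ring
    refine (add_le_add_left this 1).trans ?_
    rw [PMF.expect_add, PMF.expect_const, PMF.expect_const_mul]
    unfold pot
    have e : outs o v (h :: td) = outs o v td := by simp [outs, hv]
    have e2 : sumIn N T o (t + 1) v (h :: td) = life N T (t + 1) h + sumIn N T o (t + 1) v td := by
      simp [sumIn, hv]
    rw [e, e2, life]
    have := sumIn_le_succ (N := N) (T := T) (o := o) t v dn
    have := sumIn_le_succ (N := N) (T := T) (o := o) t v td
    simp only [Nat.cast_zero, zero_mul, add_zero]
    calc _ = 2 * (sumIn N T o t v dn + (1 + ((give N T h).expect fun a => a.elim 0 (life N T t))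
            + sumIn N T o t v td)) + (outs o v td + ins o v dn : ℕ) := by push_cast; ring
      _ ≤ _ := by gcongr

theorem pot_give {t : ℕ} {v : Fin n} {th rem sl : ℕ} {dr : List (Fin n)} {dn td : List (Peeler n)}
    (hb : BatchInv o (node v true th rem sl dr dn td)) (hq : 2 * dr.countP (o v) < th) :
    ((give N T (node v true th rem sl dr dn td)).expect
      fun x => x.elim 0 (quietPot N T o t)) + 1 ≤ pot N T o (t + 1) v rem dn td := by
  obtain ⟨-, hth, hl, ho, htd⟩ := hb
  by_cases hr : rem = 0
  · subst hr
    rcases td with _ | ⟨h', td⟩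
    · rcases dn with _ | ⟨h', dn⟩
      · simp at hl; omega
      · rw [give_wrap]
        refine (pot_give_cons t v th sl dr [] dn h').trans (pot_wrap _ _ _ ?_)
        have := outs_add_ins (o := o) v (h' :: dn)
        simp only [List.length_nil, add_zero] at hl
        omega
    · exact pot_give_cons t v th sl dr dn td h'
  · have htd := htd hr
    subst htd
    rw [give_batch _ _ _ _ _ _ hr, PMF.expect_map]
    obtain ⟨r, rfl⟩ := Nat.exists_eq_succ_of_ne_zero hr
    have : ((pick N v).expect fun u => (absorb v true th (r.succ - 1) sl (u :: dr) dn []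
        (start N T u)).elim 0 (quietPot N T o t)) ≤ (pick N v).expect fun u =>
          2 * (if o v u then 0 else startLife N T t u) + (2 * sumIn N T o t v dn +
          ins o v dn + 1 + r * (2 + 2 * inLife N T o t v)) := by
      refine PMF.expect_mono fun u => ?_
      unfold start startLife start
      split_ifs with h1 h2
      · simp only [absorb, Option.elim_some, quietPot]
        split_ifs
        · simp
        · simp only [pot, sumIn, ins, outs, mkVertex, vertex, h2, List.map_append, List.map_cons,
            List.map_nil, List.sum_append, List.sum_cons, List.sum_nil, List.countP_append,
            List.countP_cons, List.countP_nil, Nat.succ_eq_add_one, Nat.add_sub_cancel]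
          simp only [if_true, mul_zero, add_zero, zero_add, Bool.not_true, Bool.false_eq_true,
            if_false]
          exact add_le_add_left le_self_add _
      · simp only [absorb, Option.elim_some, quietPot]
        split_ifs
        · simp
        · simp only [pot, sumIn, ins, outs, mkVertex, vertex, h2, List.map_append, List.map_cons,
            List.map_nil, List.sum_append, List.sum_cons, List.sum_nil, List.countP_append,
            List.countP_cons, List.countP_nil, Nat.succ_eq_add_one, Nat.add_sub_cancel]
          apply le_of_eq
          push_cast
          simp
          ring
      all_goals
        simp only [absorb]
        split_ifs
        · simp
        · simp only [Option.elim_some, quietPot]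
          split_ifs
          · simp
          · simp only [pot, sumIn, outs, List.map_nil, List.sum_nil, List.countP_nil, add_zero,
              zero_add, Nat.succ_eq_add_one, Nat.add_sub_cancel, Option.elim_none, mul_zero]
            exact add_le_add_left le_self_add _
    refine (add_le_add_left this 1).trans ?_
    rw [PMF.expect_add, PMF.expect_const, PMF.expect_const_mul]
    change 2 * inLife N T o t v + _ + 1 ≤ _
    unfold pot
    have := sumIn_le_succ (N := N) (T := T) (o := o) t v dn
    have := inLife_le_succ (N := N) (T := T) (o := o) t v
    have e : sumIn N T o (t + 1) v [] = 0 := by simp [sumIn]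
    have e' : outs o v [] = 0 := by simp [outs]
    rw [e, e']
    calc _ = 2 * (sumIn N T o t v dn) + (ins o v dn : ℕ) +
            (r + 1) * (2 + 2 * inLife N T o t v) := by ring
      _ ≤ _ := by
        push_cast
        simp only [add_zero, zero_add]
        gcongr

theorem luck_give {b : Peeler n} (hb : BatchInv o b) :
    ((give N T b).expect fun x => x.elim 0 (luck N o)) ≤ luck N o b := by
  obtain ⟨v, k, th, rem, sl, dr, dn, td⟩ := b
  obtain ⟨rfl, -, -, -, -⟩ := hb
  have key : ∀ (rem : ℕ) (dn td : List (Peeler n)) (dr : List (Fin n)) a,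
      ((absorb v true th rem sl dr dn td a).elim 0 (luck N o)) ≤
      2 / (th : ℝ≥0∞) * ((dr.countP (o v) : ℕ) + rem * outProb N o v) := by
    intro rem dn td dr a
    cases a with
    | none =>
      simp only [absorb]
      split_ifs
      · simp
      · simp [luck]
    | some y => simp [absorb, luck]
  have key0 : ∀ (dn : List (Peeler n)) h t,
      ((give N T (node v true th 0 sl dr dn (h :: t))).expect fun x => x.elim 0 (luck N o)) ≤
        luck N o (node v true th 0 sl dr dn (h :: t)) := by
    intro dn h t
    rw [give_cons, PMF.expect_map]
    exact PMF.expect_le_const fun a _ => key 0 dn t dr a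
  by_cases hr : rem = 0
  · subst hr
    rcases td with _ | ⟨h', t⟩
    · rcases dn with _ | ⟨h', t⟩
      · rw [give_nil, PMF.expect_pure]; simp
      · rw [give_wrap]; exact key0 _ _ _
    · exact key0 _ _ _
  · rw [give_batch _ _ _ _ _ _ hr, PMF.expect_map]
    obtain ⟨r, rfl⟩ := Nat.exists_eq_succ_of_ne_zero hr
    have e : ∀ u, (((u :: dr).countP (o v) : ℕ) : ℝ≥0∞) =
        (if o v u then 1 else 0) + (dr.countP (o v) : ℕ) := by
      intro u
      rw [List.countP_cons]
      split_ifs <;> simp [add_comm]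
    refine (PMF.expect_mono fun u => key r dn td (u :: dr) (start N T u)).trans ?_
    simp only [e]
    rw [PMF.expect_const_mul, luck]
    gcongr
    rw [PMF.expect_add, PMF.expect_add, PMF.expect_const, PMF.expect_const]
    change outProb N o v + _ + _ ≤ _
    apply le_of_eq
    push_cast
    ring

variable (N T)

/-- The expectation of the smaller one of two independent lifetimes, capped at `t`. -/
noncomputable def minLife : ℕ → Peeler n → Peeler n → ℝ≥0∞
  | 0, _, _ => 0
  | t + 1, b, y => 1 + (give N T b).expect fun b' => b'.elim 0 fun b' =>
      (give N T y).expect fun y' => y'.elim 0 (minLife t b')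

variable {N T}

theorem minLife_le_succ (t : ℕ) (b y : Peeler n) :
    minLife N T t b y ≤ minLife N T (t + 1) b y := by
  induction t generalizing b y with
  | zero => simp [minLife]
  | succ t ih =>
    rw [minLife, minLife]
    gcongr 1 + ?_
    refine PMF.expect_mono fun b' => ?_
    cases b' with
    | none => simp
    | some b' =>
      refine PMF.expect_mono fun y' => ?_
      cases y' with
      | none => simp
      | some y' => exact ih _ _

/-- A batch that draws many outgoing edges may survive for long, and then the other process limits
the lifetime; but this happens with a probability of at most `luck` only. -/
theorem minLife_le (t : ℕ) (b y : Peeler n) (hb : BatchInv o b) :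
    minLife N T t b y ≤ quietPot N T o t b + luck N o b * life N T t y := by
  induction t generalizing b y with
  | zero => simp [minLife]
  | succ t ih =>
    have h1 : ((give N T b).expect fun b' => b'.elim 0 fun b' =>
        (give N T y).expect fun y' => y'.elim 0 (minLife N T t b')) ≤
        ((give N T b).expect fun b' => b'.elim 0 (quietPot N T o t)) +
          ((give N T b).expect fun b' => b'.elim 0 (luck N o)) *
            ((give N T y).expect fun y' => y'.elim 0 (life N T t)) := by
      rw [← PMF.expect_mul_const, ← PMF.expect_add]
      refine PMF.expect_mono_of_support fun b' hb' => ?_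
      cases b' with
      | none => simp
      | some b' =>
        simp only [Option.elim_some]
        rw [← PMF.expect_const_mul]
        have h3 := hb.give hb'
        have : quietPot N T o t b' = (give N T y).expect fun _ => quietPot N T o t b' :=
          (PMF.expect_const _ _).symm
        rw [this, ← PMF.expect_add]
        refine PMF.expect_mono fun y' => ?_
        cases y' with
        | none => simp
        | some y' => exact ih b' y' h3
    have h2 := luck_give (N := N) (T := T) hb
    obtain ⟨v, k, th, rem, sl, dr, dn, td⟩ := b
    have hb' := hb
    obtain ⟨rfl, hth, -⟩ := hb'
    rw [minLife]
    refine (add_le_add_right h1 1).trans ?_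
    set b : Peeler n := node v true th rem sl dr dn td with hbdef
    by_cases hq : th ≤ 2 * dr.countP (o v)
    · -- the batch may survive for long, but then the luck is at least `1`
      have hl : 1 ≤ luck N o b := by
        rw [hbdef, luck]
        have h4 : (th : ℝ≥0∞) ≤ 2 * (dr.countP (o v) : ℕ) := by exact_mod_cast hq
        calc (1 : ℝ≥0∞) = (th : ℝ≥0∞) / th :=
              (ENNReal.div_self (by simp; omega) (by simp)).symm
          _ ≤ 2 * (dr.countP (o v) : ℕ) / th := by gcongr
          _ = 2 / th * (dr.countP (o v) : ℕ) := by
            rw [ENNReal.mul_div_right_comm]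
          _ ≤ _ := by gcongr; exact le_self_add
      have h5 : ((give N T b).expect fun b' => b'.elim 0 (quietPot N T o t)) ≤ 0 := by
        refine PMF.expect_le_const fun b' hb' => ?_
        cases b' with
        | none => simp
        | some b' =>
          have key : ∀ (sl : ℕ) (dn td : List (Peeler n)) a,
              (absorb v true th 0 sl dr dn td a) = some b' → quietPot N T o t b' = 0 := by
            intro sl dn td a h
            cases a with
            | none =>
              simp only [absorb] at h
              split_ifs at h
              cases h; simp [quietPot, hq]
            | some y => cases h; simp [quietPot, hq]
          have key0 : ∀ (dn : List (Peeler n)) h t',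
            (give N T (node v true th 0 sl dr dn (h :: t'))) (some b') ≠ 0 →
              quietPot N T o t b' = 0 := by
            intro dn h t' hh
            rw [give_cons, PMF.map_apply_ne_zero] at hh
            obtain ⟨a, -, ha⟩ := hh
            exact key _ _ _ a ha
          refine le_of_eq ?_
          change quietPot N T o t b' = 0
          rw [hbdef] at hb'
          by_cases hr : rem = 0
          · subst hr
            rcases td with _ | ⟨h', t'⟩
            · rcases dn with _ | ⟨h', t'⟩
              · rw [give_nil, PMF.pure_apply_ne_zero] at hb'; cases hb'
              · rw [give_wrap] at hb'; exact key0 _ _ _ hb'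
            · exact key0 _ _ _ hb'
          · rw [give_batch _ _ _ _ _ _ hr, PMF.map_apply_ne_zero] at hb'
            obtain ⟨u, -, hu⟩ := hb'
            have hq' : th ≤ 2 * (u :: dr).countP (o v) := by
              rw [List.countP_cons]; omega
            generalize start N T u = a at hu
            cases a with
            | none =>
              simp only [absorb] at hu
              split_ifs at hu
              cases hu; simp only [quietPot]; rw [if_pos hq']
            | some y => cases hu; simp only [quietPot]; rw [if_pos hq']
      have h6 : quietPot N T o (t + 1) b = 0 := by simp [hbdef, quietPot, hq]
      rw [h6, zero_add, life, mul_add, mul_one]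
      exact add_le_add hl (by
        calc _ ≤ 0 + _ := add_le_add_left h5 _
          _ ≤ _ := by rw [zero_add]; gcongr)
    · have h4 := pot_give (N := N) (T := T) (t := t) hb (not_le.1 hq)
      have h6 : quietPot N T o (t + 1) b = pot N T o (t + 1) v rem dn td := by
        simp [hbdef, quietPot, hq]
      rw [h6]
      calc _ = (((give N T b).expect fun x => x.elim 0 (quietPot N T o t)) + 1) +
            ((give N T b).expect fun b' => b'.elim 0 (luck N o)) *
            ((give N T y).expect fun y' => y'.elim 0 (life N T t)) := by ring
        _ ≤ _ := by
          gcongr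
          rw [life]
          exact le_add_self

end Sparse

end Peeling

namespace Peeling

open Peeler

variable {n : ℕ} {N : Fin n → List (Fin n)} {T : ℕ}

section Sparse

variable {o : Fin n → Fin n → Bool}

/-- A vertex process with both of its children lives about twice as long as the first of them to
die. -/
theorem life_two_children (t : ℕ) (v : Fin n) (th : ℕ) (dr : List (Fin n)) (b y : Peeler n) :
    life N T t (node v false th 0 0 dr [b, y] []) ≤ 2 * minLife N T t b y ∧
    life N T t (node v false th 0 0 dr [b] [y]) ≤
      1 + 2 * (give N T y).expect fun y' => y'.elim 0 (minLife N T t b) := by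
  induction t generalizing b y with
  | zero => simp [life]
  | succ t ih =>
    constructor
    · rw [life, give_wrap, give_cons, PMF.expect_map, minLife]
      calc _ ≤ 1 + (give N T b).expect fun b' => 1 + 2 * (b'.elim 0 fun b' =>
            (give N T y).expect fun y' => y'.elim 0 (minLife N T t b')) := by
            gcongr 1 + ?_
            refine PMF.expect_mono fun b' => ?_
            cases b' with
            | none => simp [absorb]
            | some b' => simpa [absorb] using (ih b' y).2
        _ = _ := by
            rw [PMF.expect_add, PMF.expect_const, PMF.expect_const_mul]; ring
    · rw [life, give_cons, PMF.expect_map, ← PMF.expect_const_mul]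
      gcongr 1 + ?_
      refine PMF.expect_mono fun y' => ?_
      cases y' with
      | none => simp [absorb]
      | some y' =>
        simp only [absorb, Option.elim_some, List.singleton_append]
        exact (ih b y').1.trans (by gcongr; exact minLife_le_succ _ _ _)

theorem give_mkVertex (v : Fin n) (th : ℕ) : give N T (mkVertex v th) =
    PMF.pure (some (node v false th 1 0 [] [mkBatch N T v th] [])) := by
  rw [mkVertex, give_vertex _ _ _ _ _ _ (by norm_num)]
  simp [absorb]

theorem give_mkVertex_snd (v : Fin n) (th : ℕ) (b : Peeler n) :
    give N T (node v false th 1 0 [] [b] []) =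
    PMF.pure (some (node v false th 0 0 [] [b, mkVertex v (2 * th)] [])) := by
  rw [give_vertex _ _ _ _ _ _ (by norm_num)]
  simp [absorb]

theorem batchInv_mkBatch (v : Fin n) (th : ℕ) (hth : 1 ≤ th) (hT : 1 ≤ T)
    (hv : T ≤ (N v).length) : BatchInv o (mkBatch N T v th) := by
  have hM : 1 ≤ (N v).length / T := (Nat.one_le_div_iff hT).2 hv
  have : th * 1 ≤ th * ((N v).length / T) := Nat.mul_le_mul_left _ hM
  refine ⟨rfl, hth, ?_, by simp [outs], fun _ => rfl⟩
  simp only [List.length_nil]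
  omega

/-- Each doubling of `th` doubles the bound, but the process with the doubled parameter matters with
probability at most `1 / 16` only. -/
theorem life_mkVertex_le (v : Fin n) (hT : 1 ≤ T) (hv : T ≤ (N v).length)
    (ho : 32 * (((N v).length / T : ℕ) * outProb N o v) ≤ 1) (t : ℕ) :
    ∀ th : ℕ, 1 ≤ th → life N T t (mkVertex v th) ≤
      4 + 8 * (th * ((N v).length / T : ℕ) * (1 + inLife N T o t v)) := by
  induction t using Nat.strong_induction_on with
  | _ t ih =>
    intro th hth
    match t, ih with
    | 0, _ => simp [life]
    | 1, _ =>
      refine (life_le _ _).trans (le_add_right ?_)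
      norm_num
    | t + 2, ih =>
      rw [life, give_mkVertex, PMF.expect_pure, Option.elim_some, life, give_mkVertex_snd,
        PMF.expect_pure, Option.elim_some]
      have h1 := (life_two_children (N := N) (T := T) t v th [] (mkBatch N T v th)
        (mkVertex v (2 * th))).1
      have h2 := minLife_le (N := N) (T := T) (o := o) t _ (mkVertex v (2 * th))
        (batchInv_mkBatch v th hth hT hv)
      set M : ℕ := (N v).length / T with hM
      set X : ℝ≥0∞ := th * M * (1 + inLife N T o t v) with hX
      have h3 : quietPot N T o t (mkBatch N T v th) = 2 * X := by
        simp only [mkBatch, quietPot, pot, sumIn, outs, ins, List.countP_nil, List.map_nil,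
          List.sum_nil]
        rw [if_neg (by omega), hX, ← hM]
        push_cast; ring
      have hth0 : (th : ℝ≥0∞) ≠ 0 := by simp; omega
      have h4 : luck N o (mkBatch N T v th) * 16 ≤ 1 := by
        simp only [mkBatch, luck, List.countP_nil, Nat.cast_zero, zero_add, ← hM]
        refine le_trans (le_of_eq ?_) ho
        calc _ = (2 / (th : ℝ≥0∞) * th) * 16 * (M * outProb N o v) := by push_cast; ring
          _ = _ := by
            rw [ENNReal.div_mul_cancel hth0 (by simp)]; norm_num
      have h5 : life N T t (mkVertex v (2 * th)) ≤ 16 * (1 + X) := by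
        refine (ih t (by omega) (2 * th) (by omega)).trans ?_
        calc _ = 4 + 16 * X := by rw [hX]; push_cast; ring
          _ ≤ 16 * 1 + 16 * X := by gcongr; norm_num
          _ = _ := by ring
      have hmono : X ≤ th * M * (1 + inLife N T o (t + 2) v) := by
        rw [hX]
        gcongr
        exact (inLife_le_succ _ _).trans (inLife_le_succ _ _)
      calc _ ≤ 1 + (1 + 2 * (2 * X + luck N o (mkBatch N T v th) * (16 * (1 + X)))) := by
            gcongr
            refine h1.trans ?_
            gcongr
            refine h2.trans ?_
            rw [h3]
            gcongr
        _ = 1 + (1 + 2 * (2 * X + (luck N o (mkBatch N T v th) * 16) * (1 + X))) := by ring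
        _ ≤ 1 + (1 + 2 * (2 * X + 1 * (1 + X))) := by gcongr
        _ = 4 + 6 * X := by ring
        _ ≤ 4 + 8 * X := by gcongr; norm_num
        _ ≤ _ := by gcongr

/-- Exchanging the order of summation: every vertex is charged along its outgoing edges only. -/
theorem sum_in_le (hnd : ∀ v, (N v).Nodup) (hsymm : ∀ v u, u ∈ N v → v ∈ N u)
    (ho : ∀ v u, u ∈ N v → o v u = false → o u v = true) {α : ℕ}
    (hα : ∀ v, (N v).countP (o v) ≤ α) (f : Fin n → ℝ≥0∞) :
    ∑ v, ((N v).map fun u => if o v u then 0 else f u).sum ≤ α * ∑ u, f u := by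
  have h1 : ∀ v, ((N v).map fun u => if o v u then 0 else f u).sum =
      ∑ u, if u ∈ N v then (if o v u then 0 else f u) else 0 := by
    intro v
    rw [← List.sum_toFinset _ (hnd v), ← Finset.sum_filter]
    refine Finset.sum_congr ?_ fun _ _ => rfl
    ext u; simp
  simp only [h1]
  rw [Finset.sum_comm, Finset.mul_sum]
  refine Finset.sum_le_sum fun u _ => ?_
  calc _ ≤ ∑ v, if v ∈ N u then (if o u v then f u else 0) else 0 := by
        refine Finset.sum_le_sum fun v _ => ?_
        by_cases h : u ∈ N v
        · rw [if_pos h, if_pos (hsymm v u h)]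
          by_cases h' : o v u
          · simp [h']
          · rw [if_neg h', if_pos (ho v u h (by simpa using h'))]
        · simp [h]
    _ = ((N u).countP (o u) : ℕ) * f u := by
        have h2 : ∀ l : List (Fin n), (l.map fun v => if o u v then f u else 0).sum =
            (l.countP (o u) : ℕ) * f u := by
          intro l
          induction l with
          | nil => simp
          | cons a l ih =>
            rw [List.map_cons, List.sum_cons, ih, List.countP_cons]
            split_ifs <;> (push_cast; ring)
        rw [← h2, ← List.sum_toFinset _ (hnd u), ← Finset.sum_filter]
        refine Finset.sum_congr ?_ fun _ _ => rfl
        ext v; simp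
    _ ≤ α * f u := by gcongr; exact_mod_cast hα u

/-- If every vertex has at most `α ≤ T / 32` outgoing edges, the processes have constant expected
lifetime on average over all vertices. -/
theorem sum_startLife_le (hT : 1 ≤ T) (hnd : ∀ v, (N v).Nodup)
    (hsymm : ∀ v u, u ∈ N v → v ∈ N u)
    (ho : ∀ v u, u ∈ N v → o v u = false → o u v = true) {α : ℕ}
    (hα : ∀ v, (N v).countP (o v) ≤ α) (hTα : 32 * α ≤ T) (t : ℕ) :
    ∑ v, startLife N T t v ≤ 10 * n := by
  have hT0 : (T : ℝ≥0∞) ≠ 0 := by simp; omega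
  set F := ∑ v, startLife N T t v with hF
  have hFfin : F ≠ ∞ := by
    refine ENNReal.sum_ne_top.2 fun v _ => ?_
    unfold startLife
    cases start N T v with
    | none => simp
    | some y => exact ne_top_of_le_ne_top (by simp) (life_le t y)
  have hcount : ∀ (v : Fin n) (l : List (Fin n)),
      (l.map fun u => if o v u then (1 : ℝ≥0∞) else 0).sum = (l.countP (o v) : ℕ) := by
    intro v l
    induction l with
    | nil => simp
    | cons a l ih =>
      rw [List.map_cons, List.sum_cons, ih, List.countP_cons]
      split_ifs <;> (push_cast; ring)
  have hcount' : ∀ (v : Fin n) (l : List (Fin n)), (l.length : ℝ≥0∞) = (l.countP (o v) : ℕ) +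
      (l.map fun u => if o v u then (0 : ℝ≥0∞) else 1).sum := by
    intro v l
    induction l with
    | nil => simp
    | cons a l ih =>
      rw [List.map_cons, List.sum_cons, List.length_cons, List.countP_cons]
      push_cast
      rw [ih]
      split_ifs <;> ring
  have hv : ∀ v, T * startLife N T t v ≤ T * 4 + 16 * ((N v).length +
      ((N v).map fun u => if o v u then 0 else startLife N T t u).sum) := by
    intro v
    by_cases hvT : T ≤ (N v).length
    · have hd : (N v).length ≠ 0 := by omega
      have hd0 : ((N v).length : ℝ≥0∞) ≠ 0 := by exact_mod_cast hd
      have hTM : (T : ℝ≥0∞) * ((N v).length / T : ℕ) ≤ (N v).length := by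
        exact_mod_cast Nat.mul_div_le _ _
      have key : ∀ s : ℝ≥0∞, T * (((N v).length / T : ℕ) * (s / (N v).length)) ≤ s := by
        intro s
        calc _ = (T * ((N v).length / T : ℕ)) * (s / (N v).length) := by ring
          _ ≤ (N v).length * (s / (N v).length) := by gcongr
          _ = s := ENNReal.mul_div_cancel hd0 (by simp)
      have h32 : 32 * (((N v).length / T : ℕ) * outProb N o v) ≤ 1 := by
        rw [outProb, expect_pick v hd, hcount]
        have h1 := key ((N v).countP (o v) : ℕ)
        have h2 : ((N v).countP (o v) : ℝ≥0∞) ≤ α := by exact_mod_cast hα v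
        have h3 : (32 : ℝ≥0∞) * α ≤ T := by exact_mod_cast hTα
        rw [← ENNReal.mul_le_mul_iff_right hT0 (by simp), mul_one]
        calc _ = 32 * (T * (((N v).length / T : ℕ) *
              (((N v).countP (o v) : ℕ) / ((N v).length : ℝ≥0∞)))) := by ring
          _ ≤ 32 * α := by gcongr; exact h1.trans h2
          _ ≤ T := h3
      have h := life_mkVertex_le (o := o) v hT hvT h32 t 2 (by norm_num)
      have e : startLife N T t v = life N T t (mkVertex v 2) := by
        simp [startLife, start, hvT]
      rw [e]
      calc _ ≤ T * (4 + 8 * ((2 : ℕ) * ((N v).length / T : ℕ) * (1 + inLife N T o t v))) := by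
            gcongr
        _ = T * 4 + 16 * (T * ((N v).length / T : ℕ) +
              T * (((N v).length / T : ℕ) * inLife N T o t v)) := by push_cast; ring
        _ ≤ _ := by
          gcongr
          rw [inLife, expect_pick v hd]
          exact key _
    · simp [startLife, start, hvT]
  have hsum : T * F ≤ T * 4 * n + 16 * ((α * n + α * n) + α * F) := by
    calc T * F = ∑ v, T * startLife N T t v := by rw [hF, Finset.mul_sum]
      _ ≤ ∑ v, (T * 4 + 16 * ((N v).length +
            ((N v).map fun u => if o v u then 0 else startLife N T t u).sum)) :=
          Finset.sum_le_sum fun v _ => hv v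
      _ = T * 4 * n + 16 * (∑ v, ((N v).length : ℝ≥0∞) +
            ∑ v, ((N v).map fun u => if o v u then 0 else startLife N T t u).sum) := by
          rw [Finset.sum_add_distrib, ← Finset.mul_sum _ _ (16 : ℝ≥0∞), Finset.sum_add_distrib]
          simp [mul_comm]
      _ ≤ _ := by
          gcongr
          · calc _ = ∑ v, (((N v).countP (o v) : ℕ) +
                  ((N v).map fun u => if o v u then (0 : ℝ≥0∞) else 1).sum) :=
                  Finset.sum_congr rfl fun v _ => hcount' v _
              _ ≤ _ := by
                rw [Finset.sum_add_distrib]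
                gcongr
                · calc _ ≤ ∑ _v : Fin n, (α : ℝ≥0∞) :=
                        Finset.sum_le_sum fun v _ => by exact_mod_cast hα v
                    _ = _ := by simp [mul_comm]
                · refine (sum_in_le hnd hsymm ho hα _).trans (by simp)
          · exact sum_in_le hnd hsymm ho hα _
  have hTα' : (32 : ℝ≥0∞) * α ≤ T := by exact_mod_cast hTα
  -- the last summand of `hsum` is at most half of the left-hand side
  have h2 : T * F + T * F ≤ T * (10 * n) + T * F := by
    calc T * F + T * F = 2 * (T * F) := by ring
      _ ≤ 2 * (T * 4 * n + 16 * ((α * n + α * n) + α * F)) := by gcongr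
      _ = T * (8 * n) + (32 * α) * (2 * n) + (32 * α) * F := by ring
      _ ≤ T * (8 * n) + T * (2 * n) + T * F := by gcongr
      _ = _ := by ring
  have h3 := ENNReal.le_of_add_le_add_right (ENNReal.mul_ne_top (by simp) hFfin) h2
  exact (ENNReal.mul_le_mul_iff_right hT0 (by simp)).1 h3

end Sparse

/-! ### Graphs with a dense core

If the vertex belongs to a subgraph of minimum degree at least `480 * T`, its process survives
forever with probability at least `1 / 2`: by induction on the time, a draw from the subgraph
survives with probability at least `1 / 2`, and a batch expects many more than `th` such draws. -/

section Core

variable (N T)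

/-- The probability that the process of a random neighbour dies within `t` units of time. -/
noncomputable def newDeath (t : ℕ) (v : Fin n) : ℝ≥0∞ :=
  (pick N v).expect fun u => (start N T u).elim 1 (death N T t)

/-- The product of `1 +` the death probabilities: the expectation of `2` to the number of deaths, if
the processes are independent. -/
noncomputable def prodDeath (t : ℕ) (l : List (Peeler n)) : ℝ≥0∞ :=
  (l.map fun x => 1 + death N T t x).prod

/-- The sum of the death probabilities. -/
noncomputable def sumDeath (t : ℕ) (l : List (Peeler n)) : ℝ≥0∞ :=
  (l.map fun x => death N T t x).sum

variable {N T}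

theorem prodDeath_le_succ (t : ℕ) (l : List (Peeler n)) :
    prodDeath N T t l ≤ prodDeath N T (t + 1) l := by
  unfold prodDeath
  refine List.prod_le_prod' fun x _ => ?_
  gcongr
  exact death_le_succ _ _

theorem one_le_prodDeath (t : ℕ) (l : List (Peeler n)) : 1 ≤ prodDeath N T t l := by
  unfold prodDeath
  induction l with
  | nil => simp
  | cons a l ih =>
    rw [List.map_cons, List.prod_cons]
    exact one_le_mul le_self_add ih

theorem newDeath_le_succ (t : ℕ) (v : Fin n) : newDeath N T t v ≤ newDeath N T (t + 1) v := by
  unfold newDeath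
  refine PMF.expect_mono fun u => ?_
  cases start N T u with
  | none => simp
  | some y => exact death_le_succ _ _

/-- A Chernoff bound: a batch dies if at least `sl + 1` of its children die, and the right-hand side
bounds the expectation of `2` to the number of dead children, divided by `2 ^ (sl + 1)`. -/
theorem death_batch_le (t : ℕ) : ∀ (v : Fin n) (th rem sl : ℕ) (dr : List (Fin n))
    (dn td : List (Peeler n)), sl + 1 ≤ dn.length + td.length + rem →
    death N T t (node v true th rem sl dr dn td) ≤
      2⁻¹ ^ (sl + 1) * (prodDeath N T t dn * prodDeath N T t td) *
        (1 + newDeath N T t v) ^ rem := by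
  induction t with
  | zero => simp [death]
  | succ t ih =>
    intro v th rem sl dr dn td hl
    have h2 : (2⁻¹ : ℝ≥0∞) * 2 = 1 := ENNReal.inv_mul_cancel (by norm_num) (by norm_num)
    have key : ∀ (rem : ℕ) (dr : List (Fin n)) (dn td : List (Peeler n)) (a : Option (Peeler n)),
        sl + 1 ≤ dn.length + td.length + rem + 1 →
        (absorb v true th rem sl dr dn td a).elim 1 (death N T t) ≤
          2⁻¹ ^ (sl + 1) * (prodDeath N T t dn * prodDeath N T t td) *
            (1 + newDeath N T t v) ^ rem * (1 + a.elim 1 (death N T t)) := by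
      intro rem dr dn td a hl
      cases a with
      | none =>
        simp only [absorb]
        have e : (1 : ℝ≥0∞) + Option.elim none 1 (death N T t) = 2 := by simp; norm_num
        rw [e]
        split_ifs with hsl
        · subst hsl
          calc (1 : ℝ≥0∞) = 2⁻¹ ^ (0 + 1) * (1 * 1) * 1 * 2 := by simp [h2]
            _ ≤ _ := by
              gcongr
              · exact one_le_prodDeath _ _
              · exact one_le_prodDeath _ _
              · exact one_le_pow₀ le_self_add
        · refine (ih v th rem (sl - 1) dr dn td (by omega)).trans (le_of_eq ?_)
          obtain ⟨s, rfl⟩ := Nat.exists_eq_succ_of_ne_zero hsl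
          simp only [Nat.succ_eq_add_one, Nat.add_sub_cancel]
          calc _ = 2⁻¹ ^ (s + 1) * (prodDeath N T t dn * prodDeath N T t td) *
                (1 + newDeath N T t v) ^ rem * (2⁻¹ * 2) := by rw [h2, mul_one]
            _ = _ := by ring
      | some y =>
        refine (ih v th rem sl dr (dn ++ [y]) td (by simp; omega)).trans (le_of_eq ?_)
        simp only [prodDeath, List.map_append, List.prod_append, List.map_cons, List.map_nil,
          List.prod_cons, List.prod_nil, Option.elim_some]
        ring
    have key0 : ∀ (dn : List (Peeler n)) (h : Peeler n) (td : List (Peeler n)),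
        sl + 1 ≤ dn.length + td.length + 1 →
        death N T (t + 1) (node v true th 0 sl dr dn (h :: td)) ≤
        2⁻¹ ^ (sl + 1) * (prodDeath N T (t + 1) dn * prodDeath N T (t + 1) (h :: td)) := by
      intro dn h td hl
      rw [death, give_cons, PMF.expect_map]
      refine (PMF.expect_mono fun a => key 0 dr dn td a (by omega)).trans ?_
      rw [PMF.expect_const_mul, PMF.expect_add, PMF.expect_const]
      have e : prodDeath N T (t + 1) (h :: td) =
          (1 + death N T (t + 1) h) * prodDeath N T (t + 1) td := by simp [prodDeath]
      rw [e, death, pow_zero, mul_one]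
      have := prodDeath_le_succ (N := N) (T := T) t dn
      have := prodDeath_le_succ (N := N) (T := T) t td
      calc _ = 2⁻¹ ^ (sl + 1) * (prodDeath N T t dn *
            ((1 + (give N T h).expect fun o => o.elim 1 (death N T t)) * prodDeath N T t td)) := by
            ring
        _ ≤ _ := by gcongr
    by_cases hr : rem = 0
    · subst hr
      rw [pow_zero, mul_one]
      rcases td with _ | ⟨h', td⟩
      · rcases dn with _ | ⟨h', dn⟩
        · simp at hl
        · have : death N T (t + 1) (node v true th 0 sl dr (h' :: dn) []) =
              death N T (t + 1) (node v true th 0 sl dr [] (h' :: dn)) := by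
            rw [death, death, give_wrap]
          rw [this]
          refine (key0 [] h' dn (by simpa using hl)).trans (le_of_eq ?_)
          simp [prodDeath]
      · exact key0 _ _ _ (by simp at hl ⊢; omega)
    · obtain ⟨r, rfl⟩ := Nat.exists_eq_succ_of_ne_zero hr
      rw [death, give_batch _ _ _ _ _ _ hr, PMF.expect_map]
      refine (PMF.expect_mono fun u => key r (u :: dr) dn td (start N T u) (by omega)).trans ?_
      rw [PMF.expect_const_mul, PMF.expect_add, PMF.expect_const]
      change _ * (1 + newDeath N T t v) ≤ _
      have := prodDeath_le_succ (N := N) (T := T) t dn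
      have := prodDeath_le_succ (N := N) (T := T) t td
      have := newDeath_le_succ (N := N) (T := T) t v
      rw [mul_assoc, ← pow_succ]
      gcongr

/-- The union bound for a process that dies with any one of its children. -/
theorem death_union_le (t : ℕ) : ∀ (v : Fin n) (b : Bool) (th : ℕ) (dr : List (Fin n))
    (dn td : List (Peeler n)), 1 ≤ dn.length + td.length →
    death N T t (node v b th 0 0 dr dn td) ≤ sumDeath N T t dn + sumDeath N T t td := by
  have hmono : ∀ t l, sumDeath N T t l ≤ sumDeath N T (t + 1) l := by
    intro t l
    exact List.sum_le_sum fun x _ => death_le_succ _ _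
  induction t with
  | zero => simp [death]
  | succ t ih =>
    intro v b th dr dn td hl
    have key0 : ∀ (dn : List (Peeler n)) (h : Peeler n) (td : List (Peeler n)),
        death N T (t + 1) (node v b th 0 0 dr dn (h :: td)) ≤
        sumDeath N T (t + 1) dn + sumDeath N T (t + 1) (h :: td) := by
      intro dn h td
      rw [death, give_cons, PMF.expect_map]
      have : ∀ a : Option (Peeler n), (absorb v b th 0 0 dr dn td a).elim 1 (death N T t) ≤
          a.elim 1 (death N T t) + (sumDeath N T t dn + sumDeath N T t td) := by
        intro a
        cases a with
        | none => simp [absorb]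
        | some y =>
          refine (ih v b th dr (dn ++ [y]) td (by simp; omega)).trans (le_of_eq ?_)
          simp only [sumDeath, List.map_append, List.sum_append, List.map_cons, List.map_nil,
            List.sum_cons, List.sum_nil, Option.elim_some]
          ring
      refine (PMF.expect_mono this).trans ?_
      rw [PMF.expect_add, PMF.expect_const]
      have e : sumDeath N T (t + 1) (h :: td) =
          death N T (t + 1) h + sumDeath N T (t + 1) td := by simp [sumDeath]
      rw [e, death]
      have := hmono t dn
      have := hmono t td
      calc _ = sumDeath N T t dn + (((give N T h).expect fun o => o.elim 1 (death N T t)) +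
            sumDeath N T t td) := by ring
        _ ≤ _ := by gcongr
    rcases td with _ | ⟨h', td⟩
    · rcases dn with _ | ⟨h', dn⟩
      · simp at hl
      · have : death N T (t + 1) (node v b th 0 0 dr (h' :: dn) []) =
            death N T (t + 1) (node v b th 0 0 dr [] (h' :: dn)) := by
          rw [death, death, give_wrap]
        rw [this]
        refine (key0 [] h' dn).trans (le_of_eq ?_)
        simp [sumDeath]
    · exact key0 _ _ _

theorem newDeath_le {S : Fin n → Bool} {t : ℕ} {v : Fin n} (hv : (N v).length ≠ 0)
    (hS : ∀ u ∈ N v, S u → T ≤ (N u).length ∧ death N T t (mkVertex u 2) ≤ 2⁻¹) :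
    newDeath N T t v ≤
      ENNReal.ofReal (1 - ((N v).countP S : ℝ) / (2 * ((N v).length : ℝ))) := by
  have hd0 : (0 : ℝ) < (N v).length := by exact_mod_cast Nat.pos_of_ne_zero hv
  have h1 : ∀ l : List (Fin n), (l.map fun u => if S u then (2⁻¹ : ℝ≥0∞) else 1).sum =
      ENNReal.ofReal ((l.length : ℝ) - (l.countP S : ℝ) / 2) := by
    intro l
    induction l with
    | nil => simp
    | cons a l ih =>
      have h0 : (0 : ℝ) ≤ (l.length : ℝ) - (l.countP S : ℝ) / 2 := by
        have : (l.countP S : ℝ) ≤ l.length := by exact_mod_cast List.countP_le_length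
        have : (0 : ℝ) ≤ l.length := by positivity
        linarith
      rw [List.map_cons, List.sum_cons, ih, List.countP_cons, List.length_cons]
      split_ifs
      · have : (2⁻¹ : ℝ≥0∞) = ENNReal.ofReal (2⁻¹) := by
          rw [ENNReal.ofReal_inv_of_pos (by norm_num)]; simp
        rw [this, ← ENNReal.ofReal_add (by norm_num) h0]
        congr 1; push_cast; ring
      · rw [← ENNReal.ofReal_one, ← ENNReal.ofReal_add (by norm_num) h0]
        congr 1; push_cast; ring
  rw [newDeath, expect_pick v hv]
  calc _ ≤ ((N v).map fun u => if S u then (2⁻¹ : ℝ≥0∞) else 1).sum / ((N v).length : ℝ≥0∞) := by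
        gcongr
        refine List.sum_le_sum fun u hu => ?_
        split_ifs with h
        · obtain ⟨h1, h2⟩ := hS u hu h
          simpa [start, h1] using h2
        · cases start N T u with
          | none => simp
          | some y => exact death_le_one _ _
    _ = _ := by
        rw [h1, ← ENNReal.ofReal_natCast, ← ENNReal.ofReal_div_of_pos hd0]
        congr 1
        field_simp

theorem death_mkBatch_le {v : Fin n} (hT : 1 ≤ T) (hv : T ≤ (N v).length) {t c : ℕ}
    (hc : 480 * T ≤ c) (hcd : c ≤ (N v).length)
    (hnew : newDeath N T t v ≤ ENNReal.ofReal (1 - (c : ℝ) / (2 * ((N v).length : ℝ))))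
    {th : ℕ} (hth : 1 ≤ th) :
    death N T t (mkBatch N T v th) ≤ ENNReal.ofReal ((1 / 4) ^ th) := by
  set d := (N v).length with hd
  set M := d / T with hM
  have hM1 : 1 ≤ M := (Nat.one_le_div_iff hT).2 hv
  have hthM : th * 1 ≤ th * M := Nat.mul_le_mul_left _ hM1
  have h := death_batch_le (N := N) (T := T) t v th (th * M) (th * M - th) [] [] []
    (by simp; omega)
  rw [mkBatch, ← hd, ← hM]
  refine h.trans ?_
  simp only [prodDeath, List.map_nil, List.prod_nil, mul_one]
  have hd0 : (0 : ℝ) < d := by exact_mod_cast (by omega : 0 < d)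
  set y : ℝ := (c : ℝ) / (2 * d) with hy
  have hy0 : 0 ≤ y := by positivity
  have hy1 : y ≤ 1 / 2 := by
    rw [hy, div_le_iff₀ (by positivity)]
    have : (c : ℝ) ≤ d := by exact_mod_cast hcd
    linarith
  have h1 : (1 : ℝ≥0∞) + newDeath N T t v ≤ ENNReal.ofReal (2 - y) := by
    calc _ ≤ ENNReal.ofReal 1 + ENNReal.ofReal (1 - y) := by
          rw [ENNReal.ofReal_one]; gcongr
      _ = _ := by rw [← ENNReal.ofReal_add (by norm_num) (by linarith)]; congr 1; ring
  have e2 : (2⁻¹ : ℝ≥0∞) = ENNReal.ofReal (2⁻¹) := by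
    rw [ENNReal.ofReal_inv_of_pos (by norm_num)]; simp
  calc _ ≤ ENNReal.ofReal (2⁻¹) ^ (th * M - th + 1) * ENNReal.ofReal (2 - y) ^ (th * M) := by
        rw [e2]; gcongr
    _ = ENNReal.ofReal (2⁻¹ ^ (th * M - th + 1) * (2 - y) ^ (th * M)) := by
        rw [ENNReal.ofReal_mul (by positivity), ENNReal.ofReal_pow (by positivity),
          ENNReal.ofReal_pow (by linarith)]
    _ ≤ _ := by
      apply ENNReal.ofReal_le_ofReal
      -- `(2 - y) / 2 ≤ exp (- y / 2)`, and the batch has at least `60 th / y` draws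
      have hexp : (2 - y) ^ (th * M) ≤ 2 ^ (th * M) * Real.exp (-(60 * th)) := by
        have h3 : 2 - y ≤ 2 * Real.exp (-(y / 2)) := by
          have := Real.add_one_le_exp (-(y / 2))
          linarith
        calc (2 - y) ^ (th * M) ≤ (2 * Real.exp (-(y / 2))) ^ (th * M) :=
              pow_le_pow_left₀ (by linarith) h3 _
          _ = 2 ^ (th * M) * Real.exp (-(y / 2) * (th * M : ℕ)) := by
              rw [mul_pow, ← Real.exp_nat_mul]
              congr 2; ring
          _ ≤ _ := by
            gcongr
            have hdM : (d : ℝ) ≤ 2 * (T * M) := by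
              have h4 : d < T * M + T := by
                have := Nat.div_add_mod d T
                have := Nat.mod_lt d (by omega : T > 0)
                rw [hM]; omega
              have h5 : T * 1 ≤ T * M := Nat.mul_le_mul_left _ hM1
              have : d ≤ 2 * (T * M) := by omega
              exact_mod_cast this
            have hcT : (480 : ℝ) * T ≤ c := by exact_mod_cast hc
            have hyM : 120 ≤ y * M := by
              rw [hy, div_mul_eq_mul_div, le_div_iff₀ (by positivity)]
              have hM0 : (0 : ℝ) ≤ M := by positivity
              nlinarith
            push_cast
            have : (0 : ℝ) ≤ th := by positivity
            nlinarith
      have hp : (2⁻¹ : ℝ) ^ (th * M - th + 1) * 2 ^ (th * M) ≤ 2 ^ th := by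
        obtain ⟨r, hr⟩ : ∃ r, th * M = th + r := ⟨th * M - th, by omega⟩
        rw [hr]
        have : th + r - th = r := by omega
        rw [this, pow_add (2 : ℝ) th r, pow_succ]
        have : (2⁻¹ : ℝ) ^ r * 2 ^ r = 1 := by rw [← mul_pow]; norm_num
        calc _ = ((2⁻¹ : ℝ) ^ r * 2 ^ r) * 2⁻¹ * 2 ^ th := by ring
          _ ≤ _ := by
            rw [this]
            have : (0 : ℝ) < 2 ^ th := by positivity
            linarith
      have he : Real.exp (-60) ≤ 1 / 8 := by
        rw [Real.exp_neg, ← one_div]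
        apply one_div_le_one_div_of_le (by norm_num)
        have := Real.add_one_le_exp (60 : ℝ)
        linarith
      calc _ ≤ 2⁻¹ ^ (th * M - th + 1) * (2 ^ (th * M) * Real.exp (-(60 * th))) := by gcongr
        _ = (2⁻¹ ^ (th * M - th + 1) * 2 ^ (th * M)) * Real.exp (-60) ^ th := by
            rw [← Real.exp_nat_mul, mul_assoc]
            congr 3; ring
        _ ≤ 2 ^ th * (1 / 8) ^ th := by gcongr
        _ = _ := by rw [← mul_pow]; norm_num

/-- The process of a vertex in a subgraph of large minimum degree dies with probability at most
`1 / th`: its batch contributes `1 / 4 ^ th`, and the process with parameter `2 * th` contributes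
`1 / (2 * th)`. -/
theorem death_mkVertex_le {S : Fin n → Bool} (hT : 1 ≤ T)
    (hS : ∀ v, S v → 480 * T ≤ (N v).countP S) (t : ℕ) :
    ∀ v, S v → ∀ th : ℕ, 2 ≤ th → death N T t (mkVertex v th) ≤ ENNReal.ofReal (1 / th) := by
  have hdeg : ∀ v, S v → T ≤ (N v).length := fun v hv =>
    ((by omega : T ≤ 480 * T).trans (hS v hv)).trans List.countP_le_length
  induction t using Nat.strong_induction_on with
  | _ t ih =>
    intro v hv th hth
    match t, ih with
    | 0, _ => simp [death]
    | 1, _ => simp [death, give_mkVertex, PMF.expect_pure]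
    | t + 2, ih =>
      rw [death, give_mkVertex, PMF.expect_pure, Option.elim_some, death, give_mkVertex_snd,
        PMF.expect_pure, Option.elim_some]
      refine (death_union_le t v false th [] _ [] (by simp)).trans ?_
      simp only [sumDeath, List.map_cons, List.map_nil, List.sum_cons, List.sum_nil, add_zero]
      have h2 := ih t (by omega) v hv (2 * th) (by omega)
      have hvT := hdeg v hv
      have hnew : newDeath N T t v ≤
          ENNReal.ofReal (1 - ((N v).countP S : ℝ) / (2 * ((N v).length : ℝ))) := by
        refine newDeath_le (by omega) fun u _ hu => ⟨hdeg u hu, ?_⟩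
        refine (ih t (by omega) u hu 2 le_rfl).trans (le_of_eq ?_)
        rw [one_div, ENNReal.ofReal_inv_of_pos (by norm_num)]; simp
      have h1 := death_mkBatch_le hT hvT (hS v hv) List.countP_le_length hnew
        (by omega : 1 ≤ th)
      refine (add_le_add h1 h2).trans ?_
      rw [← ENNReal.ofReal_add (by positivity) (by positivity)]
      apply ENNReal.ofReal_le_ofReal
      have h4 : (1 / 4 : ℝ) ^ th ≤ 1 / (2 * th) := by
        rw [one_div_pow]
        apply one_div_le_one_div_of_le (by positivity)
        have h5 : 2 * th ≤ 4 ^ th := by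
          have : th < 2 ^ th := Nat.lt_two_pow_self
          have h6 : (4 : ℕ) ^ th = 2 ^ th * 2 ^ th := by rw [← mul_pow]; norm_num
          rw [h6]
          nlinarith
        exact_mod_cast h5
      have h5 : (1 : ℝ) / (2 * th : ℕ) = 1 / (2 * th) := by push_cast; rfl
      rw [h5]
      have hth0 : (0 : ℝ) < th := by exact_mod_cast (by omega : 0 < th)
      have : (1 : ℝ) / (2 * th) + 1 / (2 * th) = 1 / th := by field_simp; norm_num
      linarith

end Core

end Peeling

/-! ### The tester

The tester distinguishes graphs of small arboricity from graphs with a dense core, by the total time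
that the processes of random vertices use. -/

namespace Peeling

open Peeler

variable {n : ℕ} (N : Fin n → List (Fin n)) (T : ℕ)

/-- The number of units of time that a process uses, if it is stopped after `t` units. -/
noncomputable def unitsUsed : ℕ → Peeler n → PMF ℕ
  | 0, _ => PMF.pure 0
  | t + 1, x => (give N T x).bind fun o =>
      o.elim (PMF.pure 1) fun x' => (unitsUsed t x').map (· + 1)

/-- The number of units of time that the process of a vertex uses, if it is stopped after `R` units.
-/
noncomputable def rootUnits (R : ℕ) (v : Fin n) : PMF ℕ :=
  (start N T v).elim (PMF.pure 0) (unitsUsed N T R)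

/-- The vertex with a given index. It is used for indices below `n` only. -/
def vertexOf (hn : 0 < n) (i : ℕ) : Fin n := ⟨i % n, Nat.mod_lt _ hn⟩

/-- Start the processes of `m` random vertices, and report whether they use up `U` units of time,
if each of them is stopped after `R` units. If they do, this is evidence for a dense core. -/
noncomputable def tester (hn : 0 < n) (R : ℕ) : ℕ → ℕ → PMF Bool
  | _, 0 => PMF.pure true
  | 0, _ + 1 => PMF.pure false
  | m + 1, U + 1 => (WordRAM.uniformBelow n).bind fun i =>
      (rootUnits N T R (vertexOf hn i)).bind fun g => tester hn R m (U + 1 - g)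

variable {N T}

theorem unitsUsed_le {t : ℕ} {x : Peeler n} {g : ℕ} (h : unitsUsed N T t x g ≠ 0) : g ≤ t := by
  induction t generalizing x g with
  | zero => rw [unitsUsed, PMF.pure_apply_ne_zero] at h; omega
  | succ t ih =>
    rw [unitsUsed, PMF.bind_apply_ne_zero] at h
    obtain ⟨o, -, h⟩ := h
    cases o with
    | none => rw [Option.elim_none, PMF.pure_apply_ne_zero] at h; omega
    | some y =>
      rw [Option.elim_some, PMF.map_apply_ne_zero] at h
      obtain ⟨g', hg', rfl⟩ := h
      have := ih hg'
      omega

theorem rootUnits_le {R : ℕ} {v : Fin n} {g : ℕ} (h : rootUnits N T R v g ≠ 0) : g ≤ R := by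
  unfold rootUnits at h
  cases hs : start N T v with
  | none => rw [hs, Option.elim_none, PMF.pure_apply_ne_zero] at h; omega
  | some y => rw [hs, Option.elim_some] at h; exact unitsUsed_le h

theorem expect_unitsUsed (t : ℕ) (x : Peeler n) :
    ((unitsUsed N T t x).expect fun g => (g : ℝ≥0∞)) = life N T t x := by
  induction t generalizing x with
  | zero => simp [unitsUsed, PMF.expect_pure, life]
  | succ t ih =>
    rw [unitsUsed, PMF.expect_bind, life]
    have h1 : (1 : ℝ≥0∞) = (give N T x).expect fun _ => 1 := (PMF.expect_const _ _).symm
    conv_rhs => rw [h1]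
    rw [← PMF.expect_add]
    congr 1
    funext o
    cases o with
    | none => simp [PMF.expect_pure]
    | some y =>
      simp only [Option.elim_some, PMF.expect_map]
      push_cast
      rw [PMF.expect_add, PMF.expect_const, ih, add_comm]

theorem expect_rootUnits (R : ℕ) (v : Fin n) :
    ((rootUnits N T R v).expect fun g => (g : ℝ≥0∞)) = startLife N T R v := by
  unfold rootUnits startLife
  cases start N T v with
  | none => simp [PMF.expect_pure]
  | some y => exact expect_unitsUsed R y

theorem expect_unitsUsed_lt (t : ℕ) (x : Peeler n) :
    ((unitsUsed N T t x).expect fun g => if g < t then 1 else 0) ≤ death N T t x := by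
  induction t generalizing x with
  | zero => simp [unitsUsed, PMF.expect_pure]
  | succ t ih =>
    rw [unitsUsed, PMF.expect_bind, death]
    refine PMF.expect_mono fun o => ?_
    cases o with
    | none =>
      rw [Option.elim_none, PMF.expect_pure]
      split_ifs <;> simp
    | some y =>
      rw [Option.elim_some, PMF.expect_map]
      simpa using ih y

theorem expect_uniformBelow (hn : 0 < n) (f : Fin n → ℝ≥0∞) :
    ((WordRAM.uniformBelow n).expect fun i => f (vertexOf hn i)) = (∑ v, f v) / n := by
  obtain ⟨m, rfl⟩ := Nat.exists_eq_add_of_le' hn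
  rw [uniformBelow_succ, PMF.expect_map, PMF.expect_uniformOfFintype_fin]
  congr 1
  refine Finset.sum_congr rfl fun i _ => ?_
  congr 1
  ext
  simp [vertexOf, Nat.mod_eq_of_lt i.2]

/-- An exponential moment bound: on average a process uses at most `10` units, so that `m` of them
are unlikely to use much more than `20 * m`. -/
theorem tester_true_le (hn : 0 < n) {R : ℕ} (hR : 1 ≤ R)
    (hlife : ∑ v, startLife N T R v ≤ 10 * n) (m U : ℕ) :
    ((tester N T hn R m U).expect fun b => if b then 1 else 0) ≤
      ENNReal.ofReal (Real.exp ((20 * m - U) / R)) := by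
  have hR0 : (0 : ℝ) < R := by exact_mod_cast hR
  induction m generalizing U with
  | zero =>
    cases U with
    | zero => simp [tester, PMF.expect_pure]
    | succ U => simp [tester, PMF.expect_pure]
  | succ m ih =>
    cases U with
    | zero =>
      rw [tester, PMF.expect_pure, if_pos rfl, ← ENNReal.ofReal_one]
      apply ENNReal.ofReal_le_ofReal
      rw [Real.one_le_exp_iff, Nat.cast_zero, sub_zero]
      positivity
    | succ U =>
      rw [tester, PMF.expect_bind]
      set a : ℝ := Real.exp ((20 * m - (U + 1 : ℕ)) / R) with ha
      have ha0 : 0 ≤ a := by positivity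
      have h1 : ∀ v, ((rootUnits N T R v).bind fun g => tester N T hn R m (U + 1 - g)).expect
          (fun b => if b then 1 else 0) ≤
          ENNReal.ofReal a * (1 + ENNReal.ofReal (2 / R) * startLife N T R v) := by
        intro v
        rw [PMF.expect_bind]
        have h2 : ∀ g, rootUnits N T R v g ≠ 0 →
            ((tester N T hn R m (U + 1 - g)).expect fun b => if b then 1 else 0) ≤
            ENNReal.ofReal a * (1 + ENNReal.ofReal (2 / R) * (g : ℝ≥0∞)) := by
          intro g hg
          refine (ih _).trans ?_
          rw [← ENNReal.ofReal_natCast, ← ENNReal.ofReal_one,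
            ← ENNReal.ofReal_mul (by positivity), ← ENNReal.ofReal_add (by positivity)
            (by positivity), ← ENNReal.ofReal_mul ha0]
          apply ENNReal.ofReal_le_ofReal
          have hgR : (g : ℝ) ≤ R := by exact_mod_cast rootUnits_le hg
          have h3 : Real.exp ((g : ℝ) / R) ≤ 1 + 2 / R * g := by
            have hx0 : 0 ≤ (g : ℝ) / R := by positivity
            have hx1 : (g : ℝ) / R ≤ 1 := by rw [div_le_one hR0]; exact hgR
            have := Real.abs_exp_sub_one_sub_id_le (x := (g : ℝ) / R) (by rwa [abs_of_nonneg hx0])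
            have h5 := (abs_le.1 this).2
            have : 2 / (R : ℝ) * g = 2 * (g / R) := by ring
            rw [this]
            nlinarith
          calc _ ≤ Real.exp ((20 * m - (U + 1 : ℕ)) / R + g / R) := by
                apply Real.exp_le_exp.2
                rw [← add_div]
                gcongr
                have : ((U + 1 : ℕ) : ℝ) ≤ ((U + 1 - g : ℕ) : ℝ) + g := by
                  exact_mod_cast (by omega : U + 1 ≤ U + 1 - g + g)
                linarith
            _ = a * Real.exp ((g : ℝ) / R) := by rw [Real.exp_add]
            _ ≤ _ := by gcongr
        refine (PMF.expect_mono_of_support h2).trans ?_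
        rw [PMF.expect_const_mul, PMF.expect_add, PMF.expect_const, PMF.expect_const_mul,
          expect_rootUnits]
      refine (PMF.expect_mono fun i => h1 (vertexOf hn i)).trans ?_
      rw [expect_uniformBelow hn fun v =>
        ENNReal.ofReal a * (1 + ENNReal.ofReal (2 / R) * startLife N T R v)]
      have hn0 : (n : ℝ≥0∞) ≠ 0 := by simp; omega
      calc _ = ENNReal.ofReal a * (n + ENNReal.ofReal (2 / R) * ∑ v, startLife N T R v) / n := by
            rw [← Finset.mul_sum, Finset.sum_add_distrib, ← Finset.mul_sum]; simp
        _ ≤ ENNReal.ofReal a * (n + ENNReal.ofReal (2 / R) * (10 * n)) / n := by gcongr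
        _ = ENNReal.ofReal a * (1 + ENNReal.ofReal (2 / R) * 10) * (n / n) := by
            rw [← mul_div_assoc]; congr 1; ring
        _ = ENNReal.ofReal (a * (1 + 2 / R * 10)) := by
            rw [ENNReal.div_self hn0 (by simp), mul_one, ENNReal.ofReal_mul ha0,
              ENNReal.ofReal_add (by positivity) (by positivity),
              ENNReal.ofReal_mul (by positivity)]
            simp
        _ ≤ _ := by
            apply ENNReal.ofReal_le_ofReal
            have h4 : 1 + 2 / (R : ℝ) * 10 ≤ Real.exp (20 / R) := by
              have := Real.add_one_le_exp (20 / (R : ℝ))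
              have e : 2 / (R : ℝ) * 10 = 20 / R := by ring
              linarith
            calc _ ≤ a * Real.exp (20 / R) := by gcongr
              _ = _ := by
                rw [ha, ← Real.exp_add, ← add_div]
                congr 2
                push_cast; ring

/-- A random vertex hits the core `S` with probability `#S / n`, and then its process uses up all of
its `R` units with probability at least `1 / 2`. -/
theorem tester_false_le (hn : 0 < n) {R : ℕ} (hR : 1 ≤ R) (hT : 1 ≤ T) {S : Fin n → Bool}
    (hS : ∀ v, S v → 480 * T ≤ (N v).countP S) (m U : ℕ) :
    ((tester N T hn R m U).expect fun b => if b then 0 else 1) ≤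
      ENNReal.ofReal (Real.exp (U / R -
        m * ((Finset.univ.filter fun v => S v).card / (4 * n)))) := by
  have hR0 : (0 : ℝ) < R := by exact_mod_cast hR
  have hn0 : (0 : ℝ) < n := by exact_mod_cast hn
  set s : ℕ := (Finset.univ.filter fun v => S v).card with hs
  induction m generalizing U with
  | zero =>
    cases U with
    | zero => simp [tester, PMF.expect_pure]
    | succ U =>
      rw [tester, PMF.expect_pure, if_neg (by simp), ← ENNReal.ofReal_one]
      apply ENNReal.ofReal_le_ofReal
      rw [Real.one_le_exp_iff]
      simp only [Nat.cast_zero, zero_mul, sub_zero]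
      positivity
  | succ m ih =>
    cases U with
    | zero => simp [tester, PMF.expect_pure]
    | succ U =>
      rw [tester, PMF.expect_bind]
      set a : ℝ := Real.exp ((U + 1 : ℕ) / R - m * (s / (4 * n))) with ha
      have ha0 : 0 ≤ a := by positivity
      set q : ℝ := Real.exp (-1) with hq
      have hq0 : 0 ≤ q := by positivity
      have hq1 : q ≤ 1 / 2 := by
        rw [hq, Real.exp_neg, ← one_div]
        apply one_div_le_one_div_of_le (by norm_num)
        have := Real.add_one_le_exp (1 : ℝ)
        linarith
      have h1 : ∀ v, ((rootUnits N T R v).bind fun g => tester N T hn R m (U + 1 - g)).expect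
          (fun b => if b then 0 else 1) ≤
          ENNReal.ofReal (a * (1 - if S v then (1 - q) / 2 else 0)) := by
        intro v
        rw [PMF.expect_bind]
        have h2 : ∀ g, ((tester N T hn R m (U + 1 - g)).expect fun b => if b then 0 else 1) ≤
            ENNReal.ofReal (a * q) + ENNReal.ofReal (a * (1 - q)) * (if g < R then 1 else 0) := by
          intro g
          by_cases hgU : U + 1 ≤ g
          · have : U + 1 - g = 0 := by omega
            rw [this]
            have h3 : tester N T hn R m 0 = PMF.pure true := by cases m <;> rw [tester]
            rw [h3, PMF.expect_pure]
            simp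
          · refine (ih _).trans ?_
            have h3 : ((U + 1 - g : ℕ) : ℝ) = (U + 1 : ℕ) - g := by
              rw [Nat.cast_sub (by omega)]
            rw [h3]
            split_ifs with hgR
            · rw [mul_one, ← ENNReal.ofReal_add (by positivity)
                (mul_nonneg ha0 (by linarith))]
              apply ENNReal.ofReal_le_ofReal
              have : a * q + a * (1 - q) = a := by ring
              rw [this, ha]
              apply Real.exp_le_exp.2
              gcongr
              have : (0 : ℝ) ≤ g := by positivity
              linarith
            · rw [mul_zero, add_zero]
              apply ENNReal.ofReal_le_ofReal
              rw [ha, hq, ← Real.exp_add]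
              apply Real.exp_le_exp.2
              rw [sub_div]
              have : 1 ≤ (g : ℝ) / R := by
                rw [one_le_div hR0]; exact_mod_cast not_lt.1 hgR
              linarith
        refine (PMF.expect_mono h2).trans ?_
        rw [PMF.expect_add, PMF.expect_const, PMF.expect_const_mul]
        have h5 : ((rootUnits N T R v).expect fun g => if g < R then 1 else 0) ≤
            ENNReal.ofReal (if S v then 1 / 2 else 1) := by
          split_ifs with hv
          · have hd : T ≤ (N v).length :=
              ((by omega : T ≤ 480 * T).trans (hS v hv)).trans List.countP_le_length
            have h6 := death_mkVertex_le hT hS R v hv 2 le_rfl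
            rw [rootUnits, start, if_pos hd, Option.elim_some]
            exact (expect_unitsUsed_lt R _).trans (by simpa using h6)
          · refine PMF.expect_le_const fun g _ => ?_
            split_ifs <;> simp
        calc _ ≤ ENNReal.ofReal (a * q) +
              ENNReal.ofReal (a * (1 - q)) * ENNReal.ofReal (if S v then 1 / 2 else 1) := by gcongr
          _ ≤ _ := by
            rw [← ENNReal.ofReal_mul (mul_nonneg ha0 (by linarith)),
              ← ENNReal.ofReal_add (by positivity)
              (mul_nonneg (mul_nonneg ha0 (by linarith)) (by split_ifs <;> norm_num))]
            apply ENNReal.ofReal_le_ofReal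
            split_ifs <;> (apply le_of_eq; ring)
      refine (PMF.expect_mono fun i => h1 (vertexOf hn i)).trans ?_
      rw [expect_uniformBelow hn fun v =>
        ENNReal.ofReal (a * (1 - if S v then (1 - q) / 2 else 0))]
      rw [← ENNReal.ofReal_sum_of_nonneg, ← ENNReal.ofReal_natCast, ← ENNReal.ofReal_div_of_pos hn0]
      · apply ENNReal.ofReal_le_ofReal
        rw [← Finset.mul_sum, Finset.sum_sub_distrib, ← Finset.sum_filter, Finset.sum_const,
          Finset.sum_const, ← hs, Finset.card_univ, Fintype.card_fin]
        simp only [nsmul_eq_mul, mul_one]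
        have h7 : ((n : ℝ) - s * ((1 - q) / 2)) / n ≤ Real.exp (-(s / (4 * n))) := by
          have h8 : ((n : ℝ) - s * ((1 - q) / 2)) / n ≤ 1 - s / (4 * n) := by
            rw [div_le_iff₀ hn0]
            have : (1 - s / (4 * n) : ℝ) * n = n - s / 4 := by field_simp
            rw [this]
            have : (0 : ℝ) ≤ s := by positivity
            nlinarith
          have := Real.add_one_le_exp (-(s / (4 * n : ℝ)))
          linarith
        calc _ = a * (((n : ℝ) - s * ((1 - q) / 2)) / n) := by ring
          _ ≤ a * Real.exp (-(s / (4 * n))) := by gcongr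
          _ = _ := by
            rw [ha, ← Real.exp_add]
            congr 1
            push_cast; ring
      · intro v _
        refine mul_nonneg ha0 ?_
        split_ifs <;> linarith

/-- On graphs of small arboricity, the tester rarely reports that there is a dense core. -/
theorem tester_true_le_of_sparse (hn : 0 < n) {R ℓ : ℕ} (hR : 1 ≤ R)
    (hlife : ∑ v, startLife N T R v ≤ 10 * n) :
    ((tester N T hn R (ℓ * R) (40 * ℓ * R)).expect fun b => if b then 1 else 0) ≤
      ENNReal.ofReal (Real.exp (-(20 * ℓ))) := by
  refine (tester_true_le hn hR hlife _ _).trans (le_of_eq ?_)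
  have hR0 : (R : ℝ) ≠ 0 := by positivity
  congr 2
  push_cast
  field_simp
  ring

/-- On graphs with a dense core, the tester rarely misses it. -/
theorem tester_false_le_of_core (hn : 0 < n) {ℓ : ℕ} (hT : 1 ≤ T) (hTn : T ≤ n) {S : Fin n → Bool}
    (hne : ∃ v, S v) (hnd : ∀ v, (N v).Nodup)
    (hS : ∀ v, S v → 480 * T ≤ (N v).countP S) :
    ((tester N T hn (n / T) (ℓ * (n / T)) (40 * ℓ * (n / T))).expect fun b => if b then 0 else 1) ≤
      ENNReal.ofReal (Real.exp (-(20 * ℓ))) := by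
  have hR : 1 ≤ n / T := (Nat.one_le_div_iff hT).2 hTn
  set R := n / T with hRdef
  refine (tester_false_le hn hR hT hS _ _).trans ?_
  apply ENNReal.ofReal_le_ofReal
  apply Real.exp_le_exp.2
  have hR0 : (0 : ℝ) < R := by exact_mod_cast hR
  have hn0 : (0 : ℝ) < n := by exact_mod_cast hn
  obtain ⟨v, hv⟩ := hne
  -- a core is larger than its minimum degree
  have hcard : 480 * T ≤ (Finset.univ.filter fun v => S v).card := by
    refine (hS v hv).trans ?_
    rw [List.countP_eq_length_filter, ← List.toFinset_card_of_nodup ((hnd v).filter _)]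
    refine Finset.card_le_card fun u hu => ?_
    simp at hu
    simp [hu.2]
  have hcard' : (480 : ℝ) * T ≤ (Finset.univ.filter fun v => S v).card := by exact_mod_cast hcard
  have hTR : (n : ℝ) ≤ 2 * (T * R) := by
    have h1 := Nat.div_add_mod n T
    have h2 := Nat.mod_lt n (by omega : T > 0)
    have h3 : T * 1 ≤ T * R := Nat.mul_le_mul_left _ hR
    have : n ≤ 2 * (T * R) := by rw [hRdef] at h3 ⊢; omega
    exact_mod_cast this
  have h4 : (60 : ℝ) ≤ R * ((Finset.univ.filter fun v => S v).card / (4 * n)) := by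
    rw [← mul_div_assoc, le_div_iff₀ (by positivity)]
    nlinarith
  push_cast
  have h5 : (40 * ℓ * R : ℝ) / R = 40 * ℓ := by field_simp
  rw [h5]
  have : (0 : ℝ) ≤ ℓ := by positivity
  nlinarith

end Peeling

/-! ### Orientations and cores from the arboricity -/

namespace SimpleGraph

variable {V : Type*}

/-- The edges of a forest can be oriented so that every vertex has at most one outgoing edge: root
every tree, and orient the edges toward the roots. -/
theorem IsAcyclic.exists_parent {F : SimpleGraph V} (hF : F.IsAcyclic) :
    ∃ par : V → V, ∀ u v, F.Adj u v → par u = v ∨ par v = u := by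
  classical
  set root : V → V := fun v => Quot.out (F.connectedComponentMk v) with hroot
  have hreach : ∀ v, F.Reachable (root v) v := fun v =>
    ConnectedComponent.exact (Quot.out_eq (F.connectedComponentMk v))
  choose p hp hlen using fun v => (hreach v).exists_path_of_dist
  have key : ∀ v w, F.Adj w v → F.dist (root v) v = F.dist (root v) w + 1 →
      (p v).penultimate = w := by
    intro v w hwv hd
    obtain ⟨q, hq⟩ := ((hreach v).trans hwv.symm.reachable).exists_walk_length_eq_dist
    have h1 : (q.concat hwv).IsPath :=
      Walk.isPath_of_length_eq_dist _ (by rw [Walk.length_concat, hq, hd])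
    have h2 := (hF.subsingleton_path (root v) v).elim ⟨p v, hp v⟩ ⟨_, h1⟩
    have h3 : p v = q.concat hwv := congrArg Subtype.val h2
    rw [h3, Walk.penultimate_concat]
  refine ⟨fun v => (p v).penultimate, fun u v huv => ?_⟩
  have hr : root u = root v := by
    simp only [hroot]
    rw [ConnectedComponent.sound huv.reachable]
  rcases hF.dist_eq_dist_add_one_of_adj_of_reachable (root u) huv (hreach u) with h | h
  · exact Or.inl (key u v huv.symm h)
  · exact Or.inr (key v u huv (hr ▸ h))

/-- An enumeration of a finite vertex set in which every vertex has few later neighbours exists if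
every nonempty subset has a vertex with few neighbours in it. -/
theorem exists_degeneracy_order [Fintype V] [DecidableEq V] (G : SimpleGraph V) [DecidableRel G.Adj]
    {k : ℕ} (hk : ∀ S : Finset V, S.Nonempty → ∃ v ∈ S, (S.filter (G.Adj v)).card ≤ k)
    (S : Finset V) :
    ∃ r : V → ℕ, Set.InjOn r S ∧ ∀ v ∈ S, (S.filter fun u => G.Adj v u ∧ r v < r u).card ≤ k := by
  induction S using Finset.strongInduction with
  | H S ih =>
    rcases S.eq_empty_or_nonempty with rfl | hS
    · exact ⟨fun _ => 0, by simp, by simp⟩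
    · obtain ⟨v, hv, hvk⟩ := hk S hS
      obtain ⟨r, hr, hrk⟩ := ih (S.erase v) (Finset.erase_ssubset hv)
      refine ⟨fun u => if u = v then 0 else r u + 1, ?_, fun u hu => ?_⟩
      · intro x hx y hy hxy
        simp only at hxy
        split_ifs at hxy with h1 h2 h2
        · rw [h1, h2]
        · refine hr ?_ ?_ (by omega) <;> simp_all
      · by_cases huv : u = v
        · subst huv
          refine (Finset.card_le_card ?_).trans hvk
          intro x hx
          simp only [Finset.mem_filter] at hx ⊢
          exact ⟨hx.1, hx.2.1⟩
        · refine (Finset.card_le_card ?_).trans (hrk u (Finset.mem_erase.2 ⟨huv, hu⟩))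
          intro x hx
          simp only [Finset.mem_filter, if_neg huv, Finset.mem_erase] at hx ⊢
          obtain ⟨hx1, hx2, hx3⟩ := hx
          split_ifs at hx3 with h
          · omega
          · exact ⟨⟨h, hx1⟩, hx2, by omega⟩

/-- A graph whose vertices can be enumerated such that each has at most `k` later neighbours
is partitioned into `k` forests: distribute the edges from each vertex to its later neighbours. -/
theorem exists_forests_of_order [Fintype V] [DecidableEq V] (G : SimpleGraph V) [DecidableRel G.Adj]
    {k : ℕ} {r : V → ℕ} (hr : Function.Injective r)
    (hk : ∀ v, (Finset.univ.filter fun u => G.Adj v u ∧ r v < r u).card ≤ k) :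
    ∃ F : Fin k → SimpleGraph V,
      (∀ i, (F i).IsAcyclic) ∧ (∀ i j, i ≠ j → Disjoint (F i) (F j)) ∧ (⨆ i, F i) = G := by
  have hc : ∀ v, ∃ c : V → ℕ, ∀ u, G.Adj v u → r v < r u →
      c u < k ∧ ∀ u', G.Adj v u' → r v < r u' → c u = c u' → u = u' := by
    intro v
    set A := Finset.univ.filter fun u => G.Adj v u ∧ r v < r u with hA
    refine ⟨fun u => if h : u ∈ A then A.equivFin ⟨u, h⟩ else 0, fun u hu hru => ?_⟩
    have hu' : u ∈ A := by simp [hA, hu, hru]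
    refine ⟨?_, fun u' hu2 hru2 h => ?_⟩
    · simp only [dif_pos hu']
      exact (A.equivFin ⟨u, hu'⟩).2.trans_le (hk v)
    · have hu2' : u' ∈ A := by simp [hA, hu2, hru2]
      simp only [dif_pos hu', dif_pos hu2'] at h
      have := A.equivFin.injective (Fin.ext h)
      exact congrArg Subtype.val this
  choose c hc using hc
  let F : Fin k → SimpleGraph V := fun i =>
    { Adj := fun u v => G.Adj u v ∧ ((r u < r v ∧ c u v = i) ∨ (r v < r u ∧ c v u = i))
      symm := ⟨fun u v h => ⟨h.1.symm, h.2.symm⟩⟩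
      loopless := ⟨fun u h => G.loopless.irrefl u h.1⟩ }
  refine ⟨F, fun i => ?_, fun i j hij => ?_, ?_⟩
  · intro v p hp
    obtain ⟨x, hx, hmin⟩ := Finset.exists_min_image p.support.toFinset r
      ⟨v, by simp⟩
    rw [List.mem_toFinset] at hx
    have hq := hp.rotate hx
    set q := p.rotate x hx with hqdef
    have later : ∀ u ∈ q.support, (F i).Adj x u → G.Adj x u ∧ r x < r u ∧ c x u = i := by
      intro u hu hxu
      have : u ∈ p.support := (Walk.mem_support_rotate_iff p x hx).1 hu
      have h1 := hmin u (by simpa using this)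
      refine ⟨hxu.1, ?_⟩
      rcases hxu.2 with h | h
      · exact h
      · omega
    obtain ⟨a1, a2, a3⟩ := later q.snd (q.getVert_mem_support 1) (q.adj_snd hq.not_nil)
    obtain ⟨b1, b2, b3⟩ := later q.penultimate (q.getVert_mem_support _)
      (q.adj_penultimate hq.not_nil).symm
    exact hq.snd_ne_penultimate ((hc x _ a1 a2).2 _ b1 b2 (a3.trans b3.symm))
  · rw [disjoint_iff]
    ext u v
    simp only [inf_adj, bot_adj, iff_false, F]
    rintro ⟨⟨-, h1⟩, -, h2⟩
    have : (i : ℕ) = j := by omega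
    exact hij (Fin.ext this)
  · ext u v
    rw [iSup_adj]
    constructor
    · rintro ⟨i, h⟩
      exact h.1
    · intro h
      rcases lt_trichotomy (r u) (r v) with h1 | h1 | h1
      · exact ⟨⟨c u v, (hc u v h h1).1⟩, h, Or.inl ⟨h1, rfl⟩⟩
      · exact (h.ne (hr h1)).elim
      · exact ⟨⟨c v u, (hc v u h.symm h1).1⟩, h, Or.inr ⟨h1, rfl⟩⟩

theorem exists_forests_of_degenerate [Fintype V] [DecidableEq V] (G : SimpleGraph V)
    [DecidableRel G.Adj]
    {k : ℕ} (hk : ∀ S : Finset V, S.Nonempty → ∃ v ∈ S, (S.filter (G.Adj v)).card ≤ k) :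
    ∃ F : Fin k → SimpleGraph V,
      (∀ i, (F i).IsAcyclic) ∧ (∀ i j, i ≠ j → Disjoint (F i) (F j)) ∧ (⨆ i, F i) = G := by
  obtain ⟨r, hr, hrk⟩ := G.exists_degeneracy_order hk Finset.univ
  exact G.exists_forests_of_order (fun x y h => hr (by simp) (by simp) h) fun v => hrk v (by simp)

theorem exists_forests_card [Fintype V] (G : SimpleGraph V) :
    ∃ F : Fin (Fintype.card V) → SimpleGraph V,
      (∀ i, (F i).IsAcyclic) ∧ (∀ i j, i ≠ j → Disjoint (F i) (F j)) ∧ (⨆ i, F i) = G := by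
  classical
  exact G.exists_forests_of_degenerate fun S ⟨v, hv⟩ => ⟨v, hv, Finset.card_le_univ _⟩

theorem arboricity_le_card [Fintype V] (G : SimpleGraph V) : arboricity G ≤ Fintype.card V :=
  Nat.sInf_le G.exists_forests_card

theorem exists_forests_arboricity [Fintype V] (G : SimpleGraph V) :
    ∃ F : Fin (arboricity G) → SimpleGraph V,
      (∀ i, (F i).IsAcyclic) ∧ (∀ i j, i ≠ j → Disjoint (F i) (F j)) ∧ (⨆ i, F i) = G :=
  Nat.sInf_mem (s := {k : ℕ | ∃ F : Fin k → SimpleGraph V, (∀ i, (F i).IsAcyclic) ∧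
    (∀ i j, i ≠ j → Disjoint (F i) (F j)) ∧ (⨆ i, F i) = G}) ⟨_, G.exists_forests_card⟩

theorem arboricity_pos [Fintype V] {G : SimpleGraph V} {u v : V} (h : G.Adj u v) :
    0 < arboricity G := by
  obtain ⟨F, -, -, hF⟩ := G.exists_forests_arboricity
  rw [← hF, iSup_adj] at h
  obtain ⟨i, -⟩ := h
  exact i.pos

end SimpleGraph

namespace IncidenceList

variable {n : ℕ} {G : SimpleGraph (Fin n)} (L : IncidenceList G)

theorem arboricity_pos_of_length {v : Fin n} (h : (L.nbrs v).length ≠ 0) : 0 < arboricity G := by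
  obtain ⟨u, hu⟩ := List.exists_mem_of_length_pos (Nat.pos_of_ne_zero h)
  exact SimpleGraph.arboricity_pos ((L.mem_nbrs v u).1 hu)

theorem countP_eq_card [DecidableRel G.Adj] (v : Fin n) (S : Fin n → Bool) :
    (L.nbrs v).countP S = (Finset.univ.filter fun u => G.Adj v u ∧ S u = true).card := by
  rw [List.countP_eq_length_filter, ← List.toFinset_card_of_nodup ((L.nodup v).filter _)]
  congr 1
  ext u
  simp [L.mem_nbrs]

/-- Any graph has an orientation whose out-degrees are at most the arboricity. -/
theorem exists_orientation :
    ∃ o : Fin n → Fin n → Bool, (∀ v, ∀ u ∈ L.nbrs v, o v u = false → o u v = true) ∧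
      ∀ v, (L.nbrs v).countP (o v) ≤ arboricity G := by
  classical
  obtain ⟨F, hF, -, hG⟩ := G.exists_forests_arboricity
  choose par hpar using fun i => (hF i).exists_parent
  refine ⟨fun v u => decide (∃ i, par i v = u), fun v u hu h => ?_, fun v => ?_⟩
  · have h1 := (L.mem_nbrs v u).1 hu
    rw [← hG, SimpleGraph.iSup_adj] at h1
    obtain ⟨i, hi⟩ := h1
    simp only [decide_eq_false_iff_not, not_exists, decide_eq_true_eq] at h ⊢
    exact ⟨i, (hpar i v u hi).resolve_left (h i)⟩
  · rw [countP_eq_card]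
    have : (Finset.univ.filter fun u => G.Adj v u ∧ decide (∃ i, par i v = u) = true) ⊆
        Finset.univ.image fun i => par i v := by
      intro u hu
      simp only [Finset.mem_filter, decide_eq_true_eq] at hu
      simpa using hu.2.2
    exact (Finset.card_le_card this).trans (Finset.card_image_le.trans_eq (by simp))

/-- Any graph has a nonempty subgraph whose minimum degree is at least the arboricity. -/
theorem exists_core (h : 0 < arboricity G) :
    ∃ S : Fin n → Bool, (∃ v, S v) ∧ ∀ v, S v → arboricity G ≤ (L.nbrs v).countP S := by
  classical
  by_contra hcon
  push Not at hcon
  have h1 : arboricity G ≤ arboricity G - 1 := by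
    refine Nat.sInf_le (G.exists_forests_of_degenerate fun S hS => ?_)
    obtain ⟨v, hv, hlt⟩ := hcon (fun u => decide (u ∈ S))
      (by obtain ⟨v, hv⟩ := hS; exact ⟨v, by simpa using hv⟩)
    refine ⟨v, by simpa using hv, ?_⟩
    rw [countP_eq_card] at hlt
    refine Nat.le_sub_one_of_lt ((Finset.card_le_card ?_).trans_lt hlt)
    intro u hu
    simp only [Finset.mem_filter, Finset.mem_univ, true_and, decide_eq_true_eq] at hu ⊢
    exact ⟨hu.2, hu.1⟩
  omega

end IncidenceList

/-! ### The tree of processes is shallow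

A process that passes on time has at least two living children, and serves them in turn. Hence each
of them has received less than half of its time, and the unit of time descends to logarithmic depth
only. A child may have at most twice the threshold of its parent, so that thresholds stay small. -/

namespace Peeling

open Peeler

variable {n : ℕ}

/-- The threshold of a process. -/
def Peeler.th : Peeler n → ℕ
  | node _ _ th _ _ _ _ _ => th

variable (N : Fin n → List (Fin n)) (T : ℕ)

/-- An invariant of a process that has received fewer than `k` units of time. The children in `td`
have been served less often than `m` times, and those in `dn` once more. -/
inductive Balanced : Peeler n → ℕ → Prop
  | mk (v : Fin n) (b : Bool) (th rem sl : ℕ) (dr : List (Fin n)) (dn td : List (Peeler n))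
      (k m : ℕ) (hth : 2 ≤ th) (hdeg : T ≤ (N v).length)
      (hk : 1 + (m + 1) * dn.length + m * td.length ≤ k)
      (hsl : sl + 2 ≤ dn.length + td.length + rem)
      (hrem : rem ≠ 0 → td = [] ∧ m = 0)
      (hdn : ∀ y ∈ dn, Balanced y (m + 1)) (htd : ∀ y ∈ td, Balanced y m)
      (hdn' : ∀ y ∈ dn, y.th ≤ 2 * th) (htd' : ∀ y ∈ td, y.th ≤ 2 * th) :
      Balanced (node v b th rem sl dr dn td) k

variable {N T}

theorem Balanced.pos {x : Peeler n} {k : ℕ} (h : Balanced N T x k) : 1 ≤ k := by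
  cases h; omega

theorem Balanced.two_le_th {x : Peeler n} {k : ℕ} (h : Balanced N T x k) : 2 ≤ x.th := by
  cases h; assumption

theorem Balanced.le_length {v : Fin n} {b : Bool} {th rem sl : ℕ} {dr : List (Fin n)}
    {dn td : List (Peeler n)} {k : ℕ} (h : Balanced N T (node v b th rem sl dr dn td) k) :
    T ≤ (N v).length := by
  cases h; assumption

theorem balanced_mkVertex {v : Fin n} (hv : T ≤ (N v).length) {th : ℕ} (hth : 2 ≤ th) :
    Balanced N T (mkVertex v th) 1 :=
  .mk v false th 2 0 [] [] [] 1 0 hth hv (by simp) (by simp) (by simp) (by simp) (by simp)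
    (by simp) (by simp)

theorem balanced_mkBatch (hT : 1 ≤ T) {v : Fin n} (hv : T ≤ (N v).length) {th : ℕ}
    (hth : 2 ≤ th) : Balanced N T (mkBatch N T v th) 1 := by
  have h1 : 1 ≤ (N v).length / T := (Nat.one_le_div_iff hT).2 hv
  have h2 : th * 1 ≤ th * ((N v).length / T) := Nat.mul_le_mul_left _ h1
  exact .mk v true th _ _ [] [] [] 1 0 hth hv (by simp) (by simp; omega) (by simp) (by simp)
    (by simp) (by simp) (by simp)

/-- When no more children are to be created, the next child is served; the children form a queue,
and the order of `td` before `dn` in it is all that matters. -/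
theorem Balanced.serve {v : Fin n} {b : Bool} {th sl : ℕ} {dr : List (Fin n)}
    {dn td : List (Peeler n)} {k : ℕ} (h : Balanced N T (node v b th 0 sl dr dn td) k) :
    ∃ (c : Peeler n) (dn' td' : List (Peeler n)) (m : ℕ), td ++ dn = c :: (td' ++ dn') ∧
      td' ++ dn' ≠ [] ∧
      give N T (node v b th 0 sl dr dn td) = (give N T c).map (absorb v b th 0 sl dr dn' td') ∧
      Balanced N T (node v b th 0 sl dr dn' (c :: td')) k ∧
      Balanced N T c m ∧ c.th ≤ 2 * th ∧ 2 * m + 1 ≤ k := by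
  have key : ∀ (c : Peeler n) (td' dn' : List (Peeler n)),
      Balanced N T (node v b th 0 sl dr dn' (c :: td')) k →
      td' ++ dn' ≠ [] ∧ ∃ m, Balanced N T c m ∧ c.th ≤ 2 * th ∧ 2 * m + 1 ≤ k := by
    intro c td' dn' h
    cases h with
    | mk v b th rem sl dr dn td k m h1 h2 h3 h4 h5 h6 h7 h8 h9 =>
      simp only [List.length_cons] at h3 h4
      refine ⟨fun h => ?_, m, h7 c (by simp), h9 c (by simp), ?_⟩
      · obtain ⟨rfl, rfl⟩ := List.append_eq_nil_iff.1 h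
        simp at h4
      · have : m * 1 ≤ m * (dn'.length + td'.length) := Nat.mul_le_mul_left _ (by omega)
        nlinarith
  rcases td with _ | ⟨c, td⟩
  · cases h with
    | mk v b th rem sl dr dn td k m h1 h2 h3 h4 h5 h6 h7 h8 h9 =>
      rcases dn with _ | ⟨c, dn⟩
      · simp at h4
      · have hB : Balanced N T (node v b th 0 sl dr [] (c :: dn)) k :=
          .mk v b th 0 sl dr [] (c :: dn) k (m + 1) h1 h2 (by simpa using h3) (by simpa using h4)
            (by simp) (by simp) h6 (by simp) h8
        obtain ⟨hne, m', hm⟩ := key _ _ _ hB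
        exact ⟨c, [], dn, m', by simp, hne, by rw [give_wrap, give_cons], hB, hm⟩
  · obtain ⟨hne, m', hm⟩ := key _ _ _ h
    exact ⟨c, dn, td, m', by simp, hne, give_cons _ _ _ _ _ _ _ _ _ _, h, hm⟩

theorem th_of_absorb {v : Fin n} {b : Bool} {th rem sl : ℕ} {dr : List (Fin n)}
    {dn td : List (Peeler n)} {o : Option (Peeler n)} {x : Peeler n}
    (h : absorb v b th rem sl dr dn td o = some x) : x.th = th := by
  cases o with
  | none =>
    simp only [absorb] at h
    split_ifs at h
    cases h; rfl
  | some y => cases h; rfl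

/-- The invariant is preserved when a process creates a child. -/
theorem Balanced.absorb_create {v : Fin n} {b : Bool} {th rem sl : ℕ} {dr dr' : List (Fin n)}
    {dn td : List (Peeler n)} {k : ℕ} (h : Balanced N T (node v b th rem sl dr dn td) k)
    (hr : rem ≠ 0) {o : Option (Peeler n)}
    (ho : ∀ y, o = some y → Balanced N T y 1 ∧ y.th ≤ 2 * th) {x : Peeler n}
    (hx : absorb v b th (rem - 1) sl dr' dn td o = some x) : Balanced N T x (k + 1) := by
  cases h with
  | mk v b th rem sl dr dn td k m h1 h2 h3 h4 h5 h6 h7 h8 h9 =>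
    obtain ⟨rfl, rfl⟩ := h5 hr
    cases o with
    | none =>
      simp only [absorb] at hx
      split_ifs at hx with hs
      cases hx
      exact .mk v b th _ _ dr' dn [] _ 0 h1 h2 (by simp at h3 ⊢; omega) (by simp at h4 ⊢; omega)
        (by simp) h6 (by simp) h8 (by simp)
    | some y =>
      cases hx
      obtain ⟨hy1, hy2⟩ := ho y rfl
      refine .mk v b th _ _ dr' _ [] _ 0 h1 h2 (by simp at h3 ⊢; omega)
        (by simp at h4 ⊢; omega) (by simp) ?_ (by simp) ?_ (by simp)
      · intro z hz
        rcases List.mem_append.1 hz with hz | hz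
        · exact h6 z hz
        · rw [List.mem_singleton] at hz; subst hz; exact hy1
      · intro z hz
        rcases List.mem_append.1 hz with hz | hz
        · exact h8 z hz
        · rw [List.mem_singleton] at hz; subst hz; exact hy2

theorem balanced_start {u : Fin n} {y : Peeler n} (h : start N T u = some y) :
    Balanced N T y 1 ∧ y.th = 2 := by
  unfold start at h
  split_ifs at h with hd
  cases h
  exact ⟨balanced_mkVertex hd le_rfl, rfl⟩

/-- The invariant is preserved when a process receives a unit of time. -/
theorem Balanced.of_give (hT : 1 ≤ T) {x : Peeler n} {k : ℕ} (h : Balanced N T x k) {y : Peeler n}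
    (hy : give N T x (some y) ≠ 0) : Balanced N T y (k + 1) ∧ y.th = x.th := by
  induction k using Nat.strong_induction_on generalizing x y with
  | _ k ih =>
  obtain ⟨v, b, th, rem, sl, dr, dn, td⟩ := x
  by_cases hr : rem = 0
  · subst hr
    obtain ⟨c, dn', td', m, -, -, hg, hB, hc, hcth, hm⟩ := h.serve
    rw [hg, PMF.map_apply_ne_zero] at hy
    obtain ⟨o, ho, hoy⟩ := hy
    refine ⟨?_, th_of_absorb hoy⟩
    have hchild := fun y hy => ih m (by omega) hc (y := y) hy
    cases hB with
    | mk v b th rem sl dr dn td k m' h1 h2 h3 h4 h5 h6 h7 h8 h9 =>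
      simp only [List.length_cons] at h3 h4
      cases o with
      | none =>
        simp only [absorb] at hoy
        split_ifs at hoy with hs
        cases hoy
        exact .mk v b th 0 _ dr dn' td' _ m' h1 h2 (by nlinarith) (by omega) (by simp) h6
          (fun z hz => h7 z (by simp [hz])) h8 (fun z hz => h9 z (by simp [hz]))
      | some z =>
        cases hoy
        -- the child may have received fewer units than its place in the queue indicates
        have hz : Balanced N T z (m' + 1) ∧ z.th = c.th := by
          refine ih m' ?_ (h7 c (by simp)) ho
          have : m' * 1 ≤ m' * (dn'.length + td'.length) := Nat.mul_le_mul_left _ (by omega)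
          nlinarith
        refine .mk v b th 0 _ dr _ td' _ m' h1 h2 ?_ (by simp; omega) (by simp) ?_
          (fun z hz => h7 z (by simp [hz])) ?_ (fun z hz => h9 z (by simp [hz]))
        · rw [List.length_append, List.length_singleton]
          nlinarith
        · intro u hu
          rcases List.mem_append.1 hu with hu | hu
          · exact h6 u hu
          · rw [List.mem_singleton] at hu; subst hu; exact hz.1
        · intro u hu
          rcases List.mem_append.1 hu with hu | hu
          · exact h8 u hu
          · rw [List.mem_singleton] at hu; subst hu; rw [hz.2]; exact hcth
  · have hth : 2 ≤ th := h.two_le_th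
    cases b
    · rw [give_vertex _ _ _ _ _ _ hr, PMF.pure_apply_ne_zero] at hy
      refine ⟨h.absorb_create hr (fun z hz => ?_) hy.symm, th_of_absorb hy.symm⟩
      cases hz
      split_ifs
      · exact ⟨balanced_mkBatch hT h.le_length hth, by simp [mkBatch, Peeler.th]; omega⟩
      · exact ⟨balanced_mkVertex h.le_length (by omega), le_rfl⟩
    · rw [give_batch _ _ _ _ _ _ hr, PMF.map_apply_ne_zero] at hy
      obtain ⟨u, -, hu⟩ := hy
      refine ⟨h.absorb_create hr (fun z hz => ?_) hu, th_of_absorb hu⟩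
      obtain ⟨h1, h2⟩ := balanced_start hz
      exact ⟨h1, by omega⟩

end Peeling

/-! ### Processes in the memory of the machine

A process is kept in a record of 16 cells. The fields of a record hold:

* `0`: the number of the record of the parent (`0` for the root of the tree),
* `1`: the number of the vertex,
* `2`: the parameter `th`,
* `3`: the kind, `1` for a batch,
* `4`: the number of children to be created,
* `5`: the number of children that may still die,
* `6`: the number of the record of the first child,
* `7`: the address of the cell for the pointer to the next child that is appended,
* `8`: the number of the record of the next sibling,
* `9`: the content of field `7` before the last child was appended.

The children form a queue, in the order of `td` followed by `dn`. When a child is served, it is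
first moved to the end of the queue; this is undone if the child has died. The records of dead
processes are not reused before the process of the next vertex starts.

The registers hold:

* `0`, `1`, `2`: the number of vertices, the threshold `T`, and the repetition factor of the tester,
* `3`: the number of units of time for a vertex,
* `4`, `5`: the numbers of vertices to be tested, and of units of time left for them,
* `6`, `7`: the numbers of units of time left for the current vertex, and used by it,
* `8`, `9`: the constants `1` and `0`,
* `10`, `11`: the numbers of the current record, and of the first free record,
* `12`: whether the last process that was served has died,
* `13`: the condition of the loops that descend and that repeat,
* `14`, …, `31`: temporary data. -/

namespace WordRAM

variable {n : ℕ} {G : SimpleGraph (Fin n)} {w : ℕ} {L : IncidenceList G}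

namespace Store

variable (s : Store) (r r' x p q : ℕ)

@[simp] theorem setReg_reg : (s.setReg r x).reg r' = if r' = r then x else s.reg r' := by
  simp [setReg, Function.update_apply]

@[simp] theorem setReg_mem : (s.setReg r x).mem = s.mem := rfl

@[simp] theorem setMem_reg : (s.setMem p x).reg = s.reg := rfl

@[simp] theorem setMem_mem : (s.setMem p x).mem q = if q = p then x else s.mem q := by
  simp [setMem, Function.update_apply]

@[simp] theorem answer_reg : (s.answer r x).reg r' = if r' = r then x else s.reg r' := by
  simp [answer, setReg, Function.update_apply]

@[simp] theorem answer_mem : (s.answer r x).mem = s.mem := rfl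

end Store

/-- The address of the field `f` of the record number `p`. Records have 16 fields. -/
def cell (p f : ℕ) : ℕ := 16 * p + f

theorem cell_inj {p q f g : ℕ} (hf : f < 16) (hg : g < 16) :
    cell p f = cell q g ↔ p = q ∧ f = g := by
  unfold cell
  omega

namespace Cmd

/-- Sequential composition of a list of commands. -/
def block : List Cmd → Cmd
  | [] => .const 31 0
  | [c] => c
  | c :: d :: l => .seq c (block (d :: l))

/-- Write the address of the field `f` of the record whose number is in register `p` to
register `r`. Registers `30` and `31` are scratch registers. -/
def lea (r p f : ℕ) : Cmd :=
  block [.const 30 16, .bin .mul 30 p 30, .const 31 f, .bin .add r 30 31]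

/-- Load the field `f` of the record whose number is in register `p`. -/
def ld (r p f : ℕ) : Cmd := .seq (lea 30 p f) (.load r 30)

/-- Store register `r` to the field `f` of the record whose number is in register `p`. -/
def st (p f r : ℕ) : Cmd := .seq (lea 30 p f) (.store 30 r)

variable {M r p f : ℕ} {s : Store}

theorem lea_eval (hM : 16 * M < 2 ^ w) (hp : s.reg p < M) (hf : f < 16) (hp' : p < 30) :
    (lea r p f).eval w L s =
      (((((s.setReg 30 16).setReg 30 (16 * s.reg p)).setReg 31 f)).setReg r
        (cell (s.reg p) f)) := by
  have h1 : 16 % 2 ^ w = 16 := Nat.mod_eq_of_lt (by omega)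
  have h2 : f % 2 ^ w = f := Nat.mod_eq_of_lt (by omega)
  have h3 : s.reg p * 16 % 2 ^ w = 16 * s.reg p := by
    rw [Nat.mod_eq_of_lt (by omega), mul_comm]
  have h4 : (16 * s.reg p + f) % 2 ^ w = 16 * s.reg p + f := Nat.mod_eq_of_lt (by omega)
  have h5 : p ≠ 30 := by omega
  simp [lea, block, Cmd.eval, BinOp.eval, h1, h2, h3, h4, h5, cell]

theorem ld_eval (hM : 16 * M < 2 ^ w) (hp : s.reg p < M) (hf : f < 16) (hp' : p < 30) :
    (ld r p f).eval w L s = ((lea 30 p f).eval w L s).setReg r (s.mem (cell (s.reg p) f)) := by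
  rw [ld, Cmd.eval, lea_eval hM hp hf hp']
  simp [Cmd.eval]

theorem st_eval (hM : 16 * M < 2 ^ w) (hp : s.reg p < M) (hf : f < 16) (hp' : p < 30)
    (hr : r < 30) :
    (st p f r).eval w L s = ((lea 30 p f).eval w L s).setMem (cell (s.reg p) f) (s.reg r) := by
  have h1 : r ≠ 30 := by omega
  have h2 : r ≠ 31 := by omega
  rw [st, Cmd.eval, lea_eval hM hp hf hp']
  simp [Cmd.eval, h1, h2]

end Cmd

end WordRAM

namespace Peeling

open Peeler WordRAM

/-- The linked list of the record numbers `ps`, where the pointer to the first record is in the cell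
with address `a`, the pointer to the next record is in field 8 of each record, and `b` is the
address of the cell for the pointer to a record that is appended to the list. -/
def Chain (mem : ℕ → ℕ) : ℕ → List ℕ → ℕ → Prop
  | a, [], b => a = b
  | a, c :: ps, b => mem a = c ∧ Chain mem (cell c 8) ps b

theorem Chain.append {mem : ℕ → ℕ} {a b c : ℕ} {ps : List ℕ} (h : Chain mem a ps b)
    (hb : mem b = c) : Chain mem a (ps ++ [c]) (cell c 8) := by
  induction ps generalizing a with
  | nil => cases h; exact ⟨hb, rfl⟩
  | cons d ps ih => exact ⟨h.1, ih h.2⟩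

theorem Chain.end_eq {mem : ℕ → ℕ} {a b : ℕ} {ps : List ℕ} (h : Chain mem a ps b)
    (hne : ps ≠ []) : ∃ c ∈ ps, b = cell c 8 := by
  induction ps generalizing a with
  | nil => exact (hne rfl).elim
  | cons d ps ih =>
    rcases ps with _ | ⟨e, ps⟩
    · exact ⟨d, by simp, h.2.symm⟩
    · obtain ⟨c, hc, hb⟩ := ih h.2 (by simp)
      exact ⟨c, by simp [hc], hb⟩

/-- The cell at the end of a list does not belong to the data of the list. -/
theorem Chain.congr {mem mem' : ℕ → ℕ} {a b : ℕ} {ps : List ℕ} (h : Chain mem a ps b)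
    (hnd : ps.Nodup) (ha : ∀ c ∈ ps, a ≠ cell c 8)
    (hm : ∀ x, x ≠ b → (x = a ∨ ∃ c ∈ ps, x = cell c 8) → mem' x = mem x) :
    Chain mem' a ps b := by
  induction ps generalizing a with
  | nil => exact h
  | cons d ps ih =>
    obtain ⟨c, hc, hb⟩ := Chain.end_eq h (by simp)
    refine ⟨?_, ih h.2 (List.nodup_cons.1 hnd).2 (fun e he hde => ?_) fun x hx hx' => hm x hx ?_⟩
    · rw [hm a (by rw [hb]; exact ha c hc) (Or.inl rfl), h.1]
    · have := ((cell_inj (by norm_num) (by norm_num)).1 hde).1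
      subst this
      exact (List.nodup_cons.1 hnd).1 he
    · rcases hx' with rfl | ⟨e, he, rfl⟩
      · exact Or.inr ⟨d, by simp, rfl⟩
      · exact Or.inr ⟨e, by simp [he], rfl⟩

/-- A child process in memory: the number of its record, the process, and the set of the numbers of
records that belong to it. -/
abbrev Child (n : ℕ) := ℕ × Peeler n × Set ℕ

variable {n : ℕ}

/-- The fields of the record `p` that describe a process itself. -/
structure Fields (mem : ℕ → ℕ) (par p : ℕ) (v : Fin n) (b : Bool) (th rem sl : ℕ) : Prop where
  par : mem (cell p 0) = par
  vertex : mem (cell p 1) = v + 1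
  th : mem (cell p 2) = th
  kind : mem (cell p 3) = if b then 1 else 0
  rem : mem (cell p 4) = rem
  sl : mem (cell p 5) = sl

/-- The records of the children of the record `p` lie in `F`, and they are disjoint. -/
structure Separate (p : ℕ) (cs : List (Child n)) (F : Set ℕ) : Prop where
  mem : p ∈ F
  subset : ∀ c ∈ cs, c.2.2 ⊆ F
  notMem : ∀ c ∈ cs, p ∉ c.2.2
  disjoint : cs.Pairwise fun c d => Disjoint c.2.2 d.2.2

/-- The memory holds a process in the record `p` and further records with numbers in `F`; the record
of the parent is `par`. -/
inductive Rep (mem : ℕ → ℕ) : ℕ → ℕ → Peeler n → Set ℕ → Prop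
  | mk (par p : ℕ) (v : Fin n) (b : Bool) (th rem sl : ℕ) (dr : List (Fin n))
      (dn td : List (Peeler n)) (F : Set ℕ) (cs : List (Child n))
      (hf : Fields mem par p v b th rem sl)
      (hchain : Chain mem (cell p 6) (cs.map fun c => c.1) (mem (cell p 7)))
      (hcs : (cs.map fun c => c.2.1) = td ++ dn)
      (hchild : ∀ c ∈ cs, Rep mem p c.1 c.2.1 c.2.2)
      (hsep : Separate p cs F) :
      Rep mem par p (node v b th rem sl dr dn td) F

theorem Rep.mem {mem : ℕ → ℕ} {par p : ℕ} {x : Peeler n} {F : Set ℕ} (h : Rep mem par p x F) :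
    p ∈ F := by
  cases h; rename_i h; exact h.mem

theorem Separate.nodup {mem : ℕ → ℕ} {p : ℕ} {cs : List (Child n)} {F : Set ℕ}
    (h : Separate p cs F) (hc : ∀ c ∈ cs, Rep mem p c.1 c.2.1 c.2.2) :
    (cs.map fun c => c.1).Nodup := by
  rw [List.Nodup, List.pairwise_map]
  refine h.disjoint.imp_of_mem fun {c d} hc' hd' hcd heq => ?_
  exact Set.disjoint_left.1 hcd (hc c hc').mem (heq ▸ (hc d hd').mem)

theorem Separate.eq_of_mem {p q : ℕ} {cs : List (Child n)} {F : Set ℕ}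
    (h : Separate p cs F) {c d : Child n} (hc : c ∈ cs) (hd : d ∈ cs) (hqc : q ∈ c.2.2)
    (hqd : q ∈ d.2.2) : c = d := by
  by_contra hne
  have : Std.Symm fun c d : Child n => Disjoint c.2.2 d.2.2 := ⟨fun _ _ h => h.symm⟩
  have := h.disjoint.forall hc hd hne
  exact Set.disjoint_left.1 this hqc hqd

theorem Fields.congr {mem mem' : ℕ → ℕ} {par p : ℕ} {v : Fin n} {b : Bool} {th rem sl : ℕ}
    (h : Fields mem par p v b th rem sl) (hm : ∀ f < 8, mem' (cell p f) = mem (cell p f)) :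
    Fields mem' par p v b th rem sl := by
  obtain ⟨h1, h2, h3, h4, h5, h6⟩ := h
  constructor <;> rw [hm _ (by norm_num)] <;> assumption

theorem cell6_ne {p c : ℕ} : cell p 6 ≠ cell c 8 := by
  unfold cell
  omega

/-- The representation of a process depends only on the records in `F`, and not on the pointer from
the record `p` to its next sibling. -/
theorem Rep.congr {mem mem' : ℕ → ℕ} {par p : ℕ} {x : Peeler n} {F : Set ℕ}
    (h : Rep mem par p x F)
    (hm : ∀ q ∈ F, ∀ f < 16, q ≠ p ∨ f ≠ 8 → mem' (cell q f) = mem (cell q f)) :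
    Rep mem' par p x F := by
  induction h with
  | mk par p v b th rem sl dr dn td F cs hf hchain hcs hchild hsep ih =>
    have hp := hsep.mem
    have key : ∀ c ∈ cs, ∀ q ∈ c.2.2, q ∈ F ∧ q ≠ p := fun c hc q hq =>
      ⟨hsep.subset c hc hq, fun h => hsep.notMem c hc (h ▸ hq)⟩
    refine .mk par p v b th rem sl dr dn td F cs (hf.congr fun f hf => hm p hp f (by omega)
      (Or.inr (by omega))) ?_ hcs (fun c hc => ih c hc fun q hq f hf _ => ?_) hsep
    · rw [hm p hp 7 (by norm_num) (by norm_num)]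
      refine hchain.congr (hsep.nodup hchild) (fun c _ => cell6_ne) fun x _ hx => ?_
      rcases hx with rfl | ⟨c, hc, rfl⟩
      · exact hm p hp 6 (by norm_num) (by norm_num)
      · obtain ⟨d, hd, rfl⟩ := List.mem_map.1 hc
        obtain ⟨h1, h2⟩ := key d hd d.1 (hchild d hd).mem
        exact hm _ h1 8 (by norm_num) (Or.inl h2)
    · obtain ⟨h1, h2⟩ := key c hc q hq
      exact hm q h1 f hf (Or.inl h2)

/-- The state of the memory when the record `c` has just been appended to the queue of the
children `cs` of the record `p`, and the end of the list `cs` is still remembered in field 9. -/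
structure Appended (mem : ℕ → ℕ) (par p : ℕ) (v : Fin n) (b : Bool) (th rem sl : ℕ)
    (cs : List (Child n)) (F : Set ℕ) (c : ℕ) : Prop where
  fields : Fields mem par p v b th rem sl
  tail : mem (cell p 7) = cell c 8
  chain : Chain mem (cell p 6) (cs.map fun c => c.1) (mem (cell p 9))
  last : mem (mem (cell p 9)) = c
  child : ∀ d ∈ cs, Rep mem p d.1 d.2.1 d.2.2
  sep : Separate p cs F

end Peeling

/-! ### The code that serves a process -/

namespace WordRAM

variable {n : ℕ} {G : SimpleGraph (Fin n)} {w : ℕ} {L : IncidenceList G}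

/-- A command does not write to the registers below `k`. -/
def Cmd.Spares (k : ℕ) : Cmd → Prop
  | .const r _ | .bin _ r _ _ | .load r _ | .rand r _ | .degree r _ | .neighbor r _ _ => k ≤ r
  | .store _ _ => True
  | .seq p q | .ite _ p q => p.Spares k ∧ q.Spares k
  | .loop _ p => p.Spares k

theorem Cmd.Spares.eval_reg {k r : ℕ} (hr : r < k) : ∀ {c : Cmd}, c.Spares k → ∀ s : Store,
    (c.eval w L s).reg r = s.reg r
  | .const _ _, h, s | .bin _ _ _ _, h, s | .load _ _, h, s | .degree _ _, h, s
  | .neighbor _ _ _, h, s => by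
    simp only [Cmd.Spares] at h
    have : r ≠ _ := (hr.trans_le h).ne
    simp [Cmd.eval, this]
  | .store _ _, _, _ | .rand _ _, _, _ | .loop _ _, _, _ => by simp [Cmd.eval]
  | .seq p q, h, s => by
    rw [Cmd.eval, h.2.eval_reg hr, h.1.eval_reg hr]
  | .ite _ p q, h, s => by
    rw [Cmd.eval]
    split_ifs
    · exact h.1.eval_reg hr s
    · exact h.2.eval_reg hr s

end WordRAM

namespace Peeling

open Peeler WordRAM

variable {n : ℕ} {G : SimpleGraph (Fin n)} {w : ℕ} {L : IncidenceList G}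

namespace Code

open WordRAM.Cmd

/-- Set register 13 to whether all children of the process in register 10 have been created. -/
def test : Cmd := block [ld 14 10 4, .bin .eq 13 14 9]

/-- Move the first child of the process in register 10 to the end of its queue, and go to it. -/
def descend : Cmd :=
  block [ld 15 10 6, ld 16 15 8, st 10 6 16, ld 17 10 7, .store 17 15, st 10 9 17, lea 18 15 8,
    st 10 7 18, .bin .add 10 15 9, test]

/-- Undo the insertion of the last child of the process in register 10, which has died. If the
process dies, too, go to its parent, and otherwise stop. -/
def ascend : Cmd :=
  block [ld 14 10 9, st 10 7 14, ld 15 10 5,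
    .ite 15 (block [.bin .sub 15 15 8, st 10 5 15, .const 12 0, .const 10 0]) (ld 10 10 0)]

/-- Load the data of the process in register 10. -/
def readData : Cmd := block [ld 14 10 4, ld 15 10 1, ld 16 10 2, ld 17 10 3, .degree 19 15]

/-- Choose the data of the next child: vertex, threshold, kind, number of children, slack, and
whether it is dead. Register 20 holds the index of a random neighbour, which matters for batches
only. -/
def choose : Cmd :=
  .ite 17
    (block [.bin .add 20 20 8, .neighbor 22 15 20, .degree 27 22, .const 23 2, .const 24 0,
      .const 25 2, .const 26 0, .bin .lt 12 27 1])
    (block [.bin .add 22 15 9, .const 12 0, .const 28 2, .bin .eq 27 14 28,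
      .ite 27
        (block [.bin .add 23 16 9, .const 24 1, .bin .div 25 19 1, .bin .mul 25 16 25,
          .bin .sub 26 25 16])
        (block [.bin .add 23 16 16, .const 24 0, .const 25 2, .const 26 0])])

/-- Write a new record. -/
def write : Cmd :=
  block [st 11 0 10, st 11 1 22, st 11 2 23, st 11 3 24, st 11 4 25, st 11 5 26, lea 29 11 6,
    st 11 7 29]

/-- Append the new record to the children of the process in register 10. -/
def push : Cmd :=
  block [.bin .sub 21 14 8, st 10 4 21, ld 27 10 7, .store 27 11, st 10 9 27, lea 29 11 8,
    st 10 7 29, .bin .add 11 11 8, .ite 12 (.const 28 0) (.const 10 0)]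

/-- Create a child of the process in register 10. -/
def create : Cmd := .seq readData (.seq (.rand 20 19) (.seq choose (.seq write push)))

theorem descend_plain : descend.Plain := by
  simp [descend, test, block, ld, st, lea, Plain]

theorem ascend_plain : ascend.Plain := by
  simp [ascend, block, ld, st, lea, Plain]

theorem readData_plain : readData.Plain := by simp [readData, block, ld, lea, Plain]

theorem choose_plain : choose.Plain := by simp [choose, block, Plain]

theorem write_plain : write.Plain := by simp [write, block, st, lea, Plain]

theorem push_plain : push.Plain := by simp [push, block, ld, st, lea, Plain]

theorem descend_size : descend.size ≤ 100 := by
  simp [descend, test, block, ld, st, lea, size]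

theorem ascend_size : ascend.size ≤ 100 := by
  simp [ascend, block, ld, st, lea, size]

theorem readData_size : readData.size ≤ 100 := by simp [readData, block, ld, lea, size]

theorem choose_size : choose.size ≤ 100 := by simp [choose, block, size]

theorem write_size : write.size ≤ 100 := by simp [write, block, st, lea, size]

theorem push_size : push.size ≤ 100 := by simp [push, block, ld, st, lea, size]

theorem descend_spares : descend.Spares 10 := by
  simp [descend, test, block, ld, st, lea, Spares]

theorem ascend_spares : ascend.Spares 10 := by simp [ascend, block, ld, st, lea, Spares]

theorem readData_spares : readData.Spares 14 := by simp [readData, block, ld, lea, Spares]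

theorem choose_spares : choose.Spares 12 := by simp [choose, block, Spares]

theorem write_spares : write.Spares 29 := by simp [write, block, st, lea, Spares]

theorem push_spares : push.Spares 10 := by simp [push, block, ld, st, lea, Spares]

end Code

/-- Registers `1`, `8` and `9` hold the threshold and the constants `1` and `0`. -/
structure Consts (T : ℕ) (s : Store) : Prop where
  threshold : s.reg 1 = T
  one : s.reg 8 = 1
  zero : s.reg 9 = 0

open Code WordRAM.Cmd

variable {T M : ℕ}

theorem Consts.congr {s s' : Store} (h : Consts T s) (hk : ∀ r < 10, s'.reg r = s.reg r) :
    Consts T s' := by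
  obtain ⟨h1, h2, h3⟩ := h
  constructor <;> rw [hk _ (by norm_num)] <;> assumption

theorem one_mod (hM : 16 * M < 2 ^ w) (h : 0 < M) : 1 % 2 ^ w = 1 :=
  Nat.mod_eq_of_lt (by omega)

theorem cell_ne_of_ne {p q f g : ℕ} (hf : f < 16) (hg : g < 16) (h : p ≠ q) :
    cell p f ≠ cell q g := by
  unfold cell
  omega

theorem test_eval (hM : 16 * M < 2 ^ w) {s : Store} (hs : Consts T s) {p : ℕ}
    (hp : s.reg 10 = p) (hpM : p < M) :
    (test.eval w L s).reg 13 = (if s.mem (cell p 4) = 0 then 1 else 0) ∧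
      (test.eval w L s).mem = s.mem ∧ ∀ r < 13, (test.eval w L s).reg r = s.reg r := by
  have h1 := one_mod hM (by omega : 0 < M)
  have e9 := hs.zero
  refine ⟨?_, ?_, fun r hr => Spares.eval_reg hr (by simp [test, block, ld, lea, Spares]) s⟩
  all_goals simp [test, block, Cmd.eval, ld_eval hM, lea_eval hM, hp, hpM, e9, BinOp.eval, h1]

theorem descend_eval (hM : 16 * M < 2 ^ w) {s : Store} (hs : Consts T s) {p c b : ℕ}
    (hp : s.reg 10 = p) (hpM : p < M) (hc : s.mem (cell p 6) = c) (hcM : c < M)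
    (hb : s.mem (cell p 7) = b) (hcp : c ≠ p) (hbc : b ≠ cell c 4) :
    (descend.eval w L s).reg 10 = c ∧ (descend.eval w L s).reg 11 = s.reg 11 ∧
      (descend.eval w L s).reg 13 = (if s.mem (cell c 4) = 0 then 1 else 0) ∧
      ∀ x, (descend.eval w L s).mem x = if x = cell p 7 then cell c 8 else
        if x = cell p 9 then b else if x = b then c else
        if x = cell p 6 then s.mem (cell c 8) else s.mem x := by
  have h1 := one_mod hM (by omega : 0 < M)
  have hcw : c % 2 ^ w = c := Nat.mod_eq_of_lt (by omega)
  have e9 := hs.zero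
  have n2 : ∀ f g, f < 16 → g < 16 → cell c f ≠ cell p g := fun f g hf hg =>
    cell_ne_of_ne hf hg hcp
  simp [descend, test, block, Cmd.eval, ld_eval hM, st_eval hM, lea_eval hM, hp, hpM, hc, hcM,
      hcw, e9, BinOp.eval, h1, cell_inj, hb, n2, hbc.symm]

theorem ascend_eval (hM : 16 * M < 2 ^ w) {s : Store} (hs : Consts T s) {p : ℕ}
    (hp : s.reg 10 = p) (hpM : p < M) :
    (ascend.eval w L s).reg 11 = s.reg 11 ∧
    (s.mem (cell p 5) = 0 → (ascend.eval w L s).reg 10 = s.mem (cell p 0) ∧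
      (ascend.eval w L s).reg 12 = s.reg 12 ∧
      ∀ x, (ascend.eval w L s).mem x = if x = cell p 7 then s.mem (cell p 9) else s.mem x) ∧
    (s.mem (cell p 5) ≠ 0 → (ascend.eval w L s).reg 10 = 0 ∧
      (ascend.eval w L s).reg 12 = 0 ∧
      ∀ x, (ascend.eval w L s).mem x = if x = cell p 5 then s.mem (cell p 5) - 1 else
        if x = cell p 7 then s.mem (cell p 9) else s.mem x) := by
  have e8 := hs.one
  refine ⟨?_, fun h => ?_, fun h => ?_⟩
  · by_cases h : s.mem (cell p 5) = 0 <;>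
    simp [ascend, block, Cmd.eval, ld_eval hM, st_eval hM, lea_eval hM, hp, hpM, cell_inj, h]
  · simp [ascend, block, Cmd.eval, ld_eval hM, st_eval hM, lea_eval hM, hp, hpM, cell_inj, h]
  · simp [ascend, block, Cmd.eval, ld_eval hM, st_eval hM, lea_eval hM, hp, hpM, cell_inj, h,
      BinOp.eval, e8]

theorem readData_eval (hM : 16 * M < 2 ^ w) {s : Store} {p : ℕ}
    (hp : s.reg 10 = p) (hpM : p < M) :
    (readData.eval w L s).reg 14 = s.mem (cell p 4) ∧
    (readData.eval w L s).reg 15 = s.mem (cell p 1) ∧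
    (readData.eval w L s).reg 16 = s.mem (cell p 2) ∧
    (readData.eval w L s).reg 17 = s.mem (cell p 3) ∧
    (readData.eval w L s).reg 19 = L.degreeQuery (s.mem (cell p 1)) ∧
    (readData.eval w L s).mem = s.mem := by
  simp [readData, block, Cmd.eval, ld_eval hM, lea_eval hM, hp, hpM]

theorem choose_mem (s : Store) : (choose.eval w L s).mem = s.mem := by
  by_cases h1 : s.reg 17 = 0 <;> by_cases h2 : BinOp.eval w .eq (s.reg 14) (2 % 2 ^ w) = 0 <;>
  simp [choose, block, Cmd.eval, h1, h2]

theorem choose_reg14 (s : Store) : (choose.eval w L s).reg 14 = s.reg 14 := by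
  by_cases h1 : s.reg 17 = 0 <;> by_cases h2 : BinOp.eval w .eq (s.reg 14) (2 % 2 ^ w) = 0 <;>
  simp [choose, block, Cmd.eval, h1, h2]

theorem choose_batch {s : Store} (hs : Consts T s) (hw : 1 < w)
    {v x : ℕ} (hk : s.reg 17 ≠ 0) (hv : s.reg 15 = v) (hx : s.reg 20 = x)
    (hxw : x + 1 < 2 ^ w) :
    (choose.eval w L s).reg 22 = L.neighborQuery v (x + 1) ∧
    (choose.eval w L s).reg 23 = 2 ∧ (choose.eval w L s).reg 24 = 0 ∧
    (choose.eval w L s).reg 25 = 2 ∧ (choose.eval w L s).reg 26 = 0 ∧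
    (choose.eval w L s).reg 12 =
      (if L.degreeQuery (L.neighborQuery v (x + 1)) < T then 1 else 0) := by
  have hw2 : 2 ^ 2 ≤ 2 ^ w := Nat.pow_le_pow_right (by norm_num) hw
  have h1 : 1 % 2 ^ w = 1 := Nat.mod_eq_of_lt (by omega)
  have h2 : 2 % 2 ^ w = 2 := Nat.mod_eq_of_lt (by omega)
  have h3 : (x + 1) % 2 ^ w = x + 1 := Nat.mod_eq_of_lt hxw
  simp [choose, block, Cmd.eval, hk, BinOp.eval, hv, hx, hs.one, hs.threshold, h1, h2, h3]

theorem choose_vertex_batch {s : Store} (hs : Consts T s) (hw : 1 < w)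
    {v th d : ℕ} (hk : s.reg 17 = 0) (hv : s.reg 15 = v) (hvw : v < 2 ^ w) (hr : s.reg 14 = 2)
    (hth : s.reg 16 = th) (hd : s.reg 19 = d) (hthw : th < 2 ^ w) (hthd : th * (d / T) < 2 ^ w) :
    (choose.eval w L s).reg 22 = v ∧
    (choose.eval w L s).reg 23 = th ∧ (choose.eval w L s).reg 24 = 1 ∧
    (choose.eval w L s).reg 25 = th * (d / T) ∧ (choose.eval w L s).reg 26 = th * (d / T) - th ∧
    (choose.eval w L s).reg 12 = 0 := by
  have hw2 : 2 ^ 2 ≤ 2 ^ w := Nat.pow_le_pow_right (by norm_num) hw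
  have h1 : 1 % 2 ^ w = 1 := Nat.mod_eq_of_lt (by omega)
  have h2 : 2 % 2 ^ w = 2 := Nat.mod_eq_of_lt (by omega)
  simp [choose, block, Cmd.eval, hk, BinOp.eval, hv, hs.zero, hs.threshold, h1, h2, hr, hth, hd,
    Nat.mod_eq_of_lt hvw, Nat.mod_eq_of_lt hthw, Nat.mod_eq_of_lt hthd]

theorem choose_vertex_vertex {s : Store} (hs : Consts T s) (hw : 1 < w)
    {v th : ℕ} (hk : s.reg 17 = 0) (hv : s.reg 15 = v) (hvw : v < 2 ^ w) (hr : s.reg 14 ≠ 2)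
    (hth : s.reg 16 = th) (hthw : 2 * th < 2 ^ w) :
    (choose.eval w L s).reg 22 = v ∧
    (choose.eval w L s).reg 23 = 2 * th ∧ (choose.eval w L s).reg 24 = 0 ∧
    (choose.eval w L s).reg 25 = 2 ∧ (choose.eval w L s).reg 26 = 0 ∧
    (choose.eval w L s).reg 12 = 0 := by
  have hw2 : 2 ^ 2 ≤ 2 ^ w := Nat.pow_le_pow_right (by norm_num) hw
  have h1 : 1 % 2 ^ w = 1 := Nat.mod_eq_of_lt (by omega)
  have h2 : 2 % 2 ^ w = 2 := Nat.mod_eq_of_lt (by omega)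
  have h3 : (th + th) % 2 ^ w = 2 * th := by rw [← two_mul, Nat.mod_eq_of_lt hthw]
  simp [choose, block, Cmd.eval, hk, BinOp.eval, hv, hs.zero, h2, hr, hth,
    Nat.mod_eq_of_lt hvw, h3]

theorem write_eval (hM : 16 * M < 2 ^ w) {s : Store} {f : ℕ}
    (hf : s.reg 11 = f) (hfM : f < M) (x : ℕ) :
    (write.eval w L s).mem x = if x = cell f 7 then cell f 6 else
      if x = cell f 5 then s.reg 26 else if x = cell f 4 then s.reg 25 else
      if x = cell f 3 then s.reg 24 else if x = cell f 2 then s.reg 23 else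
      if x = cell f 1 then s.reg 22 else if x = cell f 0 then s.reg 10 else s.mem x := by
  simp [write, block, Cmd.eval, st_eval hM, lea_eval hM, hf, hfM]

theorem push_eval (hM : 16 * M < 2 ^ w) {s : Store} (hs : Consts T s) {p f b : ℕ}
    (hp : s.reg 10 = p) (hpM : p < M) (hf : s.reg 11 = f) (hfM : f < M)
    (hb : s.mem (cell p 7) = b) :
    (push.eval w L s).reg 10 = (if s.reg 12 = 0 then 0 else p) ∧
    (push.eval w L s).reg 11 = f + 1 ∧ (push.eval w L s).reg 12 = s.reg 12 ∧
      ∀ x, (push.eval w L s).mem x = if x = cell p 7 then cell f 8 else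
        if x = cell p 9 then b else if x = b then f else
        if x = cell p 4 then s.reg 14 - 1 else s.mem x := by
  have hfw : (f + 1) % 2 ^ w = f + 1 := Nat.mod_eq_of_lt (by omega)
  have e8 := hs.one
  by_cases hd : s.reg 12 = 0 <;>
  simp [push, block, Cmd.eval, ld_eval hM, st_eval hM, lea_eval hM, hp, hpM, hf, hfM,
      hfw, e8, BinOp.eval, cell_inj, hb, hd]

end Peeling

/-! ### Correctness of the code that serves a process -/

namespace IncidenceList

variable {n : ℕ} {G : SimpleGraph (Fin n)} (L : IncidenceList G)

theorem degreeQuery_succ (v : Fin n) : L.degreeQuery (v + 1) = (L.nbrs v).length := by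
  have : (1 : ℕ) ≤ v + 1 ∧ (v : ℕ) + 1 ≤ n := by have := v.2; omega
  rw [degreeQuery, dif_pos this]
  rfl

theorem neighborQuery_succ (v : Fin n) {x : ℕ} (hx : x < (L.nbrs v).length) :
    L.neighborQuery (v + 1) (x + 1) = ((L.nbrs v)[x]?.getD v : Fin n) + 1 := by
  have : ((1 : ℕ) ≤ v + 1 ∧ (v : ℕ) + 1 ≤ n) ∧ 1 ≤ x + 1 := by have := v.2; omega
  rw [neighborQuery, dif_pos this]
  have e : (L.nbrs v)[x]? = some (L.nbrs v)[x] := List.getElem?_eq_getElem hx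
  simp [e]

theorem length_le (v : Fin n) : (L.nbrs v).length ≤ n := by
  simpa using (L.nodup v).length_le_card

end IncidenceList

namespace WordRAM

theorem lt_of_uniformBelow {m x : ℕ} (hm : 0 < m) (h : uniformBelow m x ≠ 0) : x < m := by
  obtain ⟨m, rfl⟩ := Nat.exists_eq_add_of_le' hm
  rw [Peeling.uniformBelow_succ, PMF.map_apply_ne_zero] at h
  obtain ⟨i, -, rfl⟩ := h
  exact i.2

end WordRAM

namespace Peeling

open Peeler WordRAM

variable {n : ℕ} {G : SimpleGraph (Fin n)} {w : ℕ} {L : IncidenceList G}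

/-- The registers that are not changed while a process runs. -/
def Keep (s s' : Store) : Prop := ∀ r < 10, s'.reg r = s.reg r

/-- What the machine has found out when a process has received a unit of time: its parent is
informed if it has died, and otherwise the record is up to date. -/
def Outcome (par p : ℕ) (F : Set ℕ) (s : Store) : Option (Peeler n) → Prop
  | none => s.reg 10 = par ∧ s.reg 12 = 1
  | some y => s.reg 10 = 0 ∧ s.reg 12 = 0 ∧ Rep s.mem par p y F

open Code WordRAM.Cmd

variable {T M : ℕ} {K : List Cmd}

/-- One iteration of the loop `ascend` updates the parent `p` of a process that has been served. -/
theorem ascend_refines (hM : 16 * M < 2 ^ w) {s : Store} (hs : Consts T s) {par p : ℕ} {v : Fin n}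
    {b : Bool} {th rem sl : ℕ} (dr : List (Fin n)) {dn td : List (Peeler n)} {cs : List (Child n)}
    {F Fc F' : Set ℕ} {c : ℕ} {o : Option (Peeler n)}
    (hA : Appended s.mem par p v b th rem sl cs F c) (hp0 : p ≠ 0) (hpM : p < M)
    (hcs : (cs.map fun d => d.2.1) = td ++ dn) (ho : Outcome p c Fc s o)
    (hF : F ⊆ F') (hFc : Fc ⊆ F') (hpc : p ∉ Fc) (hdisj : ∀ d ∈ cs, Disjoint d.2.2 Fc) :
    Refines w L (.loop 10 ascend :: K) s (.loop 10 ascend :: K)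
      (PMF.pure (absorb v b th rem sl dr dn td o)) (fun _ => 101) fun o' s' =>
        Outcome par p F' s' o' ∧ Keep s s' ∧ s'.reg 11 = s.reg 11 ∧
          ∀ q ≠ p, ∀ g < 16, s'.mem (cell q g) = s.mem (cell q g) := by
  obtain ⟨hfields, htail, hchain, hlast, hchild, hsep⟩ := hA
  cases o with
  | some y =>
    obtain ⟨h10, h12, hy⟩ := ho
    refine .of_eq ⟨⟨h10, h12, ?_⟩, fun _ _ => rfl, rfl, fun _ _ _ _ => rfl⟩
    refine .mk par p v b th rem sl dr (dn ++ [y]) td F' (cs ++ [(c, y, Fc)]) hfields ?_ ?_ ?_ ?_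
    · rw [htail]
      simpa using hchain.append hlast
    · simp [hcs]
    · intro d hd
      rcases List.mem_append.1 hd with hd | hd
      · exact hchild d hd
      · rw [List.mem_singleton] at hd; subst hd; exact hy
    · refine ⟨hF hsep.mem, fun d hd => ?_, fun d hd => ?_, ?_⟩
      · rcases List.mem_append.1 hd with hd | hd
        · exact (hsep.subset d hd).trans hF
        · rw [List.mem_singleton] at hd; subst hd; exact hFc
      · rcases List.mem_append.1 hd with hd | hd
        · exact hsep.notMem d hd
        · rw [List.mem_singleton] at hd; subst hd; exact hpc
      · refine List.pairwise_append.2 ⟨hsep.disjoint, by simp, fun d hd e he => ?_⟩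
        rw [List.mem_singleton] at he; subst he; exact hdisj d hd
  | none =>
    obtain ⟨h10, h12⟩ := ho
    obtain ⟨e11, ezero, epos⟩ := ascend_eval (L := L) hM hs h10 hpM
    have hkeep : Keep s (ascend.eval w L s) := fun r hr => ascend_spares.eval_reg hr s
    refine Refines.loop_true (t := fun _ => 100) (by rw [h10]; exact hp0) ?_ (fun _ _ => le_rfl)
    refine Refines.plain ascend_plain ascend_size ?_
    by_cases hsl : sl = 0
    · obtain ⟨e10, e12, em⟩ := ezero (by rw [hfields.sl, hsl])
      simp only [absorb, if_pos hsl]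
      refine ⟨⟨by rw [e10, hfields.par], by rw [e12, h12]⟩, hkeep, e11, fun q hq g hg => ?_⟩
      rw [em, if_neg (cell_ne_of_ne hg (by norm_num) hq)]
    · obtain ⟨e10, e12, em⟩ := epos (by rw [hfields.sl]; exact hsl)
      have em' : ∀ q ≠ p, ∀ g < 16,
          (ascend.eval w L s).mem (cell q g) = s.mem (cell q g) := fun q hq g hg => by
        rw [em, if_neg (cell_ne_of_ne hg (by norm_num) hq),
          if_neg (cell_ne_of_ne hg (by norm_num) hq)]
      have em8 : ∀ q g, g < 16 → g ≠ 5 → g ≠ 7 →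
          (ascend.eval w L s).mem (cell q g) = s.mem (cell q g) := fun q g hg h5 h7 => by
        rw [em, if_neg fun h => h5 ((cell_inj hg (by norm_num)).1 h).2,
          if_neg fun h => h7 ((cell_inj hg (by norm_num)).1 h).2]
      simp only [absorb, if_neg hsl]
      refine ⟨⟨e10, e12, ?_⟩, hkeep, e11, em'⟩
      refine .mk par p v b th rem (sl - 1) dr dn td F' cs ?_ ?_ hcs (fun d hd => ?_)
        ⟨hF hsep.mem, fun d hd => (hsep.subset d hd).trans hF, hsep.notMem, hsep.disjoint⟩
      · obtain ⟨h1, h2, h3, h4, h5, h6⟩ := hfields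
        constructor
        all_goals try (rw [em8 _ _ (by norm_num) (by norm_num) (by norm_num)]; assumption)
        rw [em, if_pos rfl, h6]
      · have e7 : (ascend.eval w L s).mem (cell p 7) = s.mem (cell p 9) := by
          rw [em, if_neg fun h => absurd ((cell_inj (by norm_num) (by norm_num)).1 h).2
            (by norm_num), if_pos rfl]
        rw [e7]
        refine hchain.congr (hsep.nodup hchild) (fun _ _ => cell6_ne) fun x _ hx => ?_
        rcases hx with rfl | ⟨d, -, rfl⟩ <;> exact em8 _ _ (by norm_num) (by norm_num) (by norm_num)
      · refine (hchild d hd).congr fun q hq g hg _ => em' q (fun h => ?_) g hg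
        exact hsep.notMem d hd (h ▸ hq)

/-- The next child of a process, where `u` is the neighbour that has been drawn. -/
def newChild (N : Fin n → List (Fin n)) (T : ℕ) (b : Bool) (v : Fin n) (th rem : ℕ) (u : Fin n) :
    Option (Peeler n) :=
  if b then start N T u else some (if rem = 2 then mkBatch N T v th else mkVertex v (2 * th))

theorem give_eq_bind (N : Fin n → List (Fin n)) (T : ℕ) (v : Fin n) (b : Bool) {th rem sl : ℕ}
    (hr : rem ≠ 0) (dr : List (Fin n)) (dn td : List (Peeler n)) :
    give N T (node v b th rem sl dr dn td) = (uniformBelow (N v).length).bind fun x =>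
      PMF.pure (absorb v b th (rem - 1) sl (if b then (N v)[x]?.getD v :: dr else dr) dn td
        (newChild N T b v th rem ((N v)[x]?.getD v))) := by
  cases b
  · rw [give_vertex _ _ _ _ _ _ hr]
    simp [newChild]
  · rw [give_batch _ _ _ _ _ _ hr, pick, PMF.map_comp, ← PMF.bind_pure_comp]
    simp [newChild, Function.comp_def]

/-- The words are long enough for records with numbers below `M` and thresholds up to `H`. -/
structure Fits (w n M H : ℕ) : Prop where
  address : 16 * M < 2 ^ w
  vertex : n + 1 < 2 ^ w
  threshold : H * (n + 2) < 2 ^ w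
  one_lt : 1 < w

/-- What the registers hold when the data of the next child have been chosen. -/
def Chosen (s : Store) (o : Option (Peeler n)) : Prop :=
  (o = none ∧ s.reg 12 = 1) ∨ ∃ (v : Fin n) (b : Bool) (th rem sl : ℕ),
    o = some (node v b th rem sl [] [] []) ∧ s.reg 12 = 0 ∧ s.reg 22 = v + 1 ∧ s.reg 23 = th ∧
      s.reg 24 = (if b then 1 else 0) ∧ s.reg 25 = rem ∧ s.reg 26 = sl

theorem choose_eval {H : ℕ} (hfit : Fits w n M H) {s : Store} (hs : Consts T s)
    {v : Fin n} {b : Bool} {th rem x : ℕ} (hth : th ≤ H)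
    (h14 : s.reg 14 = rem) (h15 : s.reg 15 = v + 1) (h16 : s.reg 16 = th)
    (h17 : s.reg 17 = if b then 1 else 0) (h19 : s.reg 19 = (L.nbrs v).length)
    (h20 : s.reg 20 = x) (hx : b → x < (L.nbrs v).length) :
    Chosen (choose.eval w L s) (newChild L.nbrs T b v th rem ((L.nbrs v)[x]?.getD v)) := by
  have hd := L.length_le v
  have hv := v.2
  have hvw := hfit.vertex
  have hHw := hfit.threshold
  cases b
  · by_cases hr : rem = 2
    · have h1 : th * ((L.nbrs v).length / T) ≤ H * (n + 2) :=
        Nat.mul_le_mul hth ((Nat.div_le_self _ _).trans (by omega))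
      have h2 : H * 1 ≤ H * (n + 2) := Nat.mul_le_mul_left _ (by omega)
      obtain ⟨e1, e2, e3, e4, e5, e6⟩ := choose_vertex_batch (L := L) hs hfit.one_lt
        (by simpa using h17) h15 (by omega) (h14.trans hr) h16 h19 (by omega) (by omega)
      exact Or.inr ⟨v, true, th, _, _, by simp [newChild, hr, mkBatch], e6, e1, e2,
        by simpa using e3, e4, e5⟩
    · have h2 : H * 2 ≤ H * (n + 2) := Nat.mul_le_mul_left _ (by omega)
      obtain ⟨e1, e2, e3, e4, e5, e6⟩ := choose_vertex_vertex (L := L) hs hfit.one_lt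
        (by simpa using h17) h15 (by omega) (by rw [h14]; exact hr) h16 (by omega)
      exact Or.inr ⟨v, false, 2 * th, _, _, by simp [newChild, hr, mkVertex], e6, e1, e2,
        by simpa using e3, e4, e5⟩
  · have hx := hx rfl
    obtain ⟨e1, e2, e3, e4, e5, e6⟩ := choose_batch (L := L) hs hfit.one_lt (by simp [h17])
      h15 h20 (by omega)
    rw [L.neighborQuery_succ v hx] at e1 e6
    rw [L.degreeQuery_succ] at e6
    simp only [newChild, if_true, start]
    set u : Fin n := (L.nbrs v)[x]?.getD v
    split_ifs with hu
    · rw [if_neg (by omega)] at e6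
      exact Or.inr ⟨u, false, 2, 2, 0, rfl, e6, e1, e2, by simpa using e3, e4, e5⟩
    · rw [if_pos (by omega)] at e6
      exact Or.inl ⟨rfl, e6⟩

theorem Chosen.congr {s s' : Store} {o : Option (Peeler n)} (h : Chosen s o)
    (hr : ∀ r < 29, s'.reg r = s.reg r) : Chosen s' o := by
  unfold Chosen at h ⊢
  rw [hr _ (by norm_num), hr _ (by norm_num), hr _ (by norm_num), hr _ (by norm_num),
    hr _ (by norm_num), hr _ (by norm_num)]
  exact h

/-- A new child has been appended to the queue of its parent. -/
def Created (N : Fin n → List (Fin n)) (T par p : ℕ) (v : Fin n) (b : Bool) (th rem sl : ℕ)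
    (F : Set ℕ) (q : List (Peeler n)) (f : ℕ) (s : Store) (x : ℕ) (s' : Store) : Prop :=
  (∃ cs : List (Child n), (cs.map fun c => c.2.1) = q ∧
    Appended s'.mem par p v b th (rem - 1) sl cs F f) ∧
  Outcome p f {f} s' (newChild N T b v th rem ((N v)[x]?.getD v)) ∧ Keep s s' ∧
  s'.reg 11 = f + 1 ∧ ∀ r < f, r ∉ F → ∀ g < 16, s'.mem (cell r g) = s.mem (cell r g)

theorem create_refines {H : ℕ} (hfit : Fits w n M H) (hT : 1 ≤ T) {s : Store} (hs : Consts T s)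
    {par p f : ℕ} {v : Fin n} {b : Bool} {th rem sl : ℕ} {dr : List (Fin n)}
    {dn td : List (Peeler n)} {F : Set ℕ}
    (hx : Rep s.mem par p (node v b th rem sl dr dn td) F) (hth : th ≤ H)
    (hdeg : T ≤ (L.nbrs v).length) (hF : ∀ q ∈ F, 0 < q ∧ q < f) (hfM : f < M)
    (h10 : s.reg 10 = p) (h11 : s.reg 11 = f) :
    Refines w L (create :: K) s K (uniformBelow (L.nbrs v).length) (fun _ => 500)
      (Created L.nbrs T par p v b th rem sl F (td ++ dn) f s) := by
  have hM := hfit.address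
  cases hx with
  | mk _ _ _ _ _ _ _ _ _ _ _ cs hfields hchain hcs hchild hsep =>
  have hpf := hF p hsep.mem
  obtain ⟨o14, o15, o16, o17, o19, omem⟩ := readData_eval (L := L) hM h10 (by omega)
  rw [hfields.vertex, L.degreeQuery_succ] at o19
  rw [hfields.vertex] at o15
  rw [hfields.th] at o16
  rw [hfields.rem] at o14
  rw [hfields.kind] at o17
  have oreg : ∀ r < 14, (readData.eval w L s).reg r = s.reg r := fun r hr =>
    readData_spares.eval_reg hr s
  set s₁ := readData.eval w L s with hs₁
  have main : ∀ x, uniformBelow (L.nbrs v).length x ≠ 0 →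
      Created L.nbrs T par p v b th rem sl F (td ++ dn) f s x
        (push.eval w L (write.eval w L (choose.eval w L (s₁.setReg 20 x)))) := by
    intro x hx
    have hxlt := lt_of_uniformBelow (by omega) hx
    set s₂ := s₁.setReg 20 x with hs₂
    have e2 : ∀ r < 14, s₂.reg r = s.reg r := fun r hr => by
      rw [hs₂, Store.setReg_reg, if_neg (by omega), oreg r hr]
    have c2 : Consts T s₂ := hs.congr fun r hr => e2 r (by omega)
    have hch := choose_eval (L := L) hfit c2 (v := v) (b := b) (th := th) (rem := rem) (x := x) hth
      (by simp [hs₂, o14]) (by simp [hs₂, o15]) (by simp [hs₂, o16]) (by simp [hs₂, o17])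
      (by simp [hs₂, o19]) (by simp [hs₂]) (fun _ => hxlt)
    have e3 : ∀ r < 12, (choose.eval w L s₂).reg r = s.reg r := fun r hr => by
      rw [choose_spares.eval_reg hr, e2 r (by omega)]
    have e3m : (choose.eval w L s₂).mem = s.mem := by
      rw [choose_mem, hs₂, Store.setReg_mem, omem]
    set s₃ := choose.eval w L s₂ with hs₃
    have e4r : ∀ r < 29, (write.eval w L s₃).reg r = s₃.reg r := fun r hr =>
      write_spares.eval_reg hr s₃
    have e4m := write_eval (L := L) hM (s := s₃) (f := f) (by rw [e3 _ (by norm_num), h11]) hfM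
    rw [e3m, e3 10 (by norm_num), h10] at e4m
    have e4 : ∀ r < 12, (write.eval w L s₃).reg r = s.reg r := fun r hr => by
      rw [e4r r (by omega), e3 r hr]
    have c4 : Consts T (write.eval w L s₃) := hs.congr fun r hr => e4 r (by omega)
    have hch4 := hch.congr e4r
    have e414 : (write.eval w L s₃).reg 14 = rem := by
      rw [e4r _ (by norm_num), hs₃, choose_reg14]
      simp [hs₂, o14]
    set s₄ := write.eval w L s₃ with hs₄
    have e4f : ∀ q ≠ f, ∀ g < 16, s₄.mem (cell q g) = s.mem (cell q g) := by
      intro q hq g hg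
      have : ∀ g' < 16, cell q g ≠ cell f g' := fun g' hg' => cell_ne_of_ne hg hg' hq
      rw [e4m]
      simp [this]
    set t := s.mem (cell p 7) with ht
    obtain ⟨e510, e511, e512, e5m⟩ := push_eval (L := L) hM c4 (p := p) (f := f) (b := t)
      (by rw [e4 _ (by norm_num), h10]) (by omega) (by rw [e4 _ (by norm_num), h11]) hfM
      (e4f p (by omega) 7 (by norm_num))
    have e5 : Keep s (push.eval w L s₄) := fun r hr => by
      rw [push_spares.eval_reg hr, e4 r (by omega)]
    set s₅ := push.eval w L s₄ with hs₅
    have hcF : ∀ c ∈ cs, c.1 ∈ F := fun c hc => hsep.subset c hc (hchild c hc).mem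
    have htz : t = cell p 6 ∨ ∃ c ∈ cs, t = cell c.1 8 := by
      by_cases hne : cs = []
      · subst hne
        exact Or.inl hchain.symm
      · obtain ⟨c, hc, htc⟩ := hchain.end_eq (by simpa using hne)
        obtain ⟨d, hd, rfl⟩ := List.mem_map.1 hc
        exact Or.inr ⟨d, hd, htc⟩
    have htF : ∀ q g, g < 16 → q ∉ F → cell q g ≠ t := by
      intro q g hg hq h
      rcases htz with h' | ⟨c, hc, h'⟩ <;> rw [h'] at h
      · exact hq (((cell_inj hg (by norm_num)).1 h).1 ▸ hsep.mem)
      · exact hq (((cell_inj hg (by norm_num)).1 h).1 ▸ hcF c hc)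
    have htp : ∀ g < 16, g ≠ 6 → g ≠ 8 → ∀ q, cell q g ≠ t := by
      intro g hg h6 h8 q h
      rcases htz with h' | ⟨c, hc, h'⟩ <;> rw [h'] at h
      · exact h6 ((cell_inj hg (by norm_num)).1 h).2
      · exact h8 ((cell_inj hg (by norm_num)).1 h).2
    have e5f : ∀ q ≠ f, ∀ g < 16, cell q g ≠ t → (q ≠ p ∨ g ≠ 4 ∧ g ≠ 7 ∧ g ≠ 9) →
        s₅.mem (cell q g) = s.mem (cell q g) := by
      intro q hq g hg hqt hqp
      have h1 : ∀ g', g' = 4 ∨ g' = 7 ∨ g' = 9 → cell q g ≠ cell p g' := by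
        intro g' hg' h
        have := (cell_inj hg (by omega)).1 h
        omega
      rw [e5m, if_neg (h1 7 (by simp)), if_neg (h1 9 (by simp)), if_neg hqt,
        if_neg (h1 4 (by simp)), e4f q hq g hg]
    have e59 : s₅.mem (cell p 9) = t := by
      rw [e5m, if_neg (by simp [cell_inj]), if_pos rfl]
    have hpf' : p ≠ f := by omega
    refine ⟨⟨cs, hcs, ⟨?_, ?_, ?_, ?_, ?_, hsep⟩⟩, ?_, e5, e511, fun q hqf hq g hg => ?_⟩
    · obtain ⟨h1, h2, h3, h4, h5, h6⟩ := hfields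
      constructor
      all_goals try (rw [e5f p hpf' _ (by norm_num) (htp _ (by norm_num) (by norm_num)
        (by norm_num) _) (by norm_num)]; assumption)
      rw [e5m, if_neg (by simp [cell_inj]), if_neg (by simp [cell_inj]),
        if_neg (htp 4 (by norm_num) (by norm_num) (by norm_num) _), if_pos rfl, e414]
    · rw [e5m, if_pos rfl]
    · rw [e59]
      refine hchain.congr (hsep.nodup hchild) (fun _ _ => cell6_ne) fun y hy hy' => ?_
      rcases hy' with rfl | ⟨c, hc, rfl⟩
      · exact e5f p hpf' 6 (by norm_num) hy (by norm_num)
      · obtain ⟨d, hd, rfl⟩ := List.mem_map.1 hc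
        have := hF d.1 (hcF d hd)
        exact e5f d.1 (by omega) 8 (by norm_num) hy (by norm_num)
    · rw [e59, e5m, if_neg (htp 7 (by norm_num) (by norm_num) (by norm_num) _).symm,
        if_neg (htp 9 (by norm_num) (by norm_num) (by norm_num) _).symm, if_pos rfl]
    · intro d hd
      refine (hchild d hd).congr fun q hq g hg hqg => ?_
      have hqF := hsep.subset d hd hq
      have := hF q hqF
      have hqp : q ≠ p := fun h => hsep.notMem d hd (h ▸ hq)
      refine e5f q (by omega) g hg (fun h => ?_) (Or.inl hqp)
      rcases htz with h' | ⟨c, hc, h'⟩ <;> rw [h'] at h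
      · exact hqp ((cell_inj hg (by norm_num)).1 h).1
      · obtain ⟨h1, h2⟩ := (cell_inj hg (by norm_num)).1 h
        have hcd := hsep.eq_of_mem hc hd (hchild c hc).mem (h1 ▸ hq)
        subst hcd
        omega
    · have e5c : ∀ g < 16, s₅.mem (cell f g) = s₄.mem (cell f g) := by
        intro g hg
        have h1 : ∀ g' < 16, cell f g ≠ cell p g' := fun g' hg' => cell_ne_of_ne hg hg' hpf'.symm
        rw [e5m, if_neg (h1 7 (by norm_num)), if_neg (h1 9 (by norm_num)),
          if_neg (htF f g hg fun h => absurd (hF f h).2 (lt_irrefl _)),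
          if_neg (h1 4 (by norm_num))]
      rcases hch4 with ⟨ho, h12⟩ | ⟨v', b', th', rem', sl', ho, h12, h22, h23, h24, h25, h26⟩
      · rw [ho]
        exact ⟨by rw [e510, h12]; simp, by rw [e512, h12]⟩
      · rw [ho]
        refine ⟨by rw [e510, h12]; simp, by rw [e512, h12], ?_⟩
        refine .mk p f v' b' th' rem' sl' [] [] [] {f} [] ?_ ?_ rfl (by simp)
          ⟨rfl, by simp, by simp, by simp⟩
        · rw [e4r _ (by norm_num)] at h22 h23 h24 h25 h26
          constructor <;> rw [e5c _ (by norm_num), e4m] <;> simp [cell_inj, h22, h23, h24, h25, h26]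
        · rw [e5c _ (by norm_num), e4m, if_pos rfl]
          rfl
    · refine e5f q (by omega) g hg (htF q g hg hq) (Or.inl fun h => hq (h ▸ hsep.mem))
  have h1 : Refines w L (.rand 20 19 :: .seq choose (.seq write push) :: K) s₁
      (.seq choose (.seq write push) :: K) (uniformBelow (L.nbrs v).length) (fun _ => 1)
      (fun x s' => s' = s₁.setReg 20 x) := by
    have := Refines.rand (w := w) (L := L) (K := .seq choose (.seq write push) :: K) (s := s₁)
      (r := 20) (a := 19) (t := fun _ => 1) (R := fun x s' => s' = s₁.setReg 20 x)
      (fun _ _ => le_rfl) (fun _ _ => rfl)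
    rwa [o19] at this
  refine Refines.seq (t := fun _ => 405) (Refines.plain_cons readData_plain (t := fun _ => 305) ?_
    fun _ _ => ?_) fun _ _ => ?_
  · refine Refines.seq (t := fun _ => 304) ?_ fun _ _ => le_rfl
    rw [← PMF.bind_pure (uniformBelow (L.nbrs v).length)]
    refine h1.trans (t₂ := fun _ _ => 303) (fun x hx s' hs' => ?_) fun _ _ _ _ => by norm_num
    subst hs'
    refine Refines.seq (t := fun _ => 302) ?_ fun _ _ => le_rfl
    refine Refines.plain_cons choose_plain (t := fun _ => 202) ?_ fun _ _ => ?_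
    · refine Refines.seq (t := fun _ => 201) ?_ fun _ _ => le_rfl
      refine Refines.plain_cons write_plain (t := fun _ => 100) ?_ fun _ _ => ?_
      · exact Refines.plain push_plain push_size (main x hx)
      · have := write_size; omega
    · have := choose_size; omega
  · exact Nat.add_le_add_right readData_size 305
  · norm_num

theorem log_succ_le {m k : ℕ} (hm : 1 ≤ m) (h : 2 * m + 1 ≤ k) :
    Nat.log 2 m + 1 ≤ Nat.log 2 k := by
  rw [← Nat.log_mul_base (by norm_num) (by omega)]
  exact Nat.log_mono_right (by omega)

/-- The machine gives a unit of time to the process in the record `p`: it descends to the process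
that creates a child, and reports back to the parents of dead processes. By the invariant
`Balanced`, the depth is logarithmic. -/
theorem give_refines {H : ℕ} (hfit : Fits w n M H) (hT : 1 ≤ T) (k : ℕ) :
    ∀ {x : Peeler n} {par p f : ℕ} {F : Set ℕ} {s : Store}, Balanced L.nbrs T x k →
      x.th * k ≤ H → Rep s.mem par p x F → (∀ q ∈ F, 0 < q ∧ q < f) → f < M → Consts T s →
      s.reg 10 = p → s.reg 11 = f → s.reg 13 = (if s.mem (cell p 4) = 0 then 1 else 0) →
      Refines w L (.loop 13 descend :: create :: .loop 10 ascend :: K) s (.loop 10 ascend :: K)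
        (give L.nbrs T x) (fun _ => 700 * (Nat.log 2 k + 1)) fun o s' =>
          Outcome par p (insert f F) s' o ∧ Keep s s' ∧ s'.reg 11 = f + 1 ∧
            ∀ r < f, r ∉ F → ∀ g < 16, s'.mem (cell r g) = s.mem (cell r g) := by
  induction k using Nat.strong_induction_on with
  | _ k ih =>
  intro x par p f F s hbal hH hrep hF hfM hs h10 h11 h13
  have hM := hfit.address
  obtain ⟨v, b, th, rem, sl, dr, dn, td⟩ := x
  have hk := hbal.pos
  have hpf := hF p hrep.mem
  have hthH : th ≤ H := (Nat.le_mul_of_pos_right th hk).trans hH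
  by_cases hr : rem = 0
  · subst hr
    have hrep' := hrep
    cases hrep' with
    | mk _ _ _ _ _ _ _ _ _ _ _ cs hfields hchain hcs hchild hsep =>
    obtain ⟨y, dn', td', m, hq, hne, hgive, -, hy, hyth, hmk⟩ := hbal.serve
    have hm := hy.pos
    rw [hq] at hcs
    obtain ⟨⟨c, y', Fc⟩, cs', rfl, hy', hcs'⟩ := List.map_eq_cons_iff.1 hcs
    simp only at hy'
    subst hy'
    have hcs0 : cs' ≠ [] := by
      rintro rfl
      exact hne hcs'.symm
    have hc := hchild (c, y', Fc) (by simp)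
    have hcFc : c ∈ Fc := hc.mem
    have hFcF : Fc ⊆ F := hsep.subset (c, y', Fc) (by simp)
    have hpFc : p ∉ Fc := hsep.notMem (c, y', Fc) (by simp)
    have hcp : c ≠ p := fun h => hpFc (h ▸ hcFc)
    have hcf := hF c (hFcF hcFc)
    obtain ⟨hdisj, hdisj'⟩ := List.pairwise_cons.1 hsep.disjoint
    have hsep' : Separate p cs' F := ⟨hsep.mem, fun d hd => hsep.subset d (by simp [hd]),
      fun d hd => hsep.notMem d (by simp [hd]), hdisj'⟩
    have hchild' : ∀ d ∈ cs', Rep s.mem p d.1 d.2.1 d.2.2 := fun d hd => hchild d (by simp [hd])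
    have hcd : ∀ d ∈ cs', d.1 ≠ c := fun d hd h =>
      Set.disjoint_left.1 (hdisj d hd) hcFc (h ▸ (hchild' d hd).mem)
    obtain ⟨hhead, htail⟩ := hchain
    change Chain s.mem (cell c 8) (cs'.map fun c => c.1) _ at htail
    change s.mem (cell p 6) = c at hhead
    obtain ⟨e, he, hbe⟩ := htail.end_eq (by simpa using hcs0)
    obtain ⟨d, hd, rfl⟩ := List.mem_map.1 he
    set t := s.mem (cell p 7) with ht
    have htf : ∀ q g, g < 16 → g ≠ 8 → cell q g ≠ t := fun q g hg hg8 h =>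
      hg8 ((cell_inj hg (by norm_num)).1 (h.trans hbe)).2
    have htd : ∀ q g, g < 16 → q ≠ d.1 → cell q g ≠ t := fun q g hg hq h =>
      hq ((cell_inj hg (by norm_num)).1 (h.trans hbe)).1
    obtain ⟨e10, e11, e13, em⟩ := descend_eval (L := L) hM hs h10 (by omega) hhead (by omega)
      ht.symm hcp (htf c 4 (by norm_num) (by norm_num)).symm
    have ekeep : Keep s (descend.eval w L s) := fun r hr => descend_spares.eval_reg hr s
    set s₁ := descend.eval w L s with hs₁
    -- after the descent, only a few cells have changed
    have em' : ∀ q g, g < 16 → cell q g ≠ t → (q ≠ p ∨ g ≠ 6 ∧ g ≠ 7 ∧ g ≠ 9) →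
        s₁.mem (cell q g) = s.mem (cell q g) := by
      intro q g hg hqt hqp
      have h1 : ∀ g', g' = 6 ∨ g' = 7 ∨ g' = 9 → cell q g ≠ cell p g' := by
        intro g' hg' h
        have := (cell_inj hg (by omega)).1 h
        omega
      rw [em, if_neg (h1 7 (by simp)), if_neg (h1 9 (by simp)), if_neg hqt,
        if_neg (h1 6 (by simp))]
    have emF : ∀ q, q ∉ F → ∀ g < 16, s₁.mem (cell q g) = s.mem (cell q g) := by
      intro q hq g hg
      refine em' q g hg (htd q g hg fun h => hq ?_) (Or.inl fun h => hq (h ▸ hsep.mem))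
      rw [h]
      exact hsep'.subset d hd (hchild' d hd).mem
    have hcrep : Rep s₁.mem p c y' Fc := by
      refine hc.congr fun q hq g hg _ => em' q g hg (htd q g hg fun h => ?_)
        (Or.inl fun h => hpFc (h ▸ hq))
      exact Set.disjoint_left.1 (hdisj d hd) hq (h ▸ (hchild' d hd).mem)
    have hA : Appended s₁.mem par p v b th 0 sl cs' F c := by
      have e9 : s₁.mem (cell p 9) = t := by
        rw [em, if_neg (by simp [cell_inj]), if_pos rfl]
      refine ⟨?_, by rw [em, if_pos rfl], ?_, ?_, fun d' hd' => ?_, hsep'⟩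
      · obtain ⟨h1, h2, h3, h4, h5, h6⟩ := hfields
        constructor <;> (rw [em' p _ (by norm_num) (htf p _ (by norm_num) (by norm_num))
          (by norm_num)]; assumption)
      · rw [e9]
        have e6 : s₁.mem (cell p 6) = s.mem (cell c 8) := by
          rw [em, if_neg (by simp [cell_inj]), if_neg (by simp [cell_inj]),
            if_neg (htf p 6 (by norm_num) (by norm_num)), if_pos rfl]
        -- the list now starts at `p` instead of `c`
        have h8 : ∀ q, cell q 8 ≠ t → s₁.mem (cell q 8) = s.mem (cell q 8) := fun q hq =>
          em' q 8 (by norm_num) hq (by norm_num)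
        have hnd := hsep'.nodup hchild'
        generalize hps : (cs'.map fun c => c.1) = ps at htail hnd
        have hps0 : ps ≠ [] := by rw [← hps]; simpa using hcs0
        rcases ps with _ | ⟨a, ps⟩
        · exact (hps0 rfl).elim
        · refine ⟨by rw [e6, htail.1], htail.2.congr (List.nodup_cons.1 hnd).2
            (fun z hz hza => ?_) fun z hz hz' => ?_⟩
          · have := ((cell_inj (by norm_num) (by norm_num)).1 hza).1
            exact (List.nodup_cons.1 hnd).1 (this ▸ hz)
          · rcases hz' with rfl | ⟨z', -, rfl⟩ <;> exact h8 _ hz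
      · rw [e9, em, if_neg (htf p 7 (by norm_num) (by norm_num)).symm,
          if_neg (htf p 9 (by norm_num) (by norm_num)).symm, if_pos rfl]
      · have hd'p : ∀ q ∈ d'.2.2, q ≠ p := fun q hq h => hsep'.notMem d' hd' (h ▸ hq)
        refine (hchild' d' hd').congr fun q hq g hg hqg => ?_
        refine em' q g hg (fun h => ?_) (Or.inl (hd'p q hq))
        obtain ⟨h1, h2⟩ := (cell_inj hg (by norm_num)).1 (h.trans hbe)
        have := hsep'.eq_of_mem hd' hd hq (h1 ▸ (hchild' d hd).mem)
        subst this
        omega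
    have hyH : y'.th * m ≤ H := by
      refine le_trans ?_ hH
      calc y'.th * m ≤ 2 * th * m := Nat.mul_le_mul_right _ hyth
        _ = th * (2 * m) := by ring
        _ ≤ th * k := Nat.mul_le_mul_left _ (by omega)
    have hrec := ih m (by omega) (x := y') (par := p) (p := c) (f := f) (F := Fc) (s := s₁)
      hy hyH hcrep (fun q hq => hF q (hFcF hq)) hfM (hs.congr ekeep) e10 (by rw [e11, h11])
      (by rw [e13, em' c 4 (by norm_num) (htf c 4 (by norm_num) (by norm_num)) (Or.inl hcp)])
    rw [hgive, ← PMF.bind_pure_comp]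
    have hlog := log_succ_le hm hmk
    refine Refines.loop_true (t := fun _ => 700 * (Nat.log 2 m + 1) + 201)
      (by rw [h13, hfields.rem]; simp) ?_ (fun _ _ => by omega)
    refine Refines.plain_cons descend_plain (t := fun _ => 700 * (Nat.log 2 m + 1) + 101) ?_
      fun _ _ => by have := descend_size; omega
    refine hrec.trans (t₂ := fun _ _ => 101) (fun o _ s₂ hs₂ => ?_) fun _ _ _ _ => le_rfl
    obtain ⟨ho, hk2, h112, hm2⟩ := hs₂
    have hAp : Appended s₂.mem par p v b th 0 sl cs' F c := by
      obtain ⟨h1, h2, h3, h4, h5, h6⟩ := hA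
      have ep : ∀ g < 16, s₂.mem (cell p g) = s₁.mem (cell p g) := hm2 p hpf.2 hpFc
      have ed : ∀ d' ∈ cs', ∀ q ∈ d'.2.2, ∀ g < 16, s₂.mem (cell q g) = s₁.mem (cell q g) :=
        fun d' hd' q hq => hm2 q (hF q (hsep'.subset d' hd' hq)).2
          fun h => Set.disjoint_left.1 (hdisj d' hd') h hq
      refine ⟨h1.congr fun g hg => ep g (by omega), by rw [ep 7 (by norm_num), h2], ?_, ?_,
        fun d' hd' => (h5 d' hd').congr fun q hq g hg _ => ed d' hd' q hq g hg, h6⟩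
      · rw [ep 9 (by norm_num)]
        refine h3.congr (hsep'.nodup hchild') (fun _ _ => cell6_ne) fun z _ hz => ?_
        rcases hz with rfl | ⟨z', hz', rfl⟩
        · exact ep 6 (by norm_num)
        · obtain ⟨d', hd', rfl⟩ := List.mem_map.1 hz'
          exact ed d' hd' _ (hchild' d' hd').mem 8 (by norm_num)
      · rw [ep 9 (by norm_num)]
        have e9 : s₁.mem (cell p 9) = cell d.1 8 := by
          rw [em, if_neg (by simp [cell_inj]), if_pos rfl, hbe]
        rw [e9] at h4 ⊢
        rw [ed d hd _ (hchild' d hd).mem 8 (by norm_num), h4]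
    have hasc := ascend_refines (L := L) (K := K) hM (hs.congr fun r hr => by
        rw [hk2 r hr, ekeep r hr]) dr (dn := dn') (td := td') hAp (by omega) (by omega) hcs' ho
      (F' := insert f F) (Set.subset_insert _ _) (Set.insert_subset_insert hFcF)
      (fun h => by
        rcases h with h | h
        · omega
        · exact hpFc h)
      (fun d' hd' => Set.disjoint_left.2 fun q hq h => by
        rcases h with h | h
        · have := hF q (hsep'.subset d' hd' hq); omega
        · exact Set.disjoint_left.1 (hdisj d' hd') h hq)
    refine hasc.mono (fun _ _ => le_rfl) fun o' _ s₃ hs₃ => ?_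
    obtain ⟨ho', hk3, h113, hm3⟩ := hs₃
    refine ⟨ho', fun r hr => by rw [hk3 r hr, hk2 r hr, ekeep r hr], by rw [h113, h112],
      fun r hrf hrF g hg => ?_⟩
    rw [hm3 r (fun h => hrF (h ▸ hsep.mem)) g hg, hm2 r hrf (fun h => hrF (hFcF h)) g hg,
      emF r hrF g hg]
  · have hrem : s.mem (cell p 4) ≠ 0 := by
      cases hrep with
      | mk _ _ _ _ _ _ _ _ _ _ _ cs hfields => rw [hfields.rem]; exact hr
    rw [give_eq_bind _ _ _ _ hr]
    refine Refines.loop_false (t := fun _ => 601) (by rw [h13, if_neg hrem]) ?_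
      (fun _ _ => by omega)
    refine (create_refines hfit hT hs hrep hthH hbal.le_length hF hfM h10 h11).trans
      (t₂ := fun _ _ => 101) (fun x _ s₂ hs₂ => ?_) fun _ _ _ _ => le_rfl
    obtain ⟨⟨cs, hcs, hA⟩, ho, hk2, h112, hm2⟩ := hs₂
    have hsep := hA.sep
    have hasc := ascend_refines (L := L) (K := K) hM (hs.congr hk2)
      (if b then (L.nbrs v)[x]?.getD v :: dr else dr) hA (by omega) (by omega) hcs ho
      (F' := insert f F) (Set.subset_insert _ _) (by simp)
      (fun h => by rw [Set.mem_singleton_iff] at h; omega)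
      (fun d' hd' => Set.disjoint_left.2 fun q hq h => by
        have := hF q (hsep.subset d' hd' hq)
        rw [Set.mem_singleton_iff] at h
        omega)
    refine hasc.mono (fun _ _ => le_rfl) fun o' _ s₃ hs₃ => ?_
    obtain ⟨ho', hk3, h113, hm3⟩ := hs₃
    refine ⟨ho', fun r hr => by rw [hk3 r hr, hk2 r hr], by rw [h113, h112],
      fun r hrf hrF g hg => ?_⟩
    rw [hm3 r (fun h => hrF (h ▸ hsep.mem)) g hg, hm2 r hrf hrF g hg]

end Peeling

/-! ### The tester on the machine -/

namespace Peeling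

open Peeler WordRAM

variable {n : ℕ} {G : SimpleGraph (Fin n)} {w : ℕ} {L : IncidenceList G}

namespace Code

open WordRAM.Cmd

/-- Go to the root of the tree of processes. -/
def enter : Cmd := .seq (.const 10 1) test

/-- Count a unit of time, and stop if the process has died. -/
def count : Cmd :=
  block [.bin .sub 6 6 8, .bin .add 7 7 8, .ite 12 (.const 6 0) (.const 28 0)]

/-- Give a unit of time to the tree of processes. -/
def unit : Cmd :=
  .seq (.seq (.seq (.seq enter (.loop 13 descend)) create) (.loop 10 ascend)) count

/-- Compute the number of a vertex from the random index in register 20, and compare its degree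
with the threshold. -/
def inspect : Cmd :=
  block [.bin .add 20 20 8, .degree 21 20, .bin .lt 22 21 1, .const 7 0]

/-- Create the process of the vertex in register 20, and prepare for serving it. -/
def plant : Cmd :=
  .seq (block [.const 10 0, .const 11 1, .bin .add 22 20 9, .const 23 2, .const 24 0, .const 25 2,
    .const 26 0, write]) (block [.const 11 2, .bin .add 6 3 9])

/-- Set register 13 to zero if there are no vertices or no units of time left. -/
def check : Cmd := .ite 4 (.bin .add 13 5 9) (.const 13 0)

/-- Account for the time that the process of a vertex has used. -/
def settle : Cmd := block [.bin .sub 5 5 7, .bin .sub 4 4 8, check]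

/-- Run the process of a random vertex. -/
def root : Cmd :=
  .seq (.rand 20 0) (.seq inspect (.seq (.ite 22 (.const 28 0) (.seq plant (.loop 6 unit))) settle))

theorem enter_plain : enter.Plain := by simp [enter, test, block, ld, lea, Plain]

theorem count_plain : count.Plain := by simp [count, block, Plain]

theorem inspect_plain : inspect.Plain := by simp [inspect, block, Plain]

theorem plant_plain : plant.Plain := by simp [plant, write, block, st, lea, Plain]

theorem settle_plain : settle.Plain := by simp [settle, check, block, Plain]

theorem enter_size : enter.size ≤ 100 := by simp [enter, test, block, ld, lea, size]

theorem count_size : count.size ≤ 100 := by simp [count, block, size]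

theorem inspect_size : inspect.size ≤ 100 := by simp [inspect, block, size]

theorem plant_size : plant.size ≤ 200 := by simp [plant, write, block, st, lea, size]

theorem settle_size : settle.size ≤ 100 := by simp [settle, check, block, size]

end Code

open Code WordRAM.Cmd

variable {T M H : ℕ} {K : List Cmd}

theorem enter_eval (hM : 16 * M < 2 ^ w) {s : Store} (hs : Consts T s) (h1M : 1 < M) :
    (enter.eval w L s).reg 10 = 1 ∧
    (enter.eval w L s).reg 13 = (if s.mem (cell 1 4) = 0 then 1 else 0) ∧
      (enter.eval w L s).mem = s.mem ∧
      ∀ r, r < 10 ∨ r = 11 → (enter.eval w L s).reg r = s.reg r := by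
  have h1 := one_mod hM (by omega : 0 < M)
  have c1 : Consts T (s.setReg 10 1) := hs.congr fun r hr => by
    rw [Store.setReg_reg, if_neg (by omega)]
  obtain ⟨e13, em, er⟩ := test_eval (L := L) hM c1 (p := 1) (by simp) h1M
  have e : enter.eval w L s = test.eval w L (s.setReg 10 1) := by
    rw [enter, Cmd.eval, Cmd.eval, h1]
  rw [e]
  refine ⟨?_, e13, em, fun r hr => ?_⟩
  · rw [er _ (by norm_num)]; simp
  · rw [er _ (by omega), Store.setReg_reg, if_neg (by omega)]

theorem count_eval {s : Store} (hs : Consts T s) (h7 : s.reg 7 + 1 < 2 ^ w) :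
    (count.eval w L s).reg 6 = (if s.reg 12 = 0 then s.reg 6 - 1 else 0) ∧
    (count.eval w L s).reg 7 = s.reg 7 + 1 ∧
    (count.eval w L s).mem = s.mem ∧
    ∀ r < 12, r ≠ 6 → r ≠ 7 → (count.eval w L s).reg r = s.reg r := by
  have e7 : (s.reg 7 + 1) % 2 ^ w = s.reg 7 + 1 := Nat.mod_eq_of_lt h7
  by_cases h : s.reg 12 = 0
  · simp [count, block, Cmd.eval, BinOp.eval, hs.one, e7, h]
    intro r h1 h2 h3
    rw [if_neg (by omega)]
    simp [h2, h3]
  · simp [count, block, Cmd.eval, BinOp.eval, hs.one, e7, h]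
    intro r h1 h2 h3
    simp [h2, h3]

theorem inspect_eval {s : Store} (hs : Consts T s) (hw : 0 < w) (h20 : s.reg 20 + 1 < 2 ^ w) :
    (inspect.eval w L s).reg 20 = s.reg 20 + 1 ∧
    (inspect.eval w L s).reg 22 = (if L.degreeQuery (s.reg 20 + 1) < T then 1 else 0) ∧
    (inspect.eval w L s).reg 7 = 0 ∧
    ∀ r < 12, r ≠ 7 → (inspect.eval w L s).reg r = s.reg r := by
  have h1 : 1 % 2 ^ w = 1 := Nat.mod_eq_of_lt (Nat.one_lt_two_pow hw.ne')
  have e20 : (s.reg 20 + 1) % 2 ^ w = s.reg 20 + 1 := Nat.mod_eq_of_lt h20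
  simp [inspect, block, Cmd.eval, BinOp.eval, hs.one, e20, hs.threshold, h1]
  intro r h1 h2
  rw [if_neg h2, if_neg (by omega), if_neg (by omega), if_neg (by omega)]

theorem plant_eval (hfit : Fits w n M H) {s : Store} (hs : Consts T s) (h1M : 2 < M) {v : Fin n}
    (h20 : s.reg 20 = v + 1) (h3 : s.reg 3 < 2 ^ w) :
    Rep (plant.eval w L s).mem 0 1 (mkVertex v 2) {1} ∧ (plant.eval w L s).reg 6 = s.reg 3 ∧
    (plant.eval w L s).reg 11 = 2 ∧ ∀ r < 10, r ≠ 6 → (plant.eval w L s).reg r = s.reg r := by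
  have hM := hfit.address
  have hv := v.2
  have hvw := hfit.vertex
  have p1 : 1 % 2 ^ w = 1 := Nat.mod_eq_of_lt (by omega)
  have p2 : 2 % 2 ^ w = 2 := Nat.mod_eq_of_lt (by omega)
  have pv : ((v : ℕ) + 1) % 2 ^ w = v + 1 := Nat.mod_eq_of_lt (by omega)
  set s₁ : Store := (block [.const 10 0, .const 11 1, .bin .add 22 20 9, .const 23 2, .const 24 0,
    .const 25 2, .const 26 0]).eval w L s with hs₁
  have f1 : s₁.reg 10 = 0 ∧ s₁.reg 11 = 1 ∧ s₁.reg 22 = v + 1 ∧ s₁.reg 23 = 2 ∧ s₁.reg 24 = 0 ∧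
      s₁.reg 25 = 2 ∧ s₁.reg 26 = 0 := by
    simp [hs₁, block, Cmd.eval, BinOp.eval, p1, p2, h20, hs.zero, pv]
  have f2 : ∀ r < 10, s₁.reg r = s.reg r := fun r hr =>
    Spares.eval_reg hr (by simp [block, Spares]) s
  obtain ⟨g10, g11, g22, g23, g24, g25, g26⟩ := f1
  set s₂ : Store := write.eval w L s₁ with hs₂
  have hm := write_eval (L := L) hM g11 (by omega : 1 < M)
  have g2 : ∀ r < 29, s₂.reg r = s₁.reg r := fun r hr => write_spares.eval_reg hr s₁
  have e : plant.eval w L s = (block [.const 11 2, .bin .add 6 3 9]).eval w L s₂ := rfl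
  have em : (plant.eval w L s).mem = s₂.mem := by rw [e]; simp [block, Cmd.eval]
  refine ⟨?_, ?_, ?_, fun r hr hr6 => ?_⟩
  · rw [em]
    refine .mk 0 1 v false 2 2 0 [] [] [] {1} [] ?_ ?_ rfl (by simp)
      ⟨rfl, by simp, by simp, by simp⟩
    · constructor <;> rw [hm] <;> simp [cell_inj, g10, g22, g23, g24, g25, g26]
    · rw [hm, if_pos rfl]; rfl
  · rw [e]
    have : s₂.reg 3 = s.reg 3 := by rw [g2 _ (by norm_num), f2 _ (by norm_num)]
    have h9 : s₂.reg 9 = 0 := by rw [g2 _ (by norm_num), f2 _ (by norm_num), hs.zero]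
    simp [block, Cmd.eval, BinOp.eval, this, h9, Nat.mod_eq_of_lt h3]
  · rw [e]; simp [block, Cmd.eval, p2]
  · rw [e]
    have : (block [.const 11 2, .bin .add 6 3 9] : Cmd).eval w L s₂ =
      (s₂.setReg 11 (2 % 2 ^ w)).setReg 6
        (BinOp.add.eval w ((s₂.setReg 11 (2 % 2 ^ w)).reg 3)
          ((s₂.setReg 11 (2 % 2 ^ w)).reg 9)) := rfl
    rw [this, Store.setReg_reg, if_neg hr6, Store.setReg_reg, if_neg (by omega), g2 _ (by omega),
      f2 _ hr]

theorem check_eval {s : Store} (h9 : s.reg 9 = 0) (h5 : s.reg 5 < 2 ^ w) :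
    (check.eval w L s).reg 13 = (if s.reg 4 = 0 then 0 else s.reg 5) ∧
    ∀ r < 12, (check.eval w L s).reg r = s.reg r := by
  refine ⟨?_, fun r hr => Spares.eval_reg hr (by simp [check, Spares]) s⟩
  by_cases h : s.reg 4 = 0 <;>
  simp [check, Cmd.eval, BinOp.eval, h, h9, Nat.mod_eq_of_lt h5]

theorem settle_eval {s : Store} (hs : Consts T s) (h5 : s.reg 5 < 2 ^ w) :
    (settle.eval w L s).reg 5 = s.reg 5 - s.reg 7 ∧
    (settle.eval w L s).reg 4 = s.reg 4 - 1 ∧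
    (settle.eval w L s).reg 13 = (if s.reg 4 - 1 = 0 then 0 else s.reg 5 - s.reg 7) ∧
    ∀ r < 12, r ≠ 4 → r ≠ 5 → (settle.eval w L s).reg r = s.reg r := by
  set s₁ := (s.setReg 5 (s.reg 5 - s.reg 7)).setReg 4 (s.reg 4 - 1) with hs₁
  have e : settle.eval w L s = check.eval w L s₁ := by
    simp [settle, block, Cmd.eval, BinOp.eval, hs.one, hs₁]
  have g : ∀ r, r ≠ 4 → r ≠ 5 → s₁.reg r = s.reg r := fun r h4 h5 => by
    rw [hs₁, Store.setReg_reg, if_neg h4, Store.setReg_reg, if_neg h5]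
  have g4 : s₁.reg 4 = s.reg 4 - 1 := by simp [hs₁]
  have g5 : s₁.reg 5 = s.reg 5 - s.reg 7 := by simp [hs₁]
  obtain ⟨e13, er⟩ := check_eval (L := L) (w := w) (s := s₁)
    (by rw [g _ (by norm_num) (by norm_num), hs.zero]) (by rw [g5]; omega)
  rw [e]
  refine ⟨by rw [er _ (by norm_num), g5], by rw [er _ (by norm_num), g4], by rw [e13, g4, g5],
    fun r hr h4 h5 => by rw [er _ hr, g _ h4 h5]⟩

/-- The registers that are not changed while the process of a vertex runs. -/
def KeepMost (s s' : Store) : Prop := ∀ r < 10, r ≠ 6 → r ≠ 7 → s'.reg r = s.reg r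

/-- The machine runs the process of a vertex for at most `t` units of time. -/
theorem units_refines (hfit : Fits w n M H) (hT : 1 ≤ T) {D : ℕ} (t : ℕ) :
    ∀ {x : Peeler n} {k f g₀ : ℕ} {F : Set ℕ} {s : Store}, Balanced L.nbrs T x k →
      x.th * (k + t) ≤ H → 700 * (Nat.log 2 (k + t) + 1) + 300 ≤ D →
      Rep s.mem 0 1 x F → (∀ q ∈ F, 0 < q ∧ q < f) → f + t ≤ M → g₀ + t < 2 ^ w → Consts T s →
      s.reg 6 = t → s.reg 7 = g₀ → s.reg 11 = f →
      Refines w L (.loop 6 unit :: K) s K (unitsUsed L.nbrs T t x) (fun g => D * g + 1) fun g s' =>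
        s'.reg 7 = g₀ + g ∧ KeepMost s s' := by
  induction t with
  | zero =>
    intro x k f g₀ F s _ _ _ _ _ _ _ _ h6 h7 _
    refine Refines.loop_false (t := fun _ => 0) h6 (.of_eq ⟨by simpa using h7, fun _ _ _ _ => rfl⟩)
      fun _ _ => by omega
  | succ t ih =>
    intro x k f g₀ F s hbal hH hD hrep hF hfM hg hs h6 h7 h11
    have hM := hfit.address
    have hp := hF 1 hrep.mem
    have hlog : Nat.log 2 k ≤ Nat.log 2 (k + (t + 1)) := Nat.log_mono_right (by omega)
    obtain ⟨e10, e13, em, er⟩ := enter_eval (L := L) hM hs (by omega)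
    have hx : x.th * k ≤ H := (Nat.mul_le_mul_left _ (by omega)).trans hH
    have hgive := give_refines (K := count :: .loop 6 unit :: K) hfit hT k (x := x) (par := 0)
      (p := 1) (f := f) (F := F) (s := enter.eval w L s) hbal hx (by rw [em]; exact hrep) hF
      (by omega) (hs.congr fun r hr => er r (Or.inl hr)) e10 (by rw [er 11 (Or.inr rfl), h11])
      (by rw [e13, em])
    have key : Refines w L (.loop 13 descend :: create :: .loop 10 ascend :: count ::
        .loop 6 unit :: K) (enter.eval w L s) K (unitsUsed L.nbrs T (t + 1) x)
        (fun g => D * (g - 1) + 700 * (Nat.log 2 k + 1) + 150) fun g s' =>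
        s'.reg 7 = g₀ + g ∧ KeepMost s s' := by
      rw [unitsUsed]
      refine hgive.trans (t₂ := fun _ g => D * (g - 1) + 150) (fun o ho s₁ hs₁ => ?_)
        fun _ _ _ _ => by omega
      obtain ⟨hout, hk1, h111, -⟩ := hs₁
      have k1 : ∀ r < 10, s₁.reg r = s.reg r := fun r hr => by rw [hk1 r hr, er r (Or.inl hr)]
      have c1 := hs.congr k1
      have z10 : s₁.reg 10 = 0 := by
        cases o with
        | none => exact hout.1
        | some y => exact hout.1
      obtain ⟨d6, d7, dm, dr⟩ := count_eval (L := L) (w := w) c1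
        (by rw [k1 _ (by norm_num), h7]; omega)
      rw [k1 7 (by norm_num), h7] at d7
      rw [k1 6 (by norm_num), h6] at d6
      have k2 : KeepMost s (count.eval w L s₁) := fun r hr hr6 hr7 => by
        rw [dr r (by omega) hr6 hr7, k1 r hr]
      have c2 : Consts T (count.eval w L s₁) :=
        ⟨by rw [k2 _ (by norm_num) (by norm_num) (by norm_num), hs.threshold],
          by rw [k2 _ (by norm_num) (by norm_num) (by norm_num), hs.one],
          by rw [k2 _ (by norm_num) (by norm_num) (by norm_num), hs.zero]⟩
      have hcs := count_size
      refine Refines.loop_false (t := fun g => D * (g - 1) + 149) z10 ?_ fun _ _ => by omega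
      refine Refines.plain_cons count_plain (t := fun g => D * (g - 1) + 49) ?_ fun _ _ => by omega
      cases o with
      | none =>
        obtain ⟨-, h12⟩ := hout
        rw [h12, if_neg (by norm_num)] at d6
        exact Refines.loop_false (t := fun _ => 0) d6 (.of_eq ⟨d7, k2⟩) fun _ _ => by omega
      | some y =>
        obtain ⟨-, h12, hrep1⟩ := hout
        rw [h12, if_pos rfl, Nat.add_sub_cancel] at d6
        obtain ⟨hbal', hth'⟩ := hbal.of_give hT ho
        have hrec := ih (x := y) (k := k + 1) (f := f + 1) (g₀ := g₀ + 1) (F := insert f F)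
          (s := count.eval w L s₁) hbal'
          (by rw [hth', show k + 1 + t = k + (t + 1) by omega]; exact hH)
          (by rw [show k + 1 + t = k + (t + 1) by omega]; exact hD) (by rw [dm]; exact hrep1)
          (fun q hq => by
            rcases hq with rfl | hq
            · omega
            · have := hF q hq; omega) (by omega) (by omega) c2 d6 d7
          (by rw [dr 11 (by norm_num) (by norm_num) (by norm_num), h111])
        refine hrec.map (fun g _ => ?_) fun g _ s' hs' => ⟨by rw [hs'.1]; omega,
          fun r hr hr6 hr7 => by rw [hs'.2 r hr hr6 hr7, k2 r hr hr6 hr7]⟩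
        simp only [Nat.add_sub_cancel]
        omega
    have hes := enter_size
    have hpos : ∀ g, unitsUsed L.nbrs T (t + 1) x g ≠ 0 → 1 ≤ g := by
      intro g hg
      rw [unitsUsed, PMF.bind_apply_ne_zero] at hg
      obtain ⟨o, -, ho⟩ := hg
      cases o with
      | none => rw [Option.elim_none, PMF.pure_apply_ne_zero] at ho; omega
      | some y =>
        rw [Option.elim_some, PMF.map_apply_ne_zero] at ho
        obtain ⟨g', -, rfl⟩ := ho
        omega
    obtain ⟨c, hc⟩ : ∃ c, c = 700 * (Nat.log 2 k + 1) + 250 := ⟨_, rfl⟩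
    refine Refines.loop_true (t := fun g => D * (g - 1) + c + 4)
      (by rw [h6]; omega) ?_ fun g hg => ?_
    · refine Refines.seq (t := fun g => D * (g - 1) + c + 3) ?_ fun _ _ => le_rfl
      refine Refines.seq (t := fun g => D * (g - 1) + c + 2) ?_ fun _ _ => le_rfl
      refine Refines.seq (t := fun g => D * (g - 1) + c + 1) ?_ fun _ _ => le_rfl
      refine Refines.seq (t := fun g => D * (g - 1) + c) ?_ fun _ _ => le_rfl
      exact Refines.plain_cons enter_plain key fun _ _ => by clear * - hes hc; omega
    · obtain ⟨g, rfl⟩ := Nat.exists_eq_add_of_le' (hpos g hg)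
      simp only [Nat.add_sub_cancel, Nat.mul_succ]
      omega

/-- The machine runs the process of a random vertex. -/
theorem root_refines (hfit : Fits w n (n + 3) (2 * (n + 1))) (hn : 0 < n) (hT : 1 ≤ T) {D R : ℕ}
    (hD : 700 * (Nat.log 2 (n + 1) + 1) + 300 ≤ D) (hR : R ≤ n) {s : Store} {m U : ℕ}
    (hs : Consts T s) (h0 : s.reg 0 = n) (h3 : s.reg 3 = R) (h4 : s.reg 4 = m) (h5 : s.reg 5 = U)
    (hU : U < 2 ^ w) :
    Refines w L (root :: K) s K
      ((uniformBelow n).bind fun i => rootUnits L.nbrs T R (vertexOf hn i))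
      (fun g => D * g + 500) fun g s' =>
        (∀ r < 10, r ≠ 4 → r ≠ 5 → r ≠ 6 → r ≠ 7 → s'.reg r = s.reg r) ∧
        s'.reg 4 = m - 1 ∧ s'.reg 5 = U - g ∧
        s'.reg 13 = if m - 1 = 0 then 0 else U - g := by
  have hnw := hfit.vertex
  have hrand : Refines w L (.rand 20 0 :: .seq inspect (.seq (.ite 22 (.const 28 0)
      (.seq plant (.loop 6 unit))) settle) :: K) s (.seq inspect (.seq (.ite 22 (.const 28 0)
      (.seq plant (.loop 6 unit))) settle) :: K) (uniformBelow n) (fun _ => 1)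
      (fun x s' => s' = s.setReg 20 x) := by
    have := Refines.rand (w := w) (L := L) (K := .seq inspect (.seq (.ite 22 (.const 28 0)
      (.seq plant (.loop 6 unit))) settle) :: K) (s := s)
      (r := 20) (a := 0) (t := fun _ => 1) (R := fun x s' => s' = s.setReg 20 x)
      (fun _ _ => le_rfl) (fun _ _ => rfl)
    rwa [h0] at this
  refine Refines.seq (t := fun g => D * g + 499) ?_ fun _ _ => le_rfl
  refine hrand.trans (t₂ := fun _ g => D * g + 450) (fun i hi s₁ hs₁ => ?_)
    fun _ _ _ _ => by clear * -; omega
  have hin : i < n := lt_of_uniformBelow hn hi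
  set v := vertexOf hn i with hv
  have hvi : (v : ℕ) = i := Nat.mod_eq_of_lt hin
  have k1 : ∀ r < 12, s₁.reg r = s.reg r := fun r hr => by
    rw [hs₁, Store.setReg_reg, if_neg (by omega)]
  have h20 : s₁.reg 20 = v := by rw [hs₁, hvi]; simp
  have c1 : Consts T s₁ := hs.congr fun r hr => k1 r (by omega)
  obtain ⟨e20, e22, e7, er⟩ := inspect_eval (L := L) (w := w) c1
    (by have := hfit.one_lt; omega) (by omega)
  rw [h20] at e20 e22
  rw [L.degreeQuery_succ] at e22
  have hsz := inspect_size
  refine Refines.seq (t := fun g => D * g + 449) ?_ fun _ _ => le_rfl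
  refine Refines.plain_cons inspect_plain (t := fun g => D * g + 349) ?_
    fun _ _ => by clear * - hsz; omega
  refine Refines.seq (t := fun g => D * g + 348) ?_ fun _ _ => le_rfl
  set s₂ := inspect.eval w L s₁ with hs₂
  have k2 : ∀ r < 12, r ≠ 7 → s₂.reg r = s.reg r := fun r hr h7 => by rw [er r hr h7, k1 r hr]
  have c2 : Consts T s₂ := ⟨by rw [k2 _ (by norm_num) (by norm_num), hs.threshold],
    by rw [k2 _ (by norm_num) (by norm_num), hs.one],
    by rw [k2 _ (by norm_num) (by norm_num), hs.zero]⟩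
  -- the time of the process has been written to register 7
  have mid : Refines w L (.ite 22 (.const 28 0) (.seq plant (.loop 6 unit)) :: settle :: K) s₂
      (settle :: K) (rootUnits L.nbrs T R v) (fun g => D * g + 248) fun g s' =>
        s'.reg 7 = g ∧ KeepMost s s' := by
    refine Refines.ite (t := fun g => D * g + 240) ?_ fun _ _ => by omega
    rw [e22]
    unfold rootUnits start
    by_cases hd : T ≤ (L.nbrs v).length
    · rw [if_neg (by omega : ¬ (L.nbrs v).length < T), if_neg (by norm_num), if_pos hd,
        Option.elim_some]
      have hpl := plant_size
      obtain ⟨p1, p2, p3, p4⟩ := plant_eval (L := L) hfit c2 (by omega) e20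
        (by rw [k2 _ (by norm_num) (by norm_num), h3]; omega)
      rw [k2 _ (by norm_num) (by norm_num), h3] at p2
      refine Refines.seq (t := fun g => D * g + 239) ?_ fun _ _ => by omega
      refine Refines.plain_cons plant_plain (t := fun g => D * g + 1) ?_ fun _ _ => by omega
      have hlog : Nat.log 2 (1 + R) ≤ Nat.log 2 (n + 1) := Nat.log_mono_right (by omega)
      have := units_refines (K := settle :: K) (L := L) (D := D) hfit hT R (x := mkVertex v 2)
        (k := 1)
        (f := 2) (g₀ := 0) (F := {1}) (s := plant.eval w L s₂) (balanced_mkVertex hd le_rfl)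
        (by show 2 * (1 + R) ≤ 2 * (n + 1); omega) (by omega) p1
        (fun q hq => by rw [Set.mem_singleton_iff] at hq; omega) (by omega) (by omega)
        ⟨by rw [p4 _ (by norm_num) (by norm_num), c2.threshold],
          by rw [p4 _ (by norm_num) (by norm_num), c2.one],
          by rw [p4 _ (by norm_num) (by norm_num), c2.zero]⟩ p2
        (by rw [p4 _ (by norm_num) (by norm_num), e7]) p3
      refine this.mono (fun _ _ => le_rfl) fun g _ s' hs' => ⟨by rw [hs'.1, zero_add],
        fun r hr h6 h7 => ?_⟩
      rw [hs'.2 r hr h6 h7, p4 r hr h6, k2 r (by omega) h7]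
    · rw [if_pos (by omega : (L.nbrs v).length < T), if_pos (by norm_num), if_neg hd,
        Option.elim_none]
      refine Refines.plain (by simp [Plain]) (by simp [Cmd.size]) ⟨?_, fun r hr h6 h7 => ?_⟩
      · simp [Cmd.eval, e7]
      · rw [Cmd.eval, Store.setReg_reg, if_neg (by omega), k2 r (by omega) h7]
  rw [← PMF.bind_pure (rootUnits L.nbrs T R v)]
  refine mid.trans (t₂ := fun _ _ => 100) (fun g _ s₃ hs₃ => ?_) fun a b _ hb => ?_
  · obtain ⟨g7, k3⟩ := hs₃
    have c3 : Consts T s₃ := ⟨by rw [k3 _ (by norm_num) (by norm_num) (by norm_num), hs.threshold],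
      by rw [k3 _ (by norm_num) (by norm_num) (by norm_num), hs.one],
      by rw [k3 _ (by norm_num) (by norm_num) (by norm_num), hs.zero]⟩
    have e5 : s₃.reg 5 = U := by rw [k3 _ (by norm_num) (by norm_num) (by norm_num), h5]
    have e4 : s₃.reg 4 = m := by rw [k3 _ (by norm_num) (by norm_num) (by norm_num), h4]
    obtain ⟨q5, q4, q13, qr⟩ := settle_eval (L := L) (w := w) c3 (by rw [e5]; exact hU)
    rw [e5, g7] at q5 q13
    rw [e4] at q4 q13
    refine Refines.plain settle_plain settle_size ⟨fun r hr h4 h5 h6 h7 => ?_, q4, q5, q13⟩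
    rw [qr r (by omega) h4 h5, k3 r hr h6 h7]
  · rw [PMF.pure_apply_ne_zero] at hb
    subst hb
    omega

/-- The time bound of the tester. A unit of time costs at most `D` steps, and the last process may
overrun the budget by `R` units. -/
def testerTime (D R m U : ℕ) : ℕ := if U = 0 then 1 else 510 * m + D * (U + R) + 1

theorem tester_refines (hfit : Fits w n (n + 3) (2 * (n + 1))) (hn : 0 < n) (hT : 1 ≤ T) {D R : ℕ}
    (hD : 700 * (Nat.log 2 (n + 1) + 1) + 300 ≤ D) (hR : R ≤ n) (m : ℕ) : ∀ {U : ℕ} {s : Store},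
    Consts T s → s.reg 0 = n → s.reg 3 = R → s.reg 4 = m → s.reg 5 = U → U < 2 ^ w →
    s.reg 13 = (if m = 0 then 0 else U) →
    Refines w L (.loop 13 root :: K) s K (tester L.nbrs T hn R m U)
      (fun _ => testerTime D R m U) fun b s' =>
        (s'.reg 5 = 0 ↔ b = true) ∧ (∀ r < 10, r ≠ 4 → r ≠ 5 → r ≠ 6 → r ≠ 7 →
          s'.reg r = s.reg r) := by
  induction m with
  | zero =>
    intro U s hs h0 h3 h4 h5 hU h13
    cases U with
    | zero =>
      rw [tester]
      exact Refines.loop_false (t := fun _ => 0) (by rw [h13]; simp)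
        (.of_eq ⟨by simp [h5], fun _ _ _ _ _ _ => rfl⟩) fun _ _ => by simp [testerTime]
    | succ U =>
      rw [tester]
      exact Refines.loop_false (t := fun _ => 0) (by rw [h13]; simp)
        (.of_eq ⟨by simp [h5], fun _ _ _ _ _ _ => rfl⟩) fun _ _ => by simp [testerTime]
  | succ m ih =>
    intro U s hs h0 h3 h4 h5 hU h13
    cases U with
    | zero =>
      rw [tester]
      exact Refines.loop_false (t := fun _ => 0) (by rw [h13]; simp)
        (.of_eq ⟨by simp [h5], fun _ _ _ _ _ _ => rfl⟩) fun _ _ => by simp [testerTime]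
    | succ U =>
      rw [tester, ← PMF.bind_bind]
      refine Refines.loop_true (t := fun _ => 510 * m + D * (U + 1 + R) + 510)
        (by rw [h13]; simp) ?_ fun _ _ => by simp only [testerTime]; rw [if_neg (by omega)]; omega
      refine (root_refines hfit hn hT hD hR hs h0 h3 h4 h5 hU).trans
        (t₂ := fun g _ => testerTime D R m (U + 1 - g)) (fun g _ s₁ hs₁ => ?_)
        fun g _ hg _ => ?_
      · obtain ⟨k, r4, r5, r13⟩ := hs₁
        have c1 : Consts T s₁ := ⟨by rw [k] <;> norm_num; exact hs.threshold,
          by rw [k] <;> norm_num; exact hs.one, by rw [k] <;> norm_num; exact hs.zero⟩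
        refine (ih c1 (by rw [k] <;> norm_num; exact h0) (by rw [k] <;> norm_num; exact h3) r4 r5
          (by omega) (by simpa using r13)).mono (fun _ _ => le_rfl) fun b _ s' hs' =>
          ⟨hs'.1, fun r hr h4 h5 h6 h7 => by rw [hs'.2 r hr h4 h5 h6 h7, k r hr h4 h5 h6 h7]⟩
      · have hgR : g ≤ R := by
          rw [PMF.bind_apply_ne_zero] at hg
          obtain ⟨i, -, hi⟩ := hg
          exact rootUnits_le hi
        unfold testerTime
        split_ifs with h
        · have : D * g ≤ D * (U + 1 + R) := Nat.mul_le_mul_left _ (by omega)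
          omega
        · have : D * g + D * (U + 1 - g + R) = D * (U + 1 + R) := by
            rw [← Nat.mul_add]; congr 1; omega
          omega

end Peeling

/-! ### The search for the threshold -/

namespace Peeling

open WordRAM

variable {n : ℕ}

/-- Halve the threshold `T` until the tester reports a dense core, at most `k` times. The outcome is
the last threshold, or `0` if the tester has never reported a dense core. -/
noncomputable def search (N : Fin n → List (Fin n)) (hn : 0 < n) (l : ℕ) : ℕ → ℕ → PMF ℕ
  | 0, _ => PMF.pure 0
  | k + 1, T => if T = 0 then PMF.pure 0 else
      (tester N T hn (n / T) (l * (n / T)) (40 * l * (n / T))).bind fun b =>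
        if b then PMF.pure T else search N hn l k (T / 2)

theorem search_le {N : Fin n → List (Fin n)} {hn : 0 < n} {l k T r : ℕ}
    (h : search N hn l k T r ≠ 0) : r ≤ T := by
  induction k generalizing T with
  | zero => rw [search, PMF.pure_apply_ne_zero] at h; omega
  | succ k ih =>
    rw [search] at h
    split_ifs at h with hT
    · rw [PMF.pure_apply_ne_zero] at h; omega
    · rw [PMF.bind_apply_ne_zero] at h
      obtain ⟨b, -, h⟩ := h
      split_ifs at h with hb
      · rw [PMF.pure_apply_ne_zero] at h; omega
      · have := ih h; omega

/-- An outcome of the search that determines the arboricity up to a constant factor: the tester has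
rejected a threshold of at most `2 * r + 1` correctly, and accepted `r` correctly. -/
def Good (α r : ℕ) : Prop := α < 480 * (2 * r + 1) ∧ (r = 0 ∨ r < 32 * α)

open Classical in
/-- The search fails only if the tester errs for one of the at most `k` thresholds, on a graph that
is clearly sparse, or has a clearly dense core, for this threshold. -/
theorem search_not_good_le {G : SimpleGraph (Fin n)} (L : IncidenceList G) (hn : 0 < n) (l k : ℕ) :
    ∀ T, T < 2 ^ k → T ≤ n → arboricity G < 480 * (2 * T + 1) →
    ((search L.nbrs hn l k T).expect fun r => if Good (arboricity G) r then 0 else 1) ≤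
      k * ENNReal.ofReal (Real.exp (-(20 * l))) := by
  set α := arboricity G with hα
  set η := ENNReal.ofReal (Real.exp (-(20 * l))) with hη
  induction k with
  | zero =>
    intro T hT _ hTα
    have hT0 : T = 0 := by simpa using hT
    subst hT0
    rw [search, PMF.expect_pure, if_pos ⟨by simpa using hTα, Or.inl rfl⟩]
    simp
  | succ k ih =>
    intro T hT hTn hTα
    rw [search]
    by_cases hT0 : T = 0
    · subst hT0
      rw [if_pos rfl, PMF.expect_pure, if_pos ⟨by simpa using hTα, Or.inl rfl⟩]
      simp
    · have hT1 : 1 ≤ T := by omega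
      rw [if_neg hT0, PMF.expect_bind]
      have hrec : α < 480 * T → ((search L.nbrs hn l k (T / 2)).expect fun r =>
          if Good α r then 0 else 1) ≤ k * η := fun h =>
        ih (T / 2) (by rw [pow_succ] at hT; omega) (by omega) (by omega)
      have hR : 1 ≤ n / T := (Nat.one_le_div_iff hT1).2 hTn
      -- bound the two wrong answers of the tester separately
      have h1 : ∀ b : Bool, ((if b = true then PMF.pure T else
          search L.nbrs hn l k (T / 2)).expect fun r => if Good α r then 0 else 1) ≤
          (if b then (if 32 * α ≤ T then 1 else 0) else 0) +
          ((if b then 0 else (if 480 * T ≤ α then 1 else 0)) + k * η) := by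
        intro b
        cases b
        · rw [if_neg (by simp)]
          by_cases h : 480 * T ≤ α
          · simp only [h, if_true, Bool.false_eq_true, if_false, zero_add]
            refine le_trans (PMF.expect_le_const (c := 1) fun r _ => ?_) le_self_add
            split_ifs <;> simp
          · simpa [h] using hrec (by omega)
        · rw [if_pos rfl, PMF.expect_pure]
          by_cases h : 32 * α ≤ T
          · simp only [h, if_true]
            refine le_trans ?_ le_self_add
            split_ifs <;> simp
          · rw [if_pos ⟨hTα, Or.inr (by omega)⟩]
            simp
      refine (PMF.expect_mono h1).trans ?_
      rw [PMF.expect_add, PMF.expect_add, PMF.expect_const]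
      have e : ((k + 1 : ℕ) : ℝ≥0∞) * η = η + k * η := by push_cast; ring
      rw [e, ← add_assoc]
      gcongr
      by_cases hd : 32 * α ≤ T
      · -- the graph is sparse
        have h2 : ¬ 480 * T ≤ α := by omega
        simp only [hd, h2, if_true, if_false, ite_self, PMF.expect_const, add_zero]
        obtain ⟨o, ho, hα'⟩ := L.exists_orientation
        exact tester_true_le_of_sparse hn hR (sum_startLife_le hT1 L.nodup
          (fun v u h => (L.mem_nbrs _ _).2 ((L.mem_nbrs _ _).1 h).symm) ho hα' hd _)
      · simp only [hd, if_false, ite_self, PMF.expect_const, zero_add]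
        by_cases hc : 480 * T ≤ α
        · simp only [hc, if_true]
          obtain ⟨S, hne, hS⟩ := L.exists_core (by omega)
          exact tester_false_le_of_core hn hT1 hTn hne L.nodup fun v hv => hc.trans (hS v hv)
        · simp [hc, PMF.expect_const]

end Peeling

/-! ### The program -/

namespace Peeling

open Peeler WordRAM

variable {n : ℕ} {G : SimpleGraph (Fin n)} {w : ℕ} {L : IncidenceList G}

namespace Code

open WordRAM.Cmd

/-- Copy the number of vertices to register 14. -/
def prelude : Cmd := block [.const 8 1, .const 15 2, .bin .add 14 0 9, .const 2 0]

/-- Halve register 14, and count in register 2. -/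
def halve : Cmd := block [.bin .add 2 2 8, .bin .div 14 14 15]

/-- Multiply register 2 by `d`, and initialize the threshold with the number of vertices. -/
def startSearch (d : ℕ) : Cmd :=
  block [.const 15 d, .bin .mul 2 2 15, .bin .add 1 0 9, .bin .add 13 0 9]

/-- Set the parameters of the tester. -/
def setup : Cmd :=
  block [.bin .div 3 0 1, .bin .mul 4 2 3, .const 28 40, .bin .mul 5 28 4, check]

/-- Halve the threshold if the tester has not found a dense core, and stop otherwise. -/
def conclude : Cmd :=
  .ite 5 (block [.const 15 2, .bin .div 1 1 15, .bin .add 13 1 9]) (.const 13 0)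

/-- Run the tester with one threshold. -/
def guess : Cmd := .seq setup (.seq (.loop 13 root) conclude)

/-- Output an estimate that is obtained from the threshold. -/
def report : Cmd := block [.const 15 32, .bin .div 14 1 15, .ite 14 (.bin .add 0 14 9) (.const 0 1)]

/-- Find out whether a vertex has a neighbour. -/
def probe : Cmd := block [.degree 15 4, .ite 15 (.const 14 1) (.const 28 0), .bin .sub 4 4 8]

/-- Output whether the graph has an edge. -/
def scan : Cmd :=
  .seq (block [.const 14 0, .bin .add 4 0 9]) (.seq (.loop 4 probe) (.bin .add 0 14 9))

/-- The whole program. The parameter `d` controls the error probability. -/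
def program (d : ℕ) : Cmd :=
  .seq prelude (.seq (.loop 14 halve) (.seq (startSearch d) (.seq (.loop 13 guess)
    (.ite 1 report scan))))

theorem prelude_plain : prelude.Plain := by simp [prelude, block, Plain]
theorem halve_plain : halve.Plain := by simp [halve, block, Plain]
theorem startSearch_plain (d : ℕ) : (startSearch d).Plain := by simp [startSearch, block, Plain]
theorem setup_plain : setup.Plain := by simp [setup, check, block, Plain]
theorem conclude_plain : conclude.Plain := by simp [conclude, block, Plain]
theorem report_plain : report.Plain := by simp [report, block, Plain]
theorem probe_plain : probe.Plain := by simp [probe, block, Plain]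

theorem prelude_size : prelude.size ≤ 20 := by simp [prelude, block, size]
theorem halve_size : halve.size ≤ 20 := by simp [halve, block, size]
theorem startSearch_size (d : ℕ) : (startSearch d).size ≤ 20 := by simp [startSearch, block, size]
theorem setup_size : setup.size ≤ 20 := by simp [setup, check, block, size]
theorem conclude_size : conclude.size ≤ 20 := by simp [conclude, block, size]
theorem report_size : report.size ≤ 20 := by simp [report, block, size]
theorem probe_size : probe.size ≤ 20 := by simp [probe, block, size]

end Code

open Code WordRAM.Cmd

variable {K : List Cmd}

/-- The number of binary digits is found by repeated halving. -/
theorem halve_refines (x : ℕ) : ∀ {c : ℕ} {s : Store}, s.reg 8 = 1 → s.reg 15 = 2 →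
    s.reg 14 = x → s.reg 2 = c → c + x < 2 ^ w →
    Refines w L (.loop 14 halve :: K) s K (PMF.pure ())
      (fun _ => 21 * (if x = 0 then 0 else Nat.log 2 x + 1) + 1) fun _ s' =>
        s'.reg 2 = c + (if x = 0 then 0 else Nat.log 2 x + 1) ∧
        ∀ r < 14, r ≠ 2 → s'.reg r = s.reg r := by
  induction x using Nat.strong_induction_on with
  | _ x ih =>
  intro c s h8 h15 h14 h2 hw
  by_cases hx : x = 0
  · subst hx
    exact Refines.loop_false (t := fun _ => 0) h14 (.of_eq ⟨by simpa using h2, fun _ _ _ => rfl⟩)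
      fun _ _ => by simp
  · have hlog : Nat.log 2 x = if x / 2 = 0 then 0 else Nat.log 2 (x / 2) + 1 := by
      split_ifs with h
      · exact Nat.log_of_lt (by omega)
      · exact Nat.log_of_one_lt_of_le (by norm_num) (by omega)
    have hc : (c + 1) % 2 ^ w = c + 1 := Nat.mod_eq_of_lt (by omega)
    have e : halve.eval w L s = (s.setReg 2 (c + 1)).setReg 14 (x / 2) := by
      simp [halve, block, Cmd.eval, BinOp.eval, h8, h15, h14, h2, hc]
    rw [if_neg hx, hlog]
    have hs := halve_size
    refine Refines.loop_true
      (t := fun _ => 21 * (if x / 2 = 0 then 0 else Nat.log 2 (x / 2) + 1) + 21)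
      (by rw [h14]; exact hx) ?_ fun _ _ => by omega
    refine Refines.plain_cons halve_plain ?_ (fun _ _ => by
      have := Nat.add_le_add_right hs
        (21 * (if x / 2 = 0 then 0 else Nat.log 2 (x / 2) + 1) + 1)
      refine this.trans (le_of_eq ?_)
      ring)
    rw [e]
    refine (ih (x / 2) (by omega) (c := c + 1)
      (s := (s.setReg 2 (c + 1)).setReg 14 (x / 2)) (by simp [h8]) (by simp [h15]) (by simp)
      (by simp) (by omega)).mono (fun _ _ => le_rfl) fun _ _ s' hs' => ⟨?_, fun r hr h2 => ?_⟩
    · rw [hs'.1]; ring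
    · rw [hs'.2 r hr h2]
      simp only [Store.setReg_reg]
      rw [if_neg (by omega), if_neg h2]

theorem setup_eval {s : Store} {T l : ℕ} (hs : Consts T s) (h0 : s.reg 0 = n) (h2 : s.reg 2 = l)
    (hw : 40 * l * n < 2 ^ w) (hw' : 40 < 2 ^ w) :
    (setup.eval w L s).reg 3 = n / T ∧ (setup.eval w L s).reg 4 = l * (n / T) ∧
    (setup.eval w L s).reg 5 = 40 * l * (n / T) ∧
    (setup.eval w L s).reg 13 = (if l * (n / T) = 0 then 0 else 40 * l * (n / T)) ∧
    ∀ r < 10, r ≠ 3 → r ≠ 4 → r ≠ 5 → (setup.eval w L s).reg r = s.reg r := by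
  have h1 : 40 * l * (n / T) ≤ 40 * l * n := Nat.mul_le_mul_left _ (Nat.div_le_self _ _)
  have e1 : 40 * (l * (n / T)) % 2 ^ w = 40 * (l * (n / T)) :=
    Nat.mod_eq_of_lt (by rw [← mul_assoc]; omega)
  have e2 : l * (n / T) % 2 ^ w = l * (n / T) := Nat.mod_eq_of_lt (by
    have : l * (n / T) ≤ 40 * (l * (n / T)) := Nat.le_mul_of_pos_left _ (by norm_num)
    rw [← mul_assoc] at this; omega)
  have e3 : 40 % 2 ^ w = 40 := Nat.mod_eq_of_lt hw'
  set s₁ := (((s.setReg 3 (n / T)).setReg 4 (l * (n / T))).setReg 28 40).setReg 5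
    (40 * (l * (n / T))) with hs₁
  have e : setup.eval w L s = check.eval w L s₁ := by
    simp [setup, block, Cmd.eval, BinOp.eval, hs₁, h0, h2, hs.threshold, e2, e3, e1]
  have g3 : s₁.reg 3 = n / T := by simp [hs₁]
  have g4 : s₁.reg 4 = l * (n / T) := by simp [hs₁]
  have g5 : s₁.reg 5 = 40 * l * (n / T) := by simp [hs₁, mul_assoc]
  obtain ⟨e13, er⟩ := check_eval (L := L) (w := w) (s := s₁) (by simp [hs₁, hs.zero])
    (by rw [g5]; omega)
  rw [e]
  refine ⟨by rw [er _ (by norm_num), g3], by rw [er _ (by norm_num), g4],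
    by rw [er _ (by norm_num), g5], by rw [e13, g4, g5], fun r hr h3 h4 h5 => ?_⟩
  rw [er _ (by omega), hs₁]
  simp only [Store.setReg_reg]
  rw [if_neg h5, if_neg (by omega), if_neg h4, if_neg h3]

theorem conclude_eval {s : Store} {T : ℕ} (hs : Consts T s) (hT : T < 2 ^ w) (hw : 2 < 2 ^ w) :
    (conclude.eval w L s).reg 1 = (if s.reg 5 = 0 then T else T / 2) ∧
    (conclude.eval w L s).reg 13 = (if s.reg 5 = 0 then 0 else T / 2) ∧
    ∀ r < 10, r ≠ 1 → (conclude.eval w L s).reg r = s.reg r := by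
  have e1 : 2 % 2 ^ w = 2 := Nat.mod_eq_of_lt hw
  have e2 : T / 2 % 2 ^ w = T / 2 := Nat.mod_eq_of_lt (by omega)
  refine ⟨?_, ?_, fun r hr h1 => ?_⟩
  · by_cases h : s.reg 5 = 0 <;>
    simp [conclude, block, Cmd.eval, BinOp.eval, h, hs.threshold, e1]
  · by_cases h : s.reg 5 = 0 <;>
    simp [conclude, block, Cmd.eval, BinOp.eval, h, hs.threshold, hs.zero, e1, e2]
  · by_cases h : s.reg 5 = 0
    · simp [conclude, block, Cmd.eval, h]
      omega
    · simp [conclude, block, Cmd.eval, h]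
      rw [if_neg (by omega), if_neg h1, if_neg (by omega)]

/-- The time for one threshold `T` is at most the product of this number and `n / T`. -/
def guessTime (D l : ℕ) : ℕ := 510 * l + D * (40 * l + 1) + 60

theorem testerTime_le {D l R X : ℕ} (hX : 1 ≤ X) (hR : R ≤ X) :
    testerTime D R (l * R) (40 * l * R) + 59 ≤ guessTime D l * X := by
  have h1 : 510 * (l * R) ≤ 510 * l * X := by
    rw [← mul_assoc]; exact Nat.mul_le_mul_left _ hR
  have h2 : D * (40 * l * R + R) ≤ D * (40 * l + 1) * X := by
    have : D * (40 * l * R + R) = D * (40 * l + 1) * R := by ring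
    rw [this]; exact Nat.mul_le_mul_left _ hR
  unfold testerTime guessTime
  rw [add_mul, add_mul]
  split_ifs <;> omega

/-- The time is dominated by the smallest threshold `r` that is tried, as the time for a threshold
is inversely proportional to it. -/
theorem search_refines (hfit : Fits w n (n + 3) (2 * (n + 1))) (hn : 0 < n) {D l : ℕ}
    (hD : 700 * (Nat.log 2 (n + 1) + 1) + 300 ≤ D) (hl : 40 * l * n < 2 ^ w) (k : ℕ) :
    ∀ {T : ℕ} {s : Store}, T < 2 ^ k → T ≤ n → Consts T s → s.reg 0 = n → s.reg 2 = l →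
    s.reg 13 = T →
    Refines w L (.loop 13 guess :: K) s K (search L.nbrs hn l k T)
      (fun r => k * (guessTime D l * (n / max r 1)) + 1) fun r s' =>
        s'.reg 1 = r ∧ s'.reg 0 = n ∧ s'.reg 8 = 1 ∧ s'.reg 9 = 0 := by
  induction k with
  | zero =>
    intro T s hT _ hs h0 h2 h13
    have hT0 : T = 0 := by simpa using hT
    subst hT0
    rw [search]
    exact Refines.loop_false (t := fun _ => 0) h13
      (.of_eq ⟨hs.threshold, h0, hs.one, hs.zero⟩) fun _ _ => by omega
  | succ k ih =>
    intro T s hT hTn hs h0 h2 h13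
    rw [search]
    by_cases hT0 : T = 0
    · rw [if_pos hT0]
      exact Refines.loop_false (t := fun _ => 0) (by rw [h13, hT0])
        (.of_eq ⟨by rw [hs.threshold, hT0], h0, hs.one, hs.zero⟩) fun _ _ => by omega
    · rw [if_neg hT0]
      have hadd := hfit.address
      have hT1 : 1 ≤ T := by omega
      have hRn : n / T ≤ n := Nat.div_le_self _ _
      obtain ⟨a3, a4, a5, a13, ar⟩ := setup_eval (L := L) (w := w) hs h0 h2 hl
        (by omega)
      set s₁ := setup.eval w L s with hs₁
      have hU : 40 * l * (n / T) < 2 ^ w :=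
        (Nat.mul_le_mul_left _ (Nat.div_le_self _ _)).trans_lt hl
      have c1 : Consts T s₁ := ⟨by rw [ar _ (by norm_num) (by norm_num) (by norm_num) (by norm_num),
          hs.threshold], by rw [ar _ (by norm_num) (by norm_num) (by norm_num) (by norm_num),
          hs.one],
        by rw [ar _ (by norm_num) (by norm_num) (by norm_num) (by norm_num), hs.zero]⟩
      have htest := tester_refines (L := L) (K := conclude :: .loop 13 guess :: K) hfit hn hT1 hD
        hRn (l * (n / T)) (U := 40 * l * (n / T)) (s := s₁) c1
        (by rw [ar _ (by norm_num) (by norm_num) (by norm_num) (by norm_num), h0]) a3 a4 a5 hU a13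
      have hss := setup_size
      have hds := conclude_size
      obtain ⟨t₁, ht₁⟩ : ∃ t₁, t₁ = testerTime D (n / T) (l * (n / T)) (40 * l * (n / T)) :=
        ⟨_, rfl⟩
      rw [← ht₁] at htest
      have main : Refines w L (.loop 13 root :: conclude :: .loop 13 guess :: K) s₁ K
          ((tester L.nbrs T hn (n / T) (l * (n / T)) (40 * l * (n / T))).bind fun b =>
            if b then PMF.pure T else search L.nbrs hn l k (T / 2))
          (fun r => k * (guessTime D l * (n / max r 1)) + t₁ + 22) fun r s' =>
            s'.reg 1 = r ∧ s'.reg 0 = n ∧ s'.reg 8 = 1 ∧ s'.reg 9 = 0 := by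
        refine htest.trans (t₂ := fun _ r => k * (guessTime D l * (n / max r 1)) + 22)
          (fun b _ s₂ hs₂ => ?_) fun _ _ _ _ => by omega
        obtain ⟨hb, hk⟩ := hs₂
        have hk' : ∀ r < 10, r ≠ 3 → r ≠ 4 → r ≠ 5 → r ≠ 6 → r ≠ 7 → s₂.reg r = s.reg r :=
          fun r hr h3 h4 h5 h6 h7 => by rw [hk r hr h4 h5 h6 h7, ar r hr h3 h4 h5]
        have g0 : s₂.reg 0 = n := by rw [hk'] <;> norm_num; exact h0
        have g2 : s₂.reg 2 = l := by rw [hk'] <;> norm_num; exact h2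
        have c2 : Consts T s₂ := ⟨by rw [hk'] <;> norm_num; exact hs.threshold,
          by rw [hk'] <;> norm_num; exact hs.one, by rw [hk'] <;> norm_num; exact hs.zero⟩
        obtain ⟨b1, b13, br⟩ := conclude_eval (L := L) (w := w) c2 (by omega) (by omega)
        refine Refines.plain_cons conclude_plain
          (t := fun r => k * (guessTime D l * (n / max r 1)) + 1) ?_
          fun r _ => by clear * - hds; omega
        have f0 : (conclude.eval w L s₂).reg 0 = n := by
          rw [br _ (by norm_num) (by norm_num), g0]
        have f2 : (conclude.eval w L s₂).reg 2 = l := by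
          rw [br _ (by norm_num) (by norm_num), g2]
        have f8 : (conclude.eval w L s₂).reg 8 = 1 := by
          rw [br _ (by norm_num) (by norm_num), c2.one]
        have f9 : (conclude.eval w L s₂).reg 9 = 0 := by
          rw [br _ (by norm_num) (by norm_num), c2.zero]
        cases b
        · have hb5 : s₂.reg 5 ≠ 0 := fun h => by simpa using hb.1 h
          rw [if_neg hb5] at b1 b13
          rw [if_neg (by simp)]
          exact ih (by rw [pow_succ] at hT; omega) (by omega) ⟨b1, f8, f9⟩ f0 f2 b13
        · have hb5 : s₂.reg 5 = 0 := hb.2 rfl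
          rw [if_pos hb5] at b1 b13
          rw [if_pos rfl]
          exact Refines.loop_false (t := fun _ => 0) b13 (.of_eq ⟨b1, f0, f8, f9⟩)
            fun _ _ => by omega
      refine Refines.loop_true (t := fun r => k * (guessTime D l * (n / max r 1)) + t₁ + 44)
        (by rw [h13]; exact hT0) ?_ fun r hr => ?_
      · refine Refines.seq (t := fun r => k * (guessTime D l * (n / max r 1)) + t₁ + 43) ?_
          fun _ _ => by omega
        refine Refines.plain_cons setup_plain
          (t := fun r => k * (guessTime D l * (n / max r 1)) + t₁ + 23) ?_
          fun _ _ => by clear * - hss; omega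
        refine Refines.seq main fun _ _ => by omega
      · have hr' : r ≤ T := by
          rw [PMF.bind_apply_ne_zero] at hr
          obtain ⟨b, -, hr⟩ := hr
          split_ifs at hr
          · rw [PMF.pure_apply_ne_zero] at hr; omega
          · have := search_le hr; omega
        have hX : n / T ≤ n / max r 1 := Nat.div_le_div_left (by omega) (by omega)
        have hX1 : 1 ≤ n / max r 1 := (Nat.one_le_div_iff (by omega)).2 (by omega)
        have := testerTime_le (D := D) (l := l) hX1 hX
        rw [← ht₁] at this
        rw [Nat.succ_mul]
        clear * - this
        omega

/-- The loop `probe` finds out whether one of the first `j` vertices has a neighbour. -/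
theorem probe_refines (j : ℕ) : ∀ {f : ℕ} {s : Store}, 0 < w → s.reg 8 = 1 → s.reg 4 = j →
    s.reg 14 = f → j ≤ n →
    Refines w L (.loop 4 probe :: K) s K (PMF.pure ()) (fun _ => 21 * j + 1) fun _ s' =>
      s'.reg 14 = (if ∃ v : Fin n, (v : ℕ) < j ∧ (L.nbrs v).length ≠ 0 then 1 else f) ∧
      s'.reg 9 = s.reg 9 := by
  induction j with
  | zero =>
    intro f s _ h8 h4 h14 _
    exact Refines.loop_false (t := fun _ => 0) h4 (.of_eq ⟨by simpa using h14, rfl⟩)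
      fun _ _ => by simp
  | succ j ih =>
    intro f s hw h8 h4 h14 hj
    have h1 : 1 % 2 ^ w = 1 := Nat.mod_eq_of_lt (Nat.one_lt_two_pow hw.ne')
    have hd : L.degreeQuery (j + 1) = (L.nbrs ⟨j, hj⟩).length := L.degreeQuery_succ ⟨j, hj⟩
    set f' := if (L.nbrs ⟨j, hj⟩).length = 0 then f else 1 with hf'
    have e : (probe.eval w L s).reg 4 = j ∧ (probe.eval w L s).reg 14 = f' ∧
        (probe.eval w L s).reg 8 = 1 ∧ (probe.eval w L s).reg 9 = s.reg 9 := by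
      by_cases h : (L.nbrs ⟨j, hj⟩).length = 0 <;>
      simp [probe, block, Cmd.eval, BinOp.eval, h4, hd, h, h8, h14, hf', h1]
    obtain ⟨e4, e14, e8, e9⟩ := e
    have hps := probe_size
    refine Refines.loop_true (t := fun _ => 21 * j + 21) (by rw [h4]; omega) ?_ fun _ _ => by omega
    refine Refines.plain_cons probe_plain (t := fun _ => 21 * j + 1) ?_
      fun _ _ => by clear * - hps; omega
    refine (ih hw e8 e4 e14 (by omega)).mono (fun _ _ => le_rfl) fun _ _ s' hs' =>
      ⟨?_, by rw [hs'.2, e9]⟩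
    rw [hs'.1, hf']
    have key : (∃ v : Fin n, (v : ℕ) < j + 1 ∧ (L.nbrs v).length ≠ 0) ↔
        (∃ v : Fin n, (v : ℕ) < j ∧ (L.nbrs v).length ≠ 0) ∨ (L.nbrs ⟨j, hj⟩).length ≠ 0 := by
      constructor
      · rintro ⟨v, hv, hv'⟩
        rcases Nat.lt_succ_iff_lt_or_eq.1 hv with h | h
        · exact Or.inl ⟨v, h, hv'⟩
        · subst h; exact Or.inr hv'
      · rintro (⟨v, hv, hv'⟩ | h)
        · exact ⟨v, by omega, hv'⟩
        · exact ⟨⟨j, hj⟩, by simp, h⟩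
    by_cases ha : ∃ v : Fin n, (v : ℕ) < j ∧ (L.nbrs v).length ≠ 0
    · rw [if_pos ha, if_pos (key.2 (Or.inl ha))]
    · by_cases hb : (L.nbrs ⟨j, hj⟩).length = 0
      · rw [if_neg ha, if_pos hb, if_neg fun h => ?_]
        rcases key.1 h with h | h
        · exact ha h
        · exact h hb
      · rw [if_neg ha, if_neg hb, if_pos (key.2 (Or.inr hb))]

end Peeling

/-! ### Correctness of the program -/

namespace Peeling

open Peeler WordRAM

variable {n : ℕ} {G : SimpleGraph (Fin n)} {w : ℕ} {L : IncidenceList G}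

open Code WordRAM.Cmd

open Classical in
/-- The output of the program, if the search has ended with the threshold `r`. If `r = 0`, the
arboricity is less than `480`, and it only matters whether it is positive. -/
noncomputable def estimate (L : IncidenceList G) (r : ℕ) : ℕ :=
  if r = 0 then (if ∃ v, (L.nbrs v).length ≠ 0 then 1 else 0) else max 1 (r / 32)

theorem finish_refines {K : List Cmd} (hw : 32 < 2 ^ w) (hnw : n < 2 ^ w) {s : Store} {r : ℕ}
    (hrn : r ≤ n) (h0 : s.reg 0 = n) (h1 : s.reg 1 = r) (h8 : s.reg 8 = 1) (h9 : s.reg 9 = 0) :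
    Refines w L (.ite 1 report scan :: K) s K (PMF.pure ()) (fun _ => 21 * (n / max r 1) + 40)
      fun _ s' => s'.reg 0 = estimate L r := by
  have hw0 : 0 < w := by
    by_contra h
    simp [Nat.eq_zero_of_not_pos h] at hw
  have e1 : 1 % 2 ^ w = 1 := Nat.mod_eq_of_lt (by omega)
  refine Refines.ite (t := fun _ => 21 * (n / max r 1) + 39) ?_ fun _ _ => by omega
  by_cases hr : r = 0
  · subst hr
    rw [h1, if_neg (by simp)]
    have hm : n / max 0 1 = n := by simp
    rw [hm]
    refine Refines.seq (t := fun _ => 21 * n + 30) ?_ fun _ _ => by omega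
    set s₁ := (block [.const 14 0, .bin .add 4 0 9] : Cmd).eval w L s with hs₁
    have g4 : s₁.reg 4 = n := by
      simp [hs₁, block, Cmd.eval, BinOp.eval, h0, h9, Nat.mod_eq_of_lt hnw]
    have g14 : s₁.reg 14 = 0 := by simp [hs₁, block, Cmd.eval]
    have g8 : s₁.reg 8 = 1 := by simp [hs₁, block, Cmd.eval, h8]
    have g9 : s₁.reg 9 = 0 := by simp [hs₁, block, Cmd.eval, h9]
    refine Refines.plain_cons (t := fun _ => 21 * n + 20) (by simp [block, Plain]) ?_
      fun _ _ => by simp [block, Cmd.size]; omega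
    refine Refines.seq (t := fun _ => 21 * n + 10) ?_ fun _ _ => by omega
    have hp := probe_refines (L := L) (K := .bin .add 0 14 9 :: K) n hw0 g8 g4 g14 le_rfl
    have := hp.trans (ν := fun _ => PMF.pure ()) (t₂ := fun _ _ => 1) (K'' := K)
      (t := fun _ => 21 * n + 10)
      (R₂ := fun _ s' => s'.reg 0 = estimate L 0) (fun _ _ s₂ hs₂ => ?_) fun _ _ _ _ => by omega
    · simpa using this
    · obtain ⟨k14, k9⟩ := hs₂
      refine Refines.plain (by simp [Plain]) (by simp [Cmd.size]) ?_
      have e : (∃ v : Fin n, (v : ℕ) < n ∧ (L.nbrs v).length ≠ 0) ↔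
          ∃ v, (L.nbrs v).length ≠ 0 :=
        ⟨fun ⟨v, _, hv⟩ => ⟨v, hv⟩, fun ⟨v, hv⟩ => ⟨v, v.2, hv⟩⟩
      simp only [Cmd.eval, BinOp.eval, Store.setReg_reg, if_true, k14, k9, g9, estimate, e]
      split_ifs <;> simp [e1]
  · rw [h1, if_pos (by simpa using hr)]
    have hs := report_size
    refine Refines.plain report_plain (hs.trans (by omega)) ?_
    have e32 : 32 % 2 ^ w = 32 := Nat.mod_eq_of_lt hw
    have er : r / 32 % 2 ^ w = r / 32 := Nat.mod_eq_of_lt (by omega)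
    by_cases hz : r / 32 = 0
    · simp [report, block, Cmd.eval, BinOp.eval, h1, e32, hz, e1, estimate, hr]
    · have : max 1 (r / 32) = r / 32 := by omega
      have hz' : ¬ r < 32 := by omega
      simp [report, block, Cmd.eval, BinOp.eval, h1, h9, e32, hz, er, estimate, hr, this]

theorem program_refines (hfit : Fits w n (n + 3) (2 * (n + 1))) (hn : 0 < n) {D d l : ℕ}
    (hD : 700 * (Nat.log 2 (n + 1) + 1) + 300 ≤ D) (hl : l = (Nat.log 2 n + 1) * d)
    (hdw : d < 2 ^ w) (hlw : 40 * l * n < 2 ^ w) {s : Store} (h0 : s.reg 0 = n)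
    (h9 : s.reg 9 = 0) :
    Refines w L [program d] s [] (search L.nbrs hn l (Nat.log 2 n + 1) n)
      (fun r => (Nat.log 2 n + 1) * (guessTime D l * (n / max r 1)) + 21 * (Nat.log 2 n + 1) +
        21 * (n / max r 1) + 150) fun r s' => s'.reg 0 = estimate L r := by
  have hadd := hfit.address
  have e1 : 1 % 2 ^ w = 1 := Nat.mod_eq_of_lt (by omega)
  have e2 : 2 % 2 ^ w = 2 := Nat.mod_eq_of_lt (by omega)
  have en : n % 2 ^ w = n := Nat.mod_eq_of_lt (by omega)
  have el : (Nat.log 2 n + 1) * d % 2 ^ w = l := by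
    rw [← hl]
    refine Nat.mod_eq_of_lt (lt_of_le_of_lt ?_ hlw)
    calc l = l * 1 := (mul_one l).symm
      _ ≤ 40 * l * n := Nat.mul_le_mul (by omega) hn
  set c := Nat.log 2 n + 1 with hc
  set s₁ := prelude.eval w L s with hs₁
  have a : s₁.reg 8 = 1 ∧ s₁.reg 15 = 2 ∧ s₁.reg 14 = n ∧ s₁.reg 2 = 0 ∧ s₁.reg 0 = n ∧
      s₁.reg 9 = 0 := by
    simp [hs₁, prelude, block, Cmd.eval, BinOp.eval, h0, h9, e1, e2, en]
  obtain ⟨a8, a15, a14, a2, a0, a9⟩ := a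
  obtain ⟨E, hE⟩ : ∃ E : ℕ → ℕ, E = fun r => c * (guessTime D l * (n / max r 1)) +
    21 * (n / max r 1) := ⟨_, rfl⟩
  have hhalve := halve_refines (L := L) (w := w) (K := [.seq (startSearch d) (.seq (.loop 13 guess)
    (.ite 1 report scan))]) n (c := 0) (s := s₁) a8 a15 a14 a2 (by omega)
  rw [if_neg hn.ne', ← hc] at hhalve
  have main : Refines w L [.loop 14 halve, .seq (startSearch d) (.seq (.loop 13 guess)
      (.ite 1 report scan))] s₁ [] (search L.nbrs hn l c n) (fun r => E r + 21 * c + 100)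
      fun r s' => s'.reg 0 = estimate L r := by
    have := hhalve.trans (ν := fun _ => search L.nbrs hn l c n) (K'' := [])
      (t := fun r => E r + 21 * c + 100)
      (t₂ := fun _ r => E r + 90) (R₂ := fun r s' => s'.reg 0 = estimate L r)
      (fun _ _ s₂ hs₂ => ?_) fun _ _ _ _ => by omega
    · simpa using this
    obtain ⟨b2, br⟩ := hs₂
    rw [zero_add] at b2
    set s₃ := (startSearch d).eval w L s₂ with hs₃
    have b0 : s₂.reg 0 = n := by rw [br _ (by norm_num) (by norm_num), a0]
    have b8 : s₂.reg 8 = 1 := by rw [br _ (by norm_num) (by norm_num), a8]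
    have b9 : s₂.reg 9 = 0 := by rw [br _ (by norm_num) (by norm_num), a9]
    have q : s₃.reg 2 = l ∧ s₃.reg 1 = n ∧ s₃.reg 13 = n ∧ s₃.reg 0 = n ∧ s₃.reg 8 = 1 ∧
        s₃.reg 9 = 0 := by
      simp [hs₃, startSearch, block, Cmd.eval, BinOp.eval, b2, b0, b8, b9, en,
        Nat.mod_eq_of_lt hdw, el]
    obtain ⟨q2, q1, q13, q0, q8, q9⟩ := q
    have hbs := startSearch_size d
    refine Refines.seq (t := fun r => E r + 80) ?_ fun _ _ => by omega
    refine Refines.plain_cons (startSearch_plain d) (t := fun r => E r + 50) ?_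
      fun _ _ => by clear * - hbs; omega
    refine Refines.seq (t := fun r => E r + 49) ?_ fun _ _ => by omega
    have hsearch := search_refines (L := L) (K := [.ite 1 report scan]) hfit hn hD hlw c (T := n)
      (s := s₃) (Nat.lt_pow_succ_log_self (by norm_num) n) le_rfl ⟨q1, q8, q9⟩ q0 q2 q13
    rw [← PMF.bind_pure (search L.nbrs hn l c n)]
    refine hsearch.trans (t₂ := fun r _ => 21 * (n / max r 1) + 40) (fun r hr s₄ hs₄ => ?_)
      fun r r' _ hr' => ?_
    · obtain ⟨u1, u0, u8, u9⟩ := hs₄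
      have hf := finish_refines (L := L) (w := w) (K := []) (by omega) (by omega)
        (search_le hr) u0 u1 u8 u9
      have := hf.map (f := fun _ => r) (t' := fun _ => 21 * (n / max r 1) + 40)
        (R' := fun r s' => s'.reg 0 = estimate L r) (fun _ _ => le_rfl) fun _ _ _ h => h
      simpa [PMF.pure_map] using this
    · rw [PMF.pure_apply_ne_zero] at hr'
      subst hr'
      rw [hE]
      clear * -
      dsimp only
      omega
  have hps := prelude_size
  rw [program]
  refine Refines.seq (t := fun r => E r + 21 * c + 140) ?_ fun r _ => by
    rw [hE]
    clear * -
    dsimp only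
    omega
  refine Refines.plain_cons prelude_plain (t := fun r => E r + 21 * c + 110) ?_
    fun _ _ => by clear * - hps; omega
  exact Refines.seq main fun _ _ => by omega

end Peeling

/-! ### Running time and word length -/

namespace Peeling

open Peeler WordRAM

variable {n : ℕ} {G : SimpleGraph (Fin n)} {L : IncidenceList G}

theorem estimate_le {r : ℕ} (h : Good (arboricity G) r) : estimate L r ≤ arboricity G := by
  unfold estimate
  split_ifs with h0 hv
  · obtain ⟨v, hv⟩ := hv
    exact L.arboricity_pos_of_length hv
  · exact Nat.zero_le _
  · have := h.2
    omega

theorem le_estimate {r : ℕ} (h : Good (arboricity G) r) :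
    arboricity G ≤ 92160 * estimate L r := by
  have h1 := h.1
  unfold estimate
  split_ifs with h0 hv
  · omega
  · by_contra hpos
    obtain ⟨S, ⟨v, hv'⟩, hS⟩ := L.exists_core (by omega)
    refine hv ⟨v, fun h => ?_⟩
    have := (hS v hv').trans List.countP_le_length
    omega
  · omega

/-- The expected time, if the machine always halts within `T'` steps, and within `T` steps with
probability at least `1 - q`. -/
theorem tsum_not_halted_le (w : ℕ) (x : Config) {T T' : ℕ} {q : ℝ≥0∞}
    (hT : 1 ≤ val w L ({x | x.Halted}.indicator 1) T x + q)
    (hT' : 1 ≤ val w L ({x | x.Halted}.indicator 1) T' x) :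
    ∑' t : ℕ, (steps w L t x).toOuterMeasure {x | ¬ x.Halted} ≤ T + T' * q := by
  have hmono : Monotonic w L ({x | x.Halted}.indicator 1) := monotonic_of_halted fun _ h => h
  have hsum : ∀ t, (steps w L t x).toOuterMeasure {x | ¬ x.Halted} +
      val w L ({x | x.Halted}.indicator 1) t x = 1 := by
    intro t
    rw [PMF.toOuterMeasure_eq_expect, val, ← PMF.expect_add, ← PMF.expect_const (steps w L t x) 1]
    congr 1
    funext y
    by_cases hy : y.Halted <;> simp [hy]
  have hfin : ∀ t, val w L ({x | x.Halted}.indicator 1) t x ≠ ∞ := fun t =>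
    ne_top_of_le_ne_top ENNReal.one_ne_top ((hsum t).symm ▸ le_add_self)
  have hsmall : ∀ t (p : ℝ≥0∞), 1 ≤ val w L ({x | x.Halted}.indicator 1) t x + p →
      (steps w L t x).toOuterMeasure {x | ¬ x.Halted} ≤ p := by
    intro t p h
    rw [← hsum t, add_comm] at h
    exact (ENNReal.add_le_add_iff_left (hfin t)).1 h
  have hterm : ∀ t, (steps w L t x).toOuterMeasure {x | ¬ x.Halted} ≤
      (if t ∈ Finset.range T then 1 else 0) + (if t ∈ Finset.range T' then q else 0) := by
    intro t
    simp only [Finset.mem_range]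
    by_cases h1 : t < T
    · rw [if_pos h1]
      refine le_trans ?_ le_self_add
      exact (hsum t).symm ▸ le_self_add
    · rw [if_neg h1, zero_add]
      split_ifs with h2
      · exact hsmall t q (hT.trans (by gcongr; exact hmono.val_mono (not_lt.1 h1) x))
      · exact hsmall t 0 (by
          rw [add_zero]; exact hT'.trans (hmono.val_mono (not_lt.1 h2) x))
  refine (ENNReal.tsum_le_tsum hterm).trans (le_of_eq ?_)
  rw [ENNReal.tsum_add]
  congr 1
  · rw [tsum_eq_sum (s := Finset.range T) fun t ht => if_neg ht, Finset.sum_ite_mem]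
    simp
  · rw [tsum_eq_sum (s := Finset.range T') fun t ht => if_neg ht, Finset.sum_ite_mem]
    simp

/-- A bound on the running time, in terms of the threshold at the end of the search. -/
theorem time_le {l d X : ℕ} (hl : 1 ≤ l) (hd : 1 ≤ d) (hX : 1 ≤ X) :
    l * (guessTime (1700 * l) (l * d) * X) + 21 * l + 21 * X + 150 ≤ 71000 * d * l ^ 3 * X := by
  have h1 : guessTime (1700 * l) (l * d) ≤ 70270 * (d * l ^ 2) := by
    unfold guessTime
    have a1 : l * d ≤ d * l ^ 2 := by nlinarith [Nat.mul_le_mul_left (l * d) hl]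
    have a2 : l ≤ d * l ^ 2 := le_trans (Nat.le_mul_of_pos_right _ hd) a1
    have a3 : 1700 * l * (40 * (l * d) + 1) = 68000 * (d * l ^ 2) + 1700 * l := by ring
    rw [a3]
    omega
  have h2 : l * (guessTime (1700 * l) (l * d) * X) ≤ 70270 * (d * l ^ 3 * X) := by
    calc l * (guessTime (1700 * l) (l * d) * X) ≤ l * (70270 * (d * l ^ 2) * X) := by gcongr
      _ = 70270 * (d * l ^ 3 * X) := by ring
  have hl3 : l ≤ l ^ 3 := Nat.le_self_pow (by norm_num) l
  have h3 : l ≤ d * l ^ 3 * X := by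
    calc l = 1 * l * 1 := by ring
      _ ≤ d * l ^ 3 * X := by gcongr
  have h4 : X ≤ d * l ^ 3 * X := by
    refine Nat.le_mul_of_pos_left _ ?_
    positivity
  have h5 : 71000 * d * l ^ 3 * X = 71000 * (d * l ^ 3 * X) := by ring
  rw [h5]
  omega

theorem log_le_of_pos (hn : 0 < n) : ((Nat.log 2 n + 1 : ℕ) : ℝ) ≤ 3 * Real.log (n + 1) := by
  have h2 : (0.6931471803 : ℝ) < Real.log 2 := Real.log_two_gt_d9
  have h1 : (Nat.log 2 n : ℝ) * Real.log 2 ≤ Real.log (n + 1) := by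
    rw [← Real.log_pow]
    apply Real.log_le_log (by positivity)
    have : 2 ^ Nat.log 2 n ≤ n := Nat.pow_log_le_self 2 hn.ne'
    have : ((2 ^ Nat.log 2 n : ℕ) : ℝ) ≤ n := by exact_mod_cast this
    push_cast at this
    linarith
  have h3 : Real.log 2 ≤ Real.log (n + 1) := by
    apply Real.log_le_log (by norm_num)
    have : (1 : ℝ) ≤ n := by exact_mod_cast hn
    linarith
  have h4 : (0 : ℝ) ≤ Nat.log 2 n := by positivity
  push_cast
  nlinarith

/-- The union bound over `l` thresholds, where the tester repeats `l * (a + 1)` times. -/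
theorem failure_le (a l : ℕ) (hl : 1 ≤ l) :
    (l : ℝ) * Real.exp (-(20 * (l * (a + 1) : ℕ))) ≤ 1 / (2 ^ l) ^ (a + 6) := by
  have h1 : (l : ℝ) ≤ 2 ^ l := by exact_mod_cast (Nat.lt_two_pow_self (n := l)).le
  have h2 : Real.exp (-(20 * (l * (a + 1) : ℕ))) ≤ 1 / (2 ^ l) ^ (a + 7) := by
    rw [Real.exp_neg, ← one_div]
    apply one_div_le_one_div_of_le (by positivity)
    have h3 : (2 : ℝ) ≤ Real.exp 1 := by
      have := Real.add_one_le_exp (1 : ℝ)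
      linarith
    calc ((2 : ℝ) ^ l) ^ (a + 7) = 2 ^ (l * (a + 7)) := by rw [pow_mul]
      _ ≤ 2 ^ (20 * (l * (a + 1))) := by
          apply pow_le_pow_right₀ (by norm_num)
          nlinarith
      _ ≤ Real.exp 1 ^ (20 * (l * (a + 1))) := by gcongr
      _ = _ := by
        rw [← Real.exp_nat_mul]
        congr 1
        push_cast
        ring
  calc (l : ℝ) * Real.exp (-(20 * (l * (a + 1) : ℕ))) ≤ 2 ^ l * (1 / (2 ^ l) ^ (a + 7)) := by
        gcongr
    _ = _ := by
      rw [pow_succ _ (a + 6)]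
      field_simp

/-- The algorithm: the word length factor and the number of repetitions depend on the exponent of
the error probability. -/
def algorithm (a : ℕ) : Algorithm := ⟨Code.program (a + 1), a + 20, by omega⟩

theorem two_pow_wordLength (a : ℕ) : 2 ^ (algorithm a).wordLength n =
    (2 ^ (Nat.log 2 n + 1)) ^ (a + 20) := by
  rw [← pow_mul, Algorithm.wordLength, algorithm, mul_comm]

/-- The words are long enough, since `n < 2 ^ (Nat.log 2 n + 1)`. -/
theorem fits_wordLength (n a : ℕ) :
    Fits ((algorithm a).wordLength n) n (n + 3) (2 * (n + 1)) ∧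
      a + 1 < 2 ^ (algorithm a).wordLength n ∧
      40 * ((Nat.log 2 n + 1) * (a + 1)) * n < 2 ^ (algorithm a).wordLength n := by
  have hX : n < 2 ^ (Nat.log 2 n + 1) := Nat.lt_pow_succ_log_self (by norm_num) n
  have hl : Nat.log 2 n + 1 < 2 ^ (Nat.log 2 n + 1) := Nat.lt_two_pow_self
  have hX2 : 2 ≤ 2 ^ (Nat.log 2 n + 1) := Nat.le_self_pow (by omega) 2
  have hw : 1 < (algorithm a).wordLength n := by
    unfold Algorithm.wordLength algorithm
    nlinarith
  have key := two_pow_wordLength (n := n) a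
  generalize 2 ^ (Nat.log 2 n + 1) = X at hX hl hX2 key
  generalize Nat.log 2 n + 1 = l at hl
  have ha : a + 1 < X ^ (a + 1) := (Nat.lt_two_pow_self).trans_le (Nat.pow_le_pow_left hX2 _)
  have hpow : ∀ k, 2 ^ k ≤ X ^ k := fun k => Nat.pow_le_pow_left hX2 k
  have hlt : ∀ k, k < a + 20 → X ^ k < 2 ^ (algorithm a).wordLength n := fun k hk => by
    rw [key]; exact Nat.pow_lt_pow_right (by omega) hk
  have h2 : 2 * X ≤ X ^ 2 := by rw [pow_two]; exact Nat.mul_le_mul_right _ hX2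
  refine ⟨⟨?_, ?_, ?_, hw⟩, ha.trans (hlt _ (by omega)), ?_⟩
  · refine lt_of_le_of_lt ?_ (hlt 7 (by omega))
    calc 16 * (n + 3) ≤ 2 ^ 5 * (2 * X) := by omega
      _ ≤ X ^ 5 * X ^ 2 := Nat.mul_le_mul (hpow 5) h2
      _ = X ^ 7 := by ring
  · exact lt_of_le_of_lt (by omega) (hlt 2 (by omega))
  · refine lt_of_le_of_lt ?_ (hlt 4 (by omega))
    calc 2 * (n + 1) * (n + 2) ≤ 2 * X * (2 * X) := Nat.mul_le_mul (by omega) (by omega)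
      _ ≤ X ^ 2 * X ^ 2 := Nat.mul_le_mul h2 h2
      _ = X ^ 4 := by ring
  · refine lt_of_le_of_lt ?_ (hlt (a + 9) (by omega))
    calc 40 * (l * (a + 1)) * n ≤ 2 ^ 6 * (X * X ^ (a + 1)) * X :=
          Nat.mul_le_mul (Nat.mul_le_mul (by norm_num) (Nat.mul_le_mul hl.le ha.le)) hX.le
      _ ≤ X ^ 6 * (X * X ^ (a + 1)) * X := by gcongr
      _ = X ^ (a + 9) := by ring

end Peeling

/-! ### The guarantee of the algorithm -/

namespace Peeling

open Peeler WordRAM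

variable {n : ℕ} {G : SimpleGraph (Fin n)}

/-- A run of the machine simulates the abstract search, in time proportional to `n` divided by the
threshold at the end of the search. -/
theorem refines_run (L : IncidenceList G) (a : ℕ) (hn : 0 < n) :
    Refines ((algorithm a).wordLength n) L [Code.program (a + 1)] ((algorithm a).init n).store []
      (search L.nbrs hn ((Nat.log 2 n + 1) * (a + 1)) (Nat.log 2 n + 1) n)
      (fun r => 71000 * (a + 1) * (Nat.log 2 n + 1) ^ 3 * (n / max r 1))
      (fun r s => s.reg 0 = estimate L r) := by
  obtain ⟨hfit, hdw, hlw⟩ := fits_wordLength n a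
  have hlog : Nat.log 2 (n + 1) < Nat.log 2 n + 1 + 1 := by
    refine Nat.log_lt_of_lt_pow (by omega) ?_
    have h1 : n < 2 ^ (Nat.log 2 n + 1) := Nat.lt_pow_succ_log_self (by norm_num) n
    rw [pow_succ]
    omega
  refine (program_refines (D := 1700 * (Nat.log 2 n + 1)) hfit hn (by omega) rfl hdw hlw
    ?_ ?_).mono (fun r hr => ?_) fun _ _ _ h => h
  · simp [Algorithm.init]
  · simp [Algorithm.init]
  · have hr' : r ≤ n := search_le hr
    exact time_le (by omega) (by omega) ((Nat.one_le_div_iff (by omega)).2 (by omega))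

/-- The probability that the machine halts in time and in a given event is at least the
probability that the abstract search has an outcome for which it does. -/
theorem expect_search_le_val (L : IncidenceList G) (a : ℕ) (hn : 0 < n) {E : Set Config}
    (hE : ∀ x ∈ E, x.Halted) {T : ℕ} {p : ℕ → Prop} [DecidablePred p]
    (hT : ∀ r ≤ n, p r → 71000 * (a + 1) * (Nat.log 2 n + 1) ^ 3 * (n / max r 1) ≤ T)
    (hp : ∀ r, p r → ∀ s : Store, s.reg 0 = estimate L r → ⟨[], s⟩ ∈ E) :
    (search L.nbrs hn ((Nat.log 2 n + 1) * (a + 1)) (Nat.log 2 n + 1) n).expect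
        (fun r => if p r then 1 else 0) ≤
      val ((algorithm a).wordLength n) L (E.indicator 1) T ((algorithm a).init n) := by
  have hmono := monotonic_of_halted (w := (algorithm a).wordLength n) (L := L) hE
  refine refines_run L a hn _ hmono T _ fun r hr hr' => ?_
  have hpr : p r := by
    by_contra h
    simp [h] at hr'
  refine ⟨hT r (search_le hr) hpr, fun s hs => ?_⟩
  refine le_trans ?_ (hmono.val_mono (Nat.zero_le _) _)
  rw [val_zero, Set.indicator_of_mem (hp r hpr s hs), if_pos hpr]
  rfl

open Classical in
/-- The search ends at a good threshold with high probability. -/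
theorem one_le_expect_good (L : IncidenceList G) (a : ℕ) (hn : 0 < n) :
    1 ≤ (search L.nbrs hn ((Nat.log 2 n + 1) * (a + 1)) (Nat.log 2 n + 1) n).expect
        (fun r => if Good (arboricity G) r then 1 else 0) +
      ENNReal.ofReal (1 / (2 ^ (Nat.log 2 n + 1)) ^ (a + 6)) := by
  have hα := G.arboricity_le_card
  rw [Fintype.card_fin] at hα
  have hbad := search_not_good_le L hn ((Nat.log 2 n + 1) * (a + 1)) (Nat.log 2 n + 1) n
    (Nat.lt_pow_succ_log_self (by norm_num) n) le_rfl (by omega)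
  rw [← ENNReal.ofReal_natCast (Nat.log 2 n + 1), ← ENNReal.ofReal_mul (by positivity)] at hbad
  have hsmall := hbad.trans (ENNReal.ofReal_le_ofReal (failure_le a (Nat.log 2 n + 1) (by omega)))
  refine le_trans ?_ (add_le_add_right hsmall _)
  rw [← PMF.expect_add]
  refine (PMF.expect_const _ 1).symm.trans_le (PMF.expect_mono fun r => ?_)
  split_ifs <;> simp

/-- At a good threshold, the machine is fast. -/
theorem time_le_of_good {P l r : ℕ} (h : Good (arboricity G) r) :
    P * l ^ 3 * (n / max r 1) ≤
      ⌊1440 * P * (l : ℝ) ^ 3 * ((n : ℝ) / max 1 (arboricity G : ℝ))⌋₊ := by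
  have h1 : max 1 (arboricity G) ≤ 1440 * max r 1 := by
    have := h.1
    omega
  have h2 : max 1 (arboricity G : ℝ) ≤ 1440 * ((max r 1 : ℕ) : ℝ) := by exact_mod_cast h1
  have h3 : (0 : ℝ) < ((max r 1 : ℕ) : ℝ) := by
    have : 0 < max r 1 := by omega
    exact_mod_cast this
  have h4 : (n : ℝ) / ((max r 1 : ℕ) : ℝ) ≤ 1440 * ((n : ℝ) / max 1 (arboricity G : ℝ)) := by
    rw [← mul_div_assoc, div_le_div_iff₀ h3 (by positivity)]
    nlinarith [Nat.cast_nonneg (α := ℝ) n]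
  apply Nat.le_floor
  calc ((P * l ^ 3 * (n / max r 1) : ℕ) : ℝ) = P * l ^ 3 * ((n / max r 1 : ℕ) : ℝ) := by
        push_cast; ring
    _ ≤ P * l ^ 3 * (1440 * ((n : ℝ) / max 1 (arboricity G : ℝ))) := by
        gcongr
        exact Nat.cast_div_le.trans h4
    _ = _ := by ring

/-- The bound of the theorem leaves room for the time of a good run, and for the contribution of
the bad ones. -/
theorem time_add_le_softBound (G : SimpleGraph (Fin n)) (P : ℕ) (hn : 0 < n) :
    1440 * P * ((Nat.log 2 n + 1 : ℕ) : ℝ) ^ 3 * ((n : ℝ) / max 1 (arboricity G : ℝ)) + P ≤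
      softBound (27 * 1441 * P) 3 G := by
  have hlog := log_le_of_pos hn
  have hl : (1 : ℝ) ≤ ((Nat.log 2 n + 1 : ℕ) : ℝ) := by exact_mod_cast Nat.le_add_left 1 _
  have hn' : (1 : ℝ) ≤ n := by exact_mod_cast hn
  have hα : (arboricity G : ℝ) ≤ n := by simpa using G.arboricity_le_card
  have hQ : 1 ≤ (n : ℝ) / max 1 (arboricity G : ℝ) := by
    rw [le_div_iff₀ (by positivity), one_mul]
    exact max_le hn' hα
  unfold softBound
  generalize (n : ℝ) / max 1 (arboricity G : ℝ) = Q at hQ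
  generalize ((Nat.log 2 n + 1 : ℕ) : ℝ) = l at hlog hl
  have h3 : l ^ 3 ≤ 27 * Real.log (n + 1) ^ 3 := by
    calc l ^ 3 ≤ (3 * Real.log (n + 1)) ^ 3 := by gcongr
      _ = _ := by ring
  have h1 : 1 ≤ l ^ 3 * Q := one_le_mul_of_one_le_of_one_le (one_le_pow₀ hl) hQ
  calc 1440 * P * l ^ 3 * Q + P ≤ 1440 * P * l ^ 3 * Q + P * (l ^ 3 * Q) := by
        gcongr
        exact le_mul_of_one_le_right (by positivity) h1
    _ = 1441 * P * Q * l ^ 3 := by ring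
    _ ≤ 1441 * P * Q * (27 * Real.log (n + 1) ^ 3) := by gcongr
    _ = _ := by ring

theorem ofReal_failure_le (a : ℕ) :
    ENNReal.ofReal (1 / (2 ^ (Nat.log 2 n + 1)) ^ (a + 6)) ≤ 1 / (n : ℝ≥0∞) ^ a := by
  have h1 : n < 2 ^ (Nat.log 2 n + 1) := Nat.lt_pow_succ_log_self (by norm_num) n
  have h2 : n ^ a ≤ (2 ^ (Nat.log 2 n + 1)) ^ (a + 6) :=
    (Nat.pow_le_pow_left h1.le a).trans (Nat.pow_le_pow_right (by positivity) (by omega))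
  rw [one_div, one_div, ENNReal.ofReal_inv_of_pos (by positivity)]
  apply ENNReal.inv_le_inv.2
  have h3 : ((2 : ℝ) ^ (Nat.log 2 n + 1)) ^ (a + 6) =
      (((2 ^ (Nat.log 2 n + 1)) ^ (a + 6) : ℕ) : ℝ) := by push_cast; rfl
  rw [h3, ENNReal.ofReal_natCast]
  exact_mod_cast h2

/-- The expected time is not affected by the bad runs: their number of steps is polynomial, and the
probability of failure is smaller. -/
theorem max_time_mul_failure_le (P a : ℕ) :
    ((P * (Nat.log 2 n + 1) ^ 3 * n : ℕ) : ℝ≥0∞) *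
      ENNReal.ofReal (1 / (2 ^ (Nat.log 2 n + 1)) ^ (a + 6)) ≤ ENNReal.ofReal P := by
  rw [← ENNReal.ofReal_natCast, ← ENNReal.ofReal_mul (by positivity)]
  apply ENNReal.ofReal_le_ofReal
  have h1 : n < 2 ^ (Nat.log 2 n + 1) := Nat.lt_pow_succ_log_self (by norm_num) n
  have h2 : Nat.log 2 n + 1 < 2 ^ (Nat.log 2 n + 1) := Nat.lt_two_pow_self
  rw [mul_one_div, div_le_iff₀ (by positivity)]
  have h3 : P * (Nat.log 2 n + 1) ^ 3 * n ≤ P * (2 ^ (Nat.log 2 n + 1)) ^ (a + 6) := by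
    generalize 2 ^ (Nat.log 2 n + 1) = X at h1 h2
    calc P * (Nat.log 2 n + 1) ^ 3 * n ≤ P * X ^ 3 * X := by gcongr
      _ = P * X ^ 4 := by ring
      _ ≤ P * X ^ (a + 6) := by
        gcongr
        · omega
        · omega
  exact_mod_cast h3

open Classical in
theorem algorithm_correct (L : IncidenceList G) (a : ℕ) (hn : 0 < n) {T : ℕ} {b : ℝ}
    (hT : ∀ r, Good (arboricity G) r →
      71000 * (a + 1) * (Nat.log 2 n + 1) ^ 3 * (n / max r 1) ≤ T) (hb : (T : ℝ) ≤ b) :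
    1 - 1 / (n : ℝ≥0∞) ^ a ≤ ((algorithm a).run L T).toOuterMeasure
      {x | x.Halted ∧ (x.store.queries : ℝ) ≤ b ∧ (arboricity G : ℝ) / 92160 ≤ (x.output : ℝ) ∧
        (x.output : ℝ) ≤ (arboricity G : ℝ)} := by
  rw [tsub_le_iff_right]
  refine (one_le_expect_good L a hn).trans (add_le_add ?_ (ofReal_failure_le a))
  refine (expect_search_le_val L a hn (E := {x | x.Halted ∧
    (arboricity G : ℝ) / 92160 ≤ (x.output : ℝ) ∧ (x.output : ℝ) ≤ (arboricity G : ℝ)})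
    (fun _ h => h.1) (fun r _ h => hT r h) fun r hr s hs => ⟨rfl, ?_, ?_⟩).trans ?_
  · rw [Config.output, hs, div_le_iff₀ (by norm_num), mul_comm]
    exact_mod_cast le_estimate hr
  · rw [Config.output, hs]
    exact_mod_cast estimate_le hr
  · rw [PMF.toOuterMeasure_eq_expect]
    refine PMF.expect_mono_of_support fun x hx => ?_
    -- the bound for the queries follows from the bound for the time
    have hq : x.store.queries ≤ T := by simpa [Algorithm.init] using steps_queries_le hx
    by_cases hxE : x.Halted ∧ (arboricity G : ℝ) / 92160 ≤ (x.output : ℝ) ∧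
        (x.output : ℝ) ≤ (arboricity G : ℝ)
    · rw [Set.indicator_of_mem, Set.indicator_of_mem]
      · exact ⟨hxE.1, (Nat.cast_le.2 hq).trans hb, hxE.2⟩
      · exact hxE
    · rw [Set.indicator_of_notMem (by exact hxE)]
      exact zero_le

open Classical in
theorem algorithm_expectedTime_le (L : IncidenceList G) (a : ℕ) (hn : 0 < n) {T : ℕ}
    (hT : ∀ r, Good (arboricity G) r →
      71000 * (a + 1) * (Nat.log 2 n + 1) ^ 3 * (n / max r 1) ≤ T) :
    (algorithm a).expectedTime L ≤ T + ENNReal.ofReal (71000 * (a + 1) : ℕ) := by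
  have hhalt : ∀ x ∈ {x : Config | x.Halted}, x.Halted := fun _ h => h
  refine (tsum_not_halted_le (T' := 71000 * (a + 1) * (Nat.log 2 n + 1) ^ 3 * n) _ _
    ((one_le_expect_good L a hn).trans (add_le_add (expect_search_le_val L a hn hhalt
      (fun r _ h => hT r h) fun _ _ _ _ => rfl) le_rfl)) ?_).trans
    (add_le_add le_rfl (max_time_mul_failure_le _ a))
  refine le_trans ?_ (expect_search_le_val L a hn hhalt (p := fun _ => True)
    (fun r _ _ => Nat.mul_le_mul_left _ (Nat.div_le_self _ _)) fun _ _ _ _ => rfl)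
  simp [PMF.expect_const]

end Peeling

theorem theorem1 :
    ∃ c : ℝ, 2 ≤ c ∧ ∃ k : ℕ, ∀ a : ℕ, ∃ (A : WordRAM.Algorithm) (C : ℝ),
      ∀ (n : ℕ), 0 < n → ∀ (G : SimpleGraph (Fin n)) (L : IncidenceList G),
        (∃ T : ℕ, (T : ℝ) ≤ softBound C k G ∧
          1 - 1 / (n : ENNReal) ^ a ≤ (A.run L T).toOuterMeasure
            {x | x.Halted ∧ (x.store.queries : ℝ) ≤ softBound C k G ∧
              (arboricity G : ℝ) / c ≤ (x.output : ℝ) ∧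
              (x.output : ℝ) ≤ (arboricity G : ℝ)}) ∧
        A.expectedTime L ≤ ENNReal.ofReal (softBound C k G) := by
  refine ⟨92160, by norm_num, 3, fun a => ⟨Peeling.algorithm a,
    27 * 1441 * (71000 * (a + 1) : ℕ), fun n hn G L => ?_⟩⟩
  have hbound := Peeling.time_add_le_softBound G (71000 * (a + 1)) hn
  have hgood := fun r (hr : Peeling.Good (arboricity G) r) =>
    Peeling.time_le_of_good (P := 71000 * (a + 1)) (l := Nat.log 2 n + 1) hr
  have hfloor := Nat.floor_le (a := 1440 * ((71000 * (a + 1) : ℕ) : ℝ) *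
    ((Nat.log 2 n + 1 : ℕ) : ℝ) ^ 3 * ((n : ℝ) / max 1 (arboricity G : ℝ))) (by positivity)
  have hP : (0 : ℝ) ≤ ((71000 * (a + 1) : ℕ) : ℝ) := Nat.cast_nonneg _
  have hT := hfloor.trans ((le_add_of_nonneg_right hP).trans hbound)
  refine ⟨⟨_, hT, Peeling.algorithm_correct L a hn hgood hT⟩, ?_⟩
  refine (Peeling.algorithm_expectedTime_le L a hn hgood).trans ?_
  rw [← ENNReal.ofReal_natCast ⌊_⌋₊, ← ENNReal.ofReal_add (Nat.cast_nonneg _) hP]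
  exact ENNReal.ofReal_le_ofReal ((add_le_add_left hfloor _).trans hbound)
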